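/- Let $S$ be a finite triangulated closed (compact, boundary-free) oriented surface with vertex set $V$, let $I\subset\mathbb R$ be an interval, and let $(P_t)_{t\in I}$ be a smooth family of polyhedral surfaces in the hyperbolic space $\mathbb H^3$ with combinatorial type $S$: every vertex $v\in V$ is sent to a point $p_t(v)\in\mathbb H^3$ that depends $C^\infty$-smoothly on $t\in I$, and for every $t \in I$ every triangle $abc$ of $S$ is realized by the nondegenerate geodesic triangle with the vertices $p_t(a),p_t(b),p_t(c)$. Self-intersections of $P_t$ are allowed. Suppose that for every edge of $S$ the dihedral angle of $P_t$ at this edge (measured on the side determined by the orientation, modulo $2\pi$) does not depend on $t$. Then the volume bounded by $P_t$ does not depend on $t$. That is: (1) the oriented volume $\sum_{abc}\operatorname{vol}^{\pm}\bigl(o,p_t(a),p_t(b),p_t(c)\bigr)$, the sum of the signed hyperbolic volumes of the geodesic tetrahedra with a fixed apex $o$ over all positively oriented triangles $abc$ of $S$, is the same for all $t\in I$; (2) if $S$ is connected, then the hyperbolic volume of the domain enclosed by $P_t$ (the union of the bounded components of $\mathbb H^3\setminus P_t$) is the same for all those $t\in I$ for which $P_t$ has no self-intersections. -/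

import Mathlib

open scoped ContDiff
open MeasureTheory

noncomputable section

/-! ### Hyperbolic 3-space: the projective (Klein) ball model

The points are those of the open unit ball of `ℝ³`; geodesic segments, triangles and tetrahedra are
the Euclidean ones, so that geodesic convex hulls are ordinary convex hulls. -/

namespace Klein

/-- The ambient Euclidean space of the ball model. -/
abbrev E3 : Type := EuclideanSpace ℝ (Fin 3)

/-- The set of points of hyperbolic 3-space. -/
def space : Set E3 := Metric.ball 0 1

/-- The Riemannian metric of constant curvature `-1` at the point `x` of the model. -/
def metric (x u v : E3) : ℝ :=
  inner ℝ u v / (1 - ‖x‖ ^ 2) + inner ℝ x u * inner ℝ x v / (1 - ‖x‖ ^ 2) ^ 2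

/-- The Riemannian volume density (the square root of the determinant of `metric x`). -/
def density (x : E3) : ℝ := ((1 - ‖x‖ ^ 2) ^ 2)⁻¹

/-- The hyperbolic volume. -/
def vol : Measure E3 :=
  (volume.restrict space).withDensity fun x => ENNReal.ofReal (density x)

/-- The determinant of three vectors. -/
def det3 (u v w : E3) : ℝ := Matrix.det (Matrix.of fun i j => (![u, v, w] i) j)

/-- The part of the tangent vector `w` at `x` which is hyperbolically orthogonal to `u`. -/
def orth (x u w : E3) : E3 := w - (metric x u w / metric x u u) • u

/-- The dihedral angle at the edge `ab` between the half-planes through `c` and through `d`,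
modulo `2π`. The triangles are `abc` and `bad`, so that each of them induces on the edge the
direction opposite to the one induced by the other; the angle is swept by a half-plane which starts
at `abc` and turns away from the positive normal `(b - a) × (c - a)`, until it reaches `bad`.
It is measured in the tangent space at `a`, between the inner conormals of the two triangles:
`x + iy` below is `|n₁| |n₂| (cos α + i sin α)`. For an embedded closed surface with outer positive
normals this is the usual dihedral angle in `(0, 2π)` on the side of the enclosed domain. -/
def dihedralAngle (a b c d : E3) : Real.Angle :=
  let u := b - a
  let n₁ := orth a u (c - a)
  let n₂ := orth a u (d - a)
  ((Complex.arg ⟨metric a n₁ n₂, density a * det3 u n₂ n₁ / √(metric a u u)⟩ : ℝ) : Real.Angle)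

/-- The oriented volume of the tetrahedron with the vertices `0, a, b, c`. -/
def coneVolume (a b c : E3) : ℝ :=
  SignType.sign (det3 a b c) * (vol (convexHull ℝ {0, a, b, c})).toReal

/-- The points enclosed by a set `X`: they lie in components of the complement of `X` in
hyperbolic space that are hyperbolically bounded (contained in a hyperbolic ball about `0`). -/
def enclosed (X : Set E3) : Set E3 :=
  {x | x ∈ space \ X ∧ ∃ r < 1, connectedComponentIn (space \ X) x ⊆ Metric.closedBall 0 r}

end Klein

/-! ### Closed oriented polyhedral surfaces -/

/-- A (finite) triangulated closed oriented surface with vertex set `V`.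
`tri a b c` says that `abc` is a triangle and that `a, b, c` is its positive cyclic order. -/
structure OrientedClosedSurface (V : Type*) where
  /-- The positively ordered triangles. -/
  tri : V → V → V → Prop
  tri_rotate : ∀ {a b c}, tri a b c → tri b c a
  tri_ne : ∀ {a b c}, tri a b c → a ≠ b
  /-- A triangle has just one positive cyclic order. -/
  tri_not_swap : ∀ {a b c}, tri a b c → ¬ tri b a c
  /-- At most one triangle induces a given direction on an edge. -/
  tri_unique : ∀ {a b c d}, tri a b c → tri a b d → c = d
  /-- No boundary, and coherent orientation: across every edge of a triangle there is another
  triangle, and it induces the opposite direction on that edge. -/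
  tri_opposite : ∀ {a b c}, tri a b c → ∃ d, tri b a d
  /-- Every vertex belongs to a triangle. -/
  vertex_mem : ∀ a, ∃ b c, tri a b c
  /-- The link of a vertex is connected (so it is a single cycle). -/
  link_connected : ∀ {v a b c d}, tri v a b → tri v c d →
    Relation.ReflTransGen (fun x y => tri v x y) a c

namespace OrientedClosedSurface

open Klein

variable {V : Type*} (S : OrientedClosedSurface V)

/-- The surface is connected: any two vertices are joined by a path of edges. -/
def Connected : Prop :=
  ∀ v w, Relation.ReflTransGen (fun x y => ∃ z, S.tri x y z) v w

/-- The positions `p` of the vertices define a polyhedral surface in hyperbolic 3-space: all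
vertices are points of the space and every triangle is nondegenerate.
Self-intersections are allowed. -/
def IsPolyhedral (p : V → E3) : Prop :=
  (∀ v, p v ∈ space) ∧ ∀ a b c, S.tri a b c → AffineIndependent ℝ ![p a, p b, p c]

/-- The point set of the polyhedral surface. -/
def carrier (p : V → E3) : Set E3 :=
  {x | ∃ a b c, S.tri a b c ∧ x ∈ convexHull ℝ {p a, p b, p c}}

/-- The polyhedral surface has no self-intersections: two triangles meet only in the (possibly
empty) simplex spanned by their common vertices. -/
def IsEmbedded (p : V → E3) : Prop :=
  ∀ a b c a' b' c', S.tri a b c → S.tri a' b' c' →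
    convexHull ℝ {p a, p b, p c} ∩ convexHull ℝ {p a', p b', p c'} ⊆
      convexHull ℝ (p '' ({a, b, c} ∩ {a', b', c'}))

open Classical in
/-- The oriented (generalized) volume bounded by the surface: the sum, over all triangles, of the
oriented volumes of the cones over them with the common apex `0`. (Each triangle occurs three times
among the ordered triples, by rotation.) -/
def orientedVolume [Fintype V] (p : V → E3) : ℝ :=
  (∑ a, ∑ b, ∑ c, if S.tri a b c then coneVolume (p a) (p b) (p c) else 0) / 3

/-- The hyperbolic volume of the domain enclosed by the surface. -/
def enclosedVolume (p : V → E3) : ENNReal := vol (enclosed (S.carrier p))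

end OrientedClosedSurface

end

/-!
The first half is an infinitesimal statement, the case of constant angles of Schläfli's formula. Let
the surface move and write the oriented volume as a sum of integrals over the triangles of the
2-form `radial 2 2 (‖x‖ ^ 2) * det3 x dx dx`, a primitive of the volume form (`radial_divergence`,
`coneVolume_eq_coneIntegral`). The derivative of the integral over one triangle is the flux of the
velocity through it plus boundary terms. On a moving plane with the normal `N` in Minkowski space
the normal velocity is proportional to `⟨N', x⟩`, and such a function times the area form is exact
(`conormal_curl`); so by Green's theorem the derivative is a sum of terms belonging to the edges
(`hasDerivAt_coneIntegral`). The term of the edge `ab` consists of the volume swept by the triangle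
`0ab`, and of the length of `ab` times the speed with which `N` rotates about the edge
(`edgeTerm`). Across an edge the swept volumes cancel by orientation, and the two rotation speeds
agree because the dihedral angle is constant (`rotation_speed_eq`). Hence the derivative is `0`, and
the mean value theorem gives constancy on the interval (`orientedVolume_eq`).

The second half identifies the volume of the enclosed domain with the absolute value of the oriented
volume (`IsEmbedded.enclosedVolume_eq`). Count the tetrahedra with an apex `o` over the triangles
which contain a point `x`, with signs. For `x` in general position this `winding` number does not
depend on `o`: moving the apex changes the count by contributions of the edges, which cancel
(`signedInd_sub_signedInd`, `winding_apex`). Choosing the apex on the line through two points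
`x`, `x'` shows that the number is constant along segments which avoid the surface, and that it
jumps by `1` where a segment crosses a single triangle. Thus it is constant on the components of the
complement and vanishes on unbounded ones.

For an embedded connected surface the complement has exactly two components. Each side of a triangle
belongs to one component; an arc in the wedge between two adjacent triangles (`exists_arc`) shows
that this is the same component for both, and by connectedness all triangles have the same component
on the sides of the same sign (`IsEmbedded.triSide_of_connected`). Every component contains such a
side, as one sees by walking from one of its points to the surface while avoiding the edges
(`IsEmbedded.exists_triSide_of_component`). The winding numbers of the two components differ by `1`
and some component is unbounded; so, up to a global sign, the winding number is the indicator
function of the enclosed domain (`IsEmbedded.winding_eq`). Integrating it gives the oriented volume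
with the apex `o`, and the apex `0` is reached by continuity.
-/

noncomputable section

namespace Klein

open Set Filter Topology

/-! ### Planes, edges and dihedral angles in Minkowski space -/

theorem det3_eq (u v w : E3) : det3 u v w =
    u 0 * (v 1 * w 2 - v 2 * w 1) - u 1 * (v 0 * w 2 - v 2 * w 0)
      + u 2 * (v 0 * w 1 - v 1 * w 0) := by
  simp [det3, Matrix.det_fin_three]
  ring

theorem inner_eq (u v : E3) : inner ℝ u v = u 0 * v 0 + u 1 * v 1 + u 2 * v 2 := by
  simp [PiLp.inner_apply, Fin.sum_univ_three]
  ring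

theorem norm_sq_eq (u : E3) : ‖u‖ ^ 2 = u 0 ^ 2 + u 1 ^ 2 + u 2 ^ 2 := by
  rw [← real_inner_self_eq_norm_sq, inner_eq]
  ring

/-- The Lorentz form of signature `(3, 1)` on `ℝ⁴`; the coordinate `0` is the timelike one. -/
def lor (X Y : Fin 4 → ℝ) : ℝ := X 1 * Y 1 + X 2 * Y 2 + X 3 * Y 3 - X 0 * Y 0

/-- The homogeneous coordinates `(1, x)` of a point of the ball model. -/
def lift (x : E3) : Fin 4 → ℝ := ![1, x 0, x 1, x 2]

/-- The vector `(0, x)` of `ℝ⁴`, which is the derivative of `lift` in the direction `x`. -/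
def lift₀ (x : E3) : Fin 4 → ℝ := ![0, x 0, x 1, x 2]

/-- The determinant of four vectors of `ℝ⁴`. -/
def det4 (X Y Z W : Fin 4 → ℝ) : ℝ :=
  X 0 * (Y 1 * (Z 2 * W 3 - Z 3 * W 2) - Y 2 * (Z 1 * W 3 - Z 3 * W 1)
      + Y 3 * (Z 1 * W 2 - Z 2 * W 1))
    - X 1 * (Y 0 * (Z 2 * W 3 - Z 3 * W 2) - Y 2 * (Z 0 * W 3 - Z 3 * W 0)
      + Y 3 * (Z 0 * W 2 - Z 2 * W 0))
    + X 2 * (Y 0 * (Z 1 * W 3 - Z 3 * W 1) - Y 1 * (Z 0 * W 3 - Z 3 * W 0)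
      + Y 3 * (Z 0 * W 1 - Z 1 * W 0))
    - X 3 * (Y 0 * (Z 1 * W 2 - Z 2 * W 1) - Y 1 * (Z 0 * W 2 - Z 2 * W 0)
      + Y 2 * (Z 0 * W 1 - Z 1 * W 0))

/-- The plane through `a, b, c` is `{x | lor (normal a b c) (lift x) = 0}`. -/
def normal (a b c : E3) : Fin 4 → ℝ :=
  ![det3 a b c,
    (b 1 - a 1) * (c 2 - a 2) - (b 2 - a 2) * (c 1 - a 1),
    (b 2 - a 2) * (c 0 - a 0) - (b 0 - a 0) * (c 2 - a 2),
    (b 0 - a 0) * (c 1 - a 1) - (b 1 - a 1) * (c 0 - a 0)]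

/-- The linear relation between five vectors of `ℝ⁴`, paired with a sixth one. -/
theorem lor_det4_cramer (Y X₁ X₂ X₃ X₄ X₅ : Fin 4 → ℝ) :
    lor Y X₁ * det4 X₂ X₃ X₄ X₅ - lor Y X₂ * det4 X₁ X₃ X₄ X₅ + lor Y X₃ * det4 X₁ X₂ X₄ X₅
      - lor Y X₄ * det4 X₁ X₂ X₃ X₅ + lor Y X₅ * det4 X₁ X₂ X₃ X₄ = 0 := by
  simp only [lor, det4]
  ring

theorem lor_comm (X Y : Fin 4 → ℝ) : lor X Y = lor Y X := by
  simp only [lor]; ring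

theorem normal_rotate (a b c : E3) : normal b c a = normal a b c := by
  ext i
  fin_cases i <;> simp [normal, det3_eq] <;> ring

theorem lor_normal_left (a b c : E3) : lor (normal a b c) (lift a) = 0 := by
  simp [lor, normal, lift, det3_eq]; ring

theorem lor_normal_mid (a b c : E3) : lor (normal a b c) (lift b) = 0 := by
  rw [← normal_rotate]; exact lor_normal_left _ _ _

theorem lor_normal_right (a b c : E3) : lor (normal a b c) (lift c) = 0 := by
  rw [← normal_rotate]; exact lor_normal_mid _ _ _

/-- Minus the Gram determinant of two vectors of Minkowski space. -/
def gram (A B : Fin 4 → ℝ) : ℝ := lor A B ^ 2 - lor A A * lor B B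

theorem metric_eq (x u v : E3) : metric x u v =
    (u 0 * v 0 + u 1 * v 1 + u 2 * v 2) / (1 - (x 0 ^ 2 + x 1 ^ 2 + x 2 ^ 2)) +
    (x 0 * u 0 + x 1 * u 1 + x 2 * u 2) * (x 0 * v 0 + x 1 * v 1 + x 2 * v 2) /
      (1 - (x 0 ^ 2 + x 1 ^ 2 + x 2 ^ 2)) ^ 2 := by
  simp only [metric, inner_eq, norm_sq_eq]

theorem one_sub_norm_sq_pos {x : E3} (hx : x ∈ space) : 0 < 1 - ‖x‖ ^ 2 := by
  have h : ‖x‖ < 1 := by simpa [space] using hx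
  nlinarith [norm_nonneg x]

theorem metric_self_pos {x u : E3} (hx : x ∈ space) (hu : u ≠ 0) : 0 < metric x u u := by
  have h := one_sub_norm_sq_pos hx
  have h1 : 0 < inner ℝ u u := by rw [real_inner_self_eq_norm_sq]; positivity
  have : 0 ≤ inner ℝ x u * inner ℝ x u / (1 - ‖x‖ ^ 2) ^ 2 := by
    apply div_nonneg (mul_self_nonneg _) (by positivity)
  have : 0 < inner ℝ u u / (1 - ‖x‖ ^ 2) := by positivity
  unfold metric; linarith

theorem gram_lift {a b : E3} (ha : a ∈ space) :
    gram (lift a) (lift b) = (1 - ‖a‖ ^ 2) ^ 2 * metric a (b - a) (b - a) := by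
  have h := (one_sub_norm_sq_pos ha).ne'
  rw [metric_eq]
  rw [norm_sq_eq] at *
  simp [gram, lor, lift]
  field_simp
  ring

theorem gram_lift_pos {a b : E3} (ha : a ∈ space) (hab : a ≠ b) :
    0 < gram (lift a) (lift b) := by
  have := one_sub_norm_sq_pos ha
  have := metric_self_pos ha (sub_ne_zero.2 hab.symm)
  rw [gram_lift ha]; positivity

theorem metric_orth {a u v w : E3} (h : metric a u u ≠ 0) :
    metric a u u * metric a (orth a u v) (orth a u w) =
      metric a u u * metric a v w - metric a u v * metric a u w := by
  have key : ∀ s t : ℝ, metric a (v - s • u) (w - t • u) =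
      metric a v w - s * metric a u w - t * metric a u v + s * t * metric a u u := by
    intro s t
    simp only [metric_eq, PiLp.sub_apply, PiLp.smul_apply, smul_eq_mul]
    ring
  rw [orth, orth, key]
  field_simp
  ring

theorem lor_normal_normal {a b c d : E3} (ha : a ∈ space) (hab : a ≠ b) :
    lor (normal a b c) (normal b a d) = -((1 - ‖a‖ ^ 2) ^ 3 * metric a (b - a) (b - a) *
      metric a (orth a (b - a) (c - a)) (orth a (b - a) (d - a))) := by
  have h := (one_sub_norm_sq_pos ha).ne'
  have h2 := (metric_self_pos ha (sub_ne_zero.2 hab.symm)).ne'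
  rw [mul_assoc, metric_orth h2]
  rw [norm_sq_eq] at *
  simp only [metric_eq, PiLp.sub_apply]
  simp [lor, normal, det3_eq]
  field_simp
  ring

theorem det4_normal_normal (a b c d : E3) :
    det4 (normal a b c) (normal b a d) (lift a) (lift b) =
      gram (lift a) (lift b) * det3 (b - a) (d - a) (c - a) := by
  simp [det4, gram, lor, lift, normal, det3_eq]
  ring

theorem det3_orth (a u v w : E3) : det3 u (orth a u v) (orth a u w) = det3 u v w := by
  have key : ∀ s t : ℝ, det3 u (v - s • u) (w - t • u) = det3 u v w := by
    intro s t
    simp only [det3_eq, PiLp.sub_apply, PiLp.smul_apply, smul_eq_mul]; ring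
  exact key _ _

/-! ### Rotation of two faces about their common edge -/

theorem hasDerivAt_lor {X Y : ℝ → Fin 4 → ℝ} {X' Y' : Fin 4 → ℝ} {t : ℝ}
    (hX : HasDerivAt X X' t) (hY : HasDerivAt Y Y' t) :
    HasDerivAt (fun s => lor (X s) (Y s)) (lor X' (Y t) + lor (X t) Y') t := by
  have hX := hasDerivAt_pi.1 hX
  have hY := hasDerivAt_pi.1 hY
  refine (((((hX 1).mul (hY 1)).add ((hX 2).mul (hY 2))).add ((hX 3).mul (hY 3))).sub
    ((hX 0).mul (hY 0))).congr_deriv ?_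
  simp only [lor]; ring

theorem hasDerivAt_det4 {X Y Z W : ℝ → Fin 4 → ℝ} {X' Y' Z' W' : Fin 4 → ℝ} {t : ℝ}
    (hX : HasDerivAt X X' t) (hY : HasDerivAt Y Y' t) (hZ : HasDerivAt Z Z' t)
    (hW : HasDerivAt W W' t) :
    HasDerivAt (fun s => det4 (X s) (Y s) (Z s) (W s))
      (det4 X' (Y t) (Z t) (W t) + det4 (X t) Y' (Z t) (W t) + det4 (X t) (Y t) Z' (W t)
        + det4 (X t) (Y t) (Z t) W') t := by
  have hX := hasDerivAt_pi.1 hX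
  have hY := hasDerivAt_pi.1 hY
  have hZ := hasDerivAt_pi.1 hZ
  have hW := hasDerivAt_pi.1 hW
  have h2 (i j : Fin 4) := ((hZ i).mul (hW j)).sub ((hZ j).mul (hW i))
  have h3 (i j k : Fin 4) := (((hY i).mul (h2 j k)).sub ((hY j).mul (h2 i k))).add
    ((hY k).mul (h2 i j))
  refine (((((hX 0).mul (h3 1 2 3)).sub ((hX 1).mul (h3 0 2 3))).add
    ((hX 2).mul (h3 0 1 3))).sub ((hX 3).mul (h3 0 1 2))).congr_deriv ?_
  simp only [det4, Pi.mul_apply, Pi.sub_apply, Pi.add_apply]; ring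

theorem re_mul_im_eq_of_arg_eq {z w : ℂ} (h : z.arg = w.arg) : z.re * w.im = z.im * w.re := by
  rw [← Complex.norm_mul_cos_arg z, ← Complex.norm_mul_sin_arg z,
    ← Complex.norm_mul_cos_arg w, ← Complex.norm_mul_sin_arg w, h]
  ring

/-- Constancy of the dihedral angle, in terms of the normals of the two triangles. The angle is
the argument of `-⟨N, M⟩ + i det (N, M, A, B) / √γ`, up to a positive factor. -/
theorem dihedralAngle_eq_imp {a b c d a' b' c' d' : E3} (ha : a ∈ space) (hab : a ≠ b)
    (ha' : a' ∈ space) (hab' : a' ≠ b')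
    (h : dihedralAngle a b c d = dihedralAngle a' b' c' d') :
    lor (normal a b c) (normal b a d) * det4 (normal a' b' c') (normal b' a' d') (lift a') (lift b')
        * √(gram (lift a) (lift b)) =
      det4 (normal a b c) (normal b a d) (lift a) (lift b) * lor (normal a' b' c') (normal b' a' d')
        * √(gram (lift a') (lift b')) := by
  have aux : ∀ {a b : E3} (c d : E3), a ∈ space → a ≠ b →
      det4 (normal a b c) (normal b a d) (lift a) (lift b) =
        (1 - ‖a‖ ^ 2) ^ 3 * metric a (b - a) (b - a) * √(gram (lift a) (lift b)) *
        (density a * det3 (b - a) (orth a (b - a) (d - a)) (orth a (b - a) (c - a)) /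
          √(metric a (b - a) (b - a))) := by
    intro a b c d ha hab
    have hq := one_sub_norm_sq_pos ha
    have hm := metric_self_pos ha (sub_ne_zero.2 hab.symm)
    rw [det4_normal_normal, gram_lift ha, det3_orth, Real.sqrt_mul (by positivity),
      Real.sqrt_sq hq.le, density]
    have := (Real.sqrt_pos.2 hm).ne'
    have h2 := Real.sq_sqrt hm.le
    field_simp
  unfold dihedralAngle at h
  simp only [Complex.arg_coe_angle_eq_iff] at h
  have cross := re_mul_im_eq_of_arg_eq h
  simp only at cross
  rw [lor_normal_normal ha hab, lor_normal_normal ha' hab', aux c d ha hab, aux c' d' ha' hab']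
  linear_combination (-((1 - ‖a‖ ^ 2) ^ 3 * metric a (b - a) (b - a)) *
    ((1 - ‖a'‖ ^ 2) ^ 3 * metric a' (b' - a') (b' - a')) * √(gram (lift a) (lift b)) *
    √(gram (lift a') (lift b'))) * cross

/-- If the angle between the normals `N` and `M` in the orthogonal complement of the moving plane
spanned by `A` and `B` is stationary, then `N` and `M` rotate with the same speed. -/
theorem rotation_speed_eq {N M A B : ℝ → Fin 4 → ℝ} {N' M' A' B' : Fin 4 → ℝ} {t : ℝ}
    (hN : HasDerivAt N N' t) (hM : HasDerivAt M M' t) (hA : HasDerivAt A A' t)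
    (hB : HasDerivAt B B' t) (hNA : lor (N t) (A t) = 0) (hNB : lor (N t) (B t) = 0)
    (hMA : lor (M t) (A t) = 0) (hMB : lor (M t) (B t) = 0) (hγ : 0 < gram (A t) (B t))
    (h : ∀ᶠ s in nhds t, lor (N t) (M t) * det4 (N s) (M s) (A s) (B s) * √(gram (A t) (B t)) =
      det4 (N t) (M t) (A t) (B t) * lor (N s) (M s) * √(gram (A s) (B s))) :
    lor (N t) (N t) * det4 (M t) M' (A t) (B t) = lor (M t) (M t) * det4 (N t) N' (A t) (B t) := by
  have hg := hasDerivAt_lor hN hM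
  have hδ := hasDerivAt_det4 hN hM hA hB
  have hγ' := ((hasDerivAt_lor hA hB).pow 2).sub ((hasDerivAt_lor hA hA).mul (hasDerivAt_lor hB hB))
  have hs := hγ'.sqrt (by exact hγ.ne')
  have e := HasDerivAt.unique ((hδ.const_mul (lor (N t) (M t))).mul_const (√(gram (A t) (B t))))
    (((hg.const_mul (det4 (N t) (M t) (A t) (B t))).mul hs).congr_of_eventuallyEq h)
  have hq : √(gram (A t) (B t)) ^ 2 = gram (A t) (B t) := Real.sq_sqrt hγ.le
  have hq0 := (Real.sqrt_pos.2 hγ).ne'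
  have i1 := lor_det4_cramer (N t) (N t) (M t) M' (A t) (B t)
  have i2 := lor_det4_cramer (M t) (M t) (N t) N' (A t) (B t)
  have i3 := lor_det4_cramer (B t) (N t) (M t) A' (A t) (B t)
  have i4 := lor_det4_cramer (A t) (N t) (M t) A' (A t) (B t)
  have i5 := lor_det4_cramer (B t) (N t) (M t) (A t) B' (B t)
  have i6 := lor_det4_cramer (A t) (N t) (M t) (A t) B' (B t)
  have sw : det4 (M t) N' (A t) (B t) = -det4 N' (M t) (A t) (B t) := by simp only [det4]; ring
  have sw' : det4 (M t) (N t) (A t) (B t) = -det4 (N t) (M t) (A t) (B t) := by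
    simp only [det4]; ring
  simp only [lor_comm (A t) (N t), lor_comm (A t) (M t), lor_comm (B t) (N t),
    lor_comm (B t) (M t), lor_comm (B t) (A t), lor_comm (M t) (N t), hNA, hNB, hMA, hMB, sw,
    sw', lor_comm A', lor_comm B', lor_comm N'] at i1 i2 i3 i4 i5 i6 e
  simp only [Pi.sub_apply, Pi.mul_apply, Pi.pow_apply] at e
  have hG : (lor (A t) (B t) ^ 2 - lor (A t) (A t) * lor (B t) (B t)) =
    √(gram (A t) (B t)) ^ 2 := hq.symm
  simp only [hG] at e
  rw [Real.sqrt_sq (Real.sqrt_nonneg _)] at e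
  have clear : ∀ {X Y Z W r : ℝ}, r ≠ 0 → X * r = Y * r + Z * (W / (2 * r)) →
      2 * r ^ 2 * X = 2 * r ^ 2 * Y + Z * W := by
    intro X Y Z W r hr h
    field_simp at h
    linarith
  have e2 := clear hq0 e
  norm_num at e2
  refine mul_left_cancel₀ (show 2 * √(gram (A t) (B t)) ^ 2 ≠ 0 by positivity) ?_
  linear_combination 2 * √(gram (A t) (B t)) ^ 2 * (i1 - i2) + e2
    + 2 * lor (N t) (M t) * (lor (A t) (B t) * i3 - lor (B t) (B t) * i4)
    + 2 * lor (N t) (M t) * (lor (A t) (A t) * i5 - lor (A t) (B t) * i6)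
    + 2 * lor (N t) (M t) * (det4 (N t) (M t) A' (B t) + det4 (N t) (M t) (A t) B') * hG

/-! ### Integrals depending on a parameter -/

/-- The integral of a jointly continuous function over a compact set depends continuously on the
parameter. -/
theorem continuousOn_setIntegral_of_compact {X : Type*} [TopologicalSpace X]
    [FirstCountableTopology X] {Y : Type*} [TopologicalSpace Y] [T2Space Y] [MeasurableSpace Y]
    [OpensMeasurableSpace Y] [SecondCountableTopology Y]
    {μ : Measure Y} [IsFiniteMeasureOnCompacts μ] {f : X → Y → ℝ} {s : Set X} {K : Set Y}
    (hK : IsCompact K) (hf : ContinuousOn (Function.uncurry f) (s ×ˢ K)) :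
    ContinuousOn (fun x => ∫ y in K, f x y ∂μ) s := by
  intro q hq
  obtain ⟨v, hv, hv'⟩ := hK.mem_uniformity_of_prod hf hq (Metric.dist_mem_uniformity one_pos)
  have hcont : ∀ x ∈ s, ContinuousOn (f x) K := fun x hx =>
    hf.comp (f := fun y => (x, y)) (by fun_prop) fun y hy => ⟨hx, hy⟩
  obtain ⟨C, hC⟩ := (hK.image_of_continuousOn (hcont q hq)).isBounded.exists_norm_le
  refine continuousWithinAt_of_dominated (bound := fun _ => C + 1) ?_ ?_ ?_ ?_
  · filter_upwards [self_mem_nhdsWithin] with x hx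
    exact (hcont x hx).aestronglyMeasurable hK.measurableSet
  · filter_upwards [hv] with x hx
    refine (ae_restrict_iff' hK.measurableSet).2 (Eventually.of_forall fun y hy => ?_)
    have h1 := hv' x hx y hy
    have h2 := hC (f q y) ⟨y, hy, rfl⟩
    simp only [mem_ofPred_eq, Real.dist_eq] at h1
    rw [Real.norm_eq_abs] at *
    have := abs_sub_abs_le_abs_sub (f x y) (f q y)
    have := abs_sub_abs_le_abs_sub (f q y) (f x y)
    have := abs_sub_comm (f x y) (f q y)
    linarith
  · exact integrableOn_const hK.measure_ne_top
  · refine (ae_restrict_iff' hK.measurableSet).2 (Eventually.of_forall fun y hy => ?_)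
    exact (hf.comp (f := fun x => (x, y)) (by fun_prop) fun x hx => ⟨hx, hy⟩) q hq

/-- Differentiation under the integral sign, for an integral over a compact set. -/
theorem hasDerivAt_setIntegral_of_compact {Y : Type*} [TopologicalSpace Y] [T2Space Y]
    [MeasurableSpace Y] [OpensMeasurableSpace Y] [SecondCountableTopology Y]
    {μ : Measure Y} [IsFiniteMeasureOnCompacts μ] {f f' : ℝ → Y → ℝ} {U : Set ℝ} (hU : IsOpen U)
    {K : Set Y} (hK : IsCompact K) (hf : ∀ t ∈ U, ContinuousOn (f t) K)
    (hf' : ContinuousOn (Function.uncurry f') (U ×ˢ K))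
    (hderiv : ∀ t ∈ U, ∀ y ∈ K, HasDerivAt (fun s => f s y) (f' t y) t) {t : ℝ} (ht : t ∈ U) :
    HasDerivAt (fun s => ∫ y in K, f s y ∂μ) (∫ y in K, f' t y ∂μ) t := by
  obtain ⟨r, hr, hrU⟩ := Metric.nhds_basis_closedBall.mem_iff.1 (hU.mem_nhds ht)
  have hcomp : IsCompact (Metric.closedBall t r ×ˢ K) := (isCompact_closedBall t r).prod hK
  obtain ⟨C, hC⟩ := (hcomp.image_of_continuousOn
    (hf'.mono (prod_mono hrU subset_rfl))).isBounded.exists_norm_le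
  refine (hasDerivAt_integral_of_dominated_loc_of_deriv_le (bound := fun _ => C)
    (Metric.closedBall_mem_nhds t hr) ?_ ?_ ?_ ?_ ?_ ?_).2
  · filter_upwards [hU.mem_nhds ht] with x hx
    exact (hf x hx).aestronglyMeasurable hK.measurableSet
  · exact (hf t ht).integrableOn_compact hK
  · exact (hf'.comp (f := fun y => (t, y)) (by fun_prop) fun y hy => ⟨ht, hy⟩).aestronglyMeasurable
      hK.measurableSet
  · refine (ae_restrict_iff' hK.measurableSet).2 (Eventually.of_forall fun y hy x hx => ?_)
    exact hC _ ⟨(x, y), ⟨hx, hy⟩, rfl⟩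
  · exact integrableOn_const hK.measure_ne_top
  · refine (ae_restrict_iff' hK.measurableSet).2 (Eventually.of_forall fun y hy x hx => ?_)
    exact hderiv x (hrU hx) y hy

/-! ### The radial primitive of the volume density -/

/-- The integrals `∫ r in 0..1, r ^ k / (1 - r ^ 2 * m) ^ j`. -/
def radial (k j : ℕ) (m : ℝ) : ℝ := ∫ r in Icc (0 : ℝ) 1, r ^ k / (1 - r ^ 2 * m) ^ j

theorem one_sub_sq_mul_pos {r m : ℝ} (hr : r ∈ Icc (0 : ℝ) 1) (hm : m < 1) :
    0 < 1 - r ^ 2 * m := by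
  have h1 : r ^ 2 ≤ 1 := by nlinarith [hr.1, hr.2]
  rcases le_or_gt m 0 with h | h <;> nlinarith [sq_nonneg r]

theorem hasDerivAt_radial (k j : ℕ) {m : ℝ} (hm : m < 1) :
    HasDerivAt (radial k j) (j * radial (k + 2) (j + 1) m) m := by
  have := hasDerivAt_setIntegral_of_compact (μ := volume) (f := fun m r => r ^ k / (1 - r ^ 2 * m) ^ j)
    (f' := fun m r => j * (r ^ (k + 2) / (1 - r ^ 2 * m) ^ (j + 1))) isOpen_Iio
    (isCompact_Icc (a := (0 : ℝ)) (b := 1)) ?_ ?_ ?_ (show m ∈ Iio (1 : ℝ) from hm)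
  · rw [integral_const_mul] at this
    exact this
  · intro t ht
    refine ContinuousOn.div (by fun_prop) (by fun_prop) fun r hr => ?_
    exact pow_ne_zero _ (one_sub_sq_mul_pos hr ht).ne'
  · refine ContinuousOn.mul (by fun_prop) (ContinuousOn.div (by fun_prop) (by fun_prop) ?_)
    rintro ⟨t, r⟩ ⟨ht, hr⟩
    exact pow_ne_zero _ (one_sub_sq_mul_pos hr ht).ne'
  · intro t ht r hr
    have h0 := one_sub_sq_mul_pos hr ht
    have h1 : HasDerivAt (fun s : ℝ => 1 - r ^ 2 * s) (-(r ^ 2)) t := by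
      simpa using ((hasDerivAt_id t).const_mul (r ^ 2)).const_sub 1
    have h2 := ((h1.pow j).inv (pow_ne_zero _ h0.ne')).const_mul (r ^ k)
    simp only [div_eq_mul_inv]
    refine h2.congr_deriv ?_
    rcases j with _ | j
    · simp
    · simp only [Pi.pow_apply, Nat.add_sub_cancel]
      field_simp
      ring

theorem continuousOn_radial (k j : ℕ) : ContinuousOn (radial k j) (Iio 1) := fun _ hm =>
  (hasDerivAt_radial k j hm).continuousAt.continuousWithinAt

/-- The vector field `x ↦ radial 2 2 (‖x‖ ^ 2) • x` has the divergence `density`. -/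
theorem radial_divergence {m : ℝ} (hm : m < 1) :
    3 * radial 2 2 m + 4 * m * radial 4 3 m = 1 / (1 - m) ^ 2 := by
  have hc : ∀ k j : ℕ, ContinuousOn (fun r : ℝ => r ^ k / (1 - r ^ 2 * m) ^ j) (Icc 0 1) := by
    intro k j
    refine ContinuousOn.div (by fun_prop) (by fun_prop) fun r hr => ?_
    exact pow_ne_zero _ (one_sub_sq_mul_pos hr hm).ne'
  have hi : ∀ k j : ℕ, IntegrableOn (fun r : ℝ => r ^ k / (1 - r ^ 2 * m) ^ j) (Icc 0 1) :=
    fun k j => (hc k j).integrableOn_compact isCompact_Icc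
  have h := intervalIntegral.integral_eq_sub_of_hasDerivAt (a := 0) (b := 1)
    (f := fun r : ℝ => r ^ 3 / (1 - r ^ 2 * m) ^ 2)
    (f' := fun r => 3 * (r ^ 2 / (1 - r ^ 2 * m) ^ 2) + 4 * m * (r ^ 4 / (1 - r ^ 2 * m) ^ 3)) ?_ ?_
  · rw [intervalIntegral.integral_of_le zero_le_one, ← integral_Icc_eq_integral_Ioc,
      integral_add ((hi 2 2).const_mul 3) ((hi 4 3).const_mul (4 * m)), integral_const_mul,
      integral_const_mul] at h
    simpa [radial] using h
  · intro r hr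
    rw [uIcc_of_le zero_le_one] at hr
    have h0 := one_sub_sq_mul_pos hr hm
    have h1 : HasDerivAt (fun s : ℝ => 1 - s ^ 2 * m) (-(2 * r * m)) r := by
      simpa using ((hasDerivAt_pow 2 r).mul_const m).const_sub 1
    refine ((hasDerivAt_pow 3 r).div (h1.pow 2) (pow_ne_zero _ h0.ne')).congr_deriv ?_
    simp only [Pi.pow_apply]
    push_cast
    field_simp
    ring
  · apply ContinuousOn.intervalIntegrable
    rw [uIcc_of_le zero_le_one]
    exact ((hc 2 2).const_mul 3).add ((hc 4 3).const_mul _)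

/-! ### Primitives of the volume form and of the normal velocity -/

/-- The point with the parameter `s` of the segment from `a` to `b`. -/
def seg (a b : E3) (s : ℝ) : E3 := (1 - s) • a + s • b

/-- The parametrization of the triangle `abc` by the unit square which collapses the side `u = 0` to
the vertex `a`. -/
def triMap (a b c : E3) (z : ℝ × ℝ) : E3 := seg a (seg b c z.2) z.1

/-- The partial derivative of `triMap` with respect to the first variable. -/
def triMapU (a b c : E3) (z : ℝ × ℝ) : E3 := seg b c z.2 - a

/-- The partial derivative of `triMap` with respect to the second variable. -/
def triMapV (b c : E3) (z : ℝ × ℝ) : E3 := z.1 • (c - b)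

theorem seg_apply (a b : E3) (s : ℝ) (i : Fin 3) : seg a b s i = (1 - s) * a i + s * b i := by
  simp [seg]

theorem hasDerivAt_seg (a b : E3) (s : ℝ) : HasDerivAt (seg a b) (b - a) s := by
  have h := (((hasDerivAt_id s).const_sub 1).smul_const a).add ((hasDerivAt_id s).smul_const b)
  refine h.congr_deriv ?_
  module

theorem hasDerivAt_seg_param {a b : ℝ → E3} {a' b' : E3} {t : ℝ} (ha : HasDerivAt a a' t)
    (hb : HasDerivAt b b' t) (s : ℝ) : HasDerivAt (fun t => seg (a t) (b t) s) (seg a' b' s) t :=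
  (ha.const_smul (1 - s)).add (hb.const_smul s)

theorem seg_mem {a b : E3} (ha : a ∈ space) (hb : b ∈ space) {s : ℝ} (hs : s ∈ Icc (0 : ℝ) 1) :
    seg a b s ∈ space :=
  convex_ball _ _ ha hb (by linarith [hs.2]) hs.1 (by ring)

theorem triMap_mem {a b c : E3} (ha : a ∈ space) (hb : b ∈ space) (hc : c ∈ space) {z : ℝ × ℝ}
    (hz : z ∈ Icc (0 : ℝ × ℝ) 1) : triMap a b c z ∈ space :=
  seg_mem ha (seg_mem hb hc ⟨hz.1.2, hz.2.2⟩) ⟨hz.1.1, hz.2.1⟩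

theorem hasDerivAt_apply {x : ℝ → E3} {x' : E3} {t : ℝ} (h : HasDerivAt x x' t) (i : Fin 3) :
    HasDerivAt (fun s => x s i) (x' i) t :=
  ((PiLp.proj 2 (fun _ : Fin 3 => ℝ) i : E3 →L[ℝ] ℝ).hasFDerivAt.comp_hasDerivAt t h)

theorem hasDerivAt_det3 {x y z : ℝ → E3} {x' y' z' : E3} {t : ℝ} (hx : HasDerivAt x x' t)
    (hy : HasDerivAt y y' t) (hz : HasDerivAt z z' t) :
    HasDerivAt (fun s => det3 (x s) (y s) (z s))
      (det3 x' (y t) (z t) + det3 (x t) y' (z t) + det3 (x t) (y t) z') t := by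
  have hx := hasDerivAt_apply hx
  have hy := hasDerivAt_apply hy
  have hz := hasDerivAt_apply hz
  have h2 (i j : Fin 3) := ((hy i).mul (hz j)).sub ((hy j).mul (hz i))
  simp only [det3_eq]
  refine ((((hx 0).mul (h2 1 2)).sub ((hx 1).mul (h2 0 2))).add
    ((hx 2).mul (h2 0 1))).congr_deriv ?_
  simp only [Pi.mul_apply, Pi.sub_apply]; ring

theorem hasDerivAt_lift {x : ℝ → E3} {x' : E3} {t : ℝ} (hx : HasDerivAt x x' t) :
    HasDerivAt (fun s => lift (x s)) (lift₀ x') t := by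
  have hx := hasDerivAt_apply hx
  refine hasDerivAt_pi.2 fun i => ?_
  fin_cases i
  · exact hasDerivAt_const t 1
  · exact hx 0
  · exact hx 1
  · exact hx 2

theorem hasDerivAt_lift₀ {x : ℝ → E3} {x' : E3} {t : ℝ} (hx : HasDerivAt x x' t) :
    HasDerivAt (fun s => lift₀ (x s)) (lift₀ x') t := by
  have hx := hasDerivAt_apply hx
  refine hasDerivAt_pi.2 fun i => ?_
  fin_cases i
  · exact hasDerivAt_const t 0
  · exact hx 0
  · exact hx 1
  · exact hx 2

theorem norm_sq_lt_one {x : E3} (hx : x ∈ space) : ‖x‖ ^ 2 < 1 := by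
  linarith [one_sub_norm_sq_pos hx]

/-- The 2-form `radial 2 2 (‖x‖ ^ 2) * det3 x y z` in `y` and `z`, whose exterior derivative is the
volume form, along a curve. -/
theorem hasDerivAt_radial_mul_det3 {x y z : ℝ → E3} {x' y' z' : E3} {t : ℝ}
    (hx : HasDerivAt x x' t) (hy : HasDerivAt y y' t) (hz : HasDerivAt z z' t)
    (h1 : x t ∈ space) :
    HasDerivAt (fun s => radial 2 2 (‖x s‖ ^ 2) * det3 (x s) (y s) (z s))
      (4 * radial 4 3 (‖x t‖ ^ 2) * inner ℝ (x t) x' * det3 (x t) (y t) (z t) +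
        radial 2 2 (‖x t‖ ^ 2) *
          (det3 x' (y t) (z t) + det3 (x t) y' (z t) + det3 (x t) (y t) z')) t := by
  refine (((hasDerivAt_radial 2 2 (norm_sq_lt_one h1)).comp t hx.norm_sq).mul
    (hasDerivAt_det3 hx hy hz)).congr_deriv ?_
  push_cast
  simp only [Function.comp]
  ring

theorem hasDerivAt_conormal {x y : ℝ → E3} {x' y' : E3} {t : ℝ} (N W : Fin 4 → ℝ)
    (hx : HasDerivAt x x' t) (hy : HasDerivAt y y' t) (h1 : x t ∈ space) :
    HasDerivAt (fun s => det4 N W (lift (x s)) (lift₀ (y s)) / (1 - ‖x s‖ ^ 2))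
      ((det4 N W (lift₀ x') (lift₀ (y t)) + det4 N W (lift (x t)) (lift₀ y')) / (1 - ‖x t‖ ^ 2) +
        2 * inner ℝ (x t) x' * det4 N W (lift (x t)) (lift₀ (y t)) / (1 - ‖x t‖ ^ 2) ^ 2) t := by
  have h := (one_sub_norm_sq_pos h1).ne'
  have hd := hasDerivAt_det4 (hasDerivAt_const t N) (hasDerivAt_const t W) (hasDerivAt_lift hx)
    (hasDerivAt_lift₀ hy)
  refine (hd.div (hx.norm_sq.const_sub 1) h).congr_deriv ?_
  have e : ∀ X Y, det4 0 W X Y + det4 N 0 X Y = 0 := by intros; simp [det4]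
  rw [e]
  field_simp
  ring

/-- The exterior derivative of the 1-form `det4 N W (1, x) (0, dx) / (1 - ‖x‖ ^ 2)` on the plane
with the normal `N`. -/
theorem conormal_curl {N W : Fin 4 → ℝ} {x e f : E3} (hx : x ∈ space)
    (h : lor N (lift x) = 0) :
    det4 N W (lift₀ e) (lift₀ f) / (1 - ‖x‖ ^ 2) +
        2 * inner ℝ x e * det4 N W (lift x) (lift₀ f) / (1 - ‖x‖ ^ 2) ^ 2 -
      (det4 N W (lift₀ f) (lift₀ e) / (1 - ‖x‖ ^ 2) +
        2 * inner ℝ x f * det4 N W (lift x) (lift₀ e) / (1 - ‖x‖ ^ 2) ^ 2) =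
      -2 * lor W (lift x) * det4 N (lift x) (lift₀ e) (lift₀ f) / (1 - ‖x‖ ^ 2) ^ 2 := by
  have hq := (one_sub_norm_sq_pos hx).ne'
  have h1 := lor_det4_cramer (lift x) N W (lift x) (lift₀ e) (lift₀ f)
  have e1 : lor (lift x) (lift x) = -(1 - ‖x‖ ^ 2) := by
    rw [norm_sq_eq]; simp [lor, lift]; ring
  have e2 : ∀ y, lor (lift x) (lift₀ y) = inner ℝ x y := by
    intro y; rw [inner_eq]; simp [lor, lift, lift₀]
  have sw : det4 N W (lift₀ f) (lift₀ e) = -det4 N W (lift₀ e) (lift₀ f) := by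
    simp only [det4]; ring
  rw [lor_comm _ N, h, e1, e2, e2, lor_comm _ W] at h1
  rw [sw]
  field_simp
  linear_combination (-2) * h1

theorem det3_triMap (a b c : E3) (z : ℝ × ℝ) :
    det3 (triMap a b c z) (triMapU a b c z) (triMapV b c z) = z.1 * det3 a b c := by
  simp only [det3_eq, triMap, triMapU, triMapV, seg_apply, PiLp.sub_apply, PiLp.smul_apply,
    smul_eq_mul]
  ring

theorem det3_triMap' (a b c y : E3) (z : ℝ × ℝ) :
    det3 y (triMapU a b c z) (triMapV b c z) = z.1 * lor (normal a b c) (lift₀ y) := by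
  simp only [det3_eq, triMapU, triMapV, seg_apply, PiLp.sub_apply, PiLp.smul_apply,
    smul_eq_mul, lor, normal, lift₀]
  simp
  ring

theorem det4_normal_triMap (a b c : E3) (z : ℝ × ℝ) :
    det4 (normal a b c) (lift (triMap a b c z)) (lift₀ (triMapU a b c z)) (lift₀ (triMapV b c z)) =
      -(z.1 * lor (normal a b c) (normal a b c)) := by
  have key : ∀ (N : Fin 4 → ℝ) (x e f : E3), det4 N (lift x) (lift₀ e) (lift₀ f) =
      N 0 * det3 x e f - det3 (WithLp.toLp 2 ![N 1, N 2, N 3]) e f := by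
    intro N x e f
    simp [det4, det3_eq, lift, lift₀]; ring
  rw [key, det3_triMap, det3_triMap']
  simp [lor, normal, lift₀]
  ring

theorem lor_lift_seg (X : Fin 4 → ℝ) (a b : E3) (s : ℝ) :
    lor X (lift (seg a b s)) = (1 - s) * lor X (lift a) + s * lor X (lift b) := by
  simp [lor, lift, seg_apply]; ring

theorem lor_lift₀_seg (X : Fin 4 → ℝ) (a b : E3) (s : ℝ) :
    lor X (lift₀ (seg a b s)) = (1 - s) * lor X (lift₀ a) + s * lor X (lift₀ b) := by
  simp [lor, lift₀, seg_apply]; ring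

/-- The exterior derivative of `radial 2 2 (‖x‖ ^ 2) * det3 x · ·` is `density x` times the volume
form, evaluated on three coordinate vector fields. -/
theorem radial_closed {h k : ℝ} (x xt xu xv xut xvt xuv : E3) :
    (4 * k * inner ℝ x xt * det3 x xu xv + h * (det3 xt xu xv + det3 x xut xv + det3 x xu xvt)) +
    (4 * k * inner ℝ x xu * det3 x xv xt + h * (det3 xu xv xt + det3 x xuv xt + det3 x xv xut)) +
    (4 * k * inner ℝ x xv * det3 x xt xu + h * (det3 xv xt xu + det3 x xvt xu + det3 x xt xuv)) =
      (3 * h + 4 * ‖x‖ ^ 2 * k) * det3 xt xu xv := by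
  simp only [det3_eq, inner_eq, norm_sq_eq]
  ring

/-! ### The variation of the volume of a cone over a triangle -/

/-- Green's theorem on the unit square, in terms of partial derivatives. -/
theorem green_unit_square {f g fu gv : ℝ × ℝ → ℝ}
    (hf : ∀ z ∈ Icc (0 : ℝ × ℝ) 1, DifferentiableAt ℝ f z)
    (hg : ∀ z ∈ Icc (0 : ℝ × ℝ) 1, DifferentiableAt ℝ g z)
    (hfu : ∀ z ∈ Icc (0 : ℝ × ℝ) 1, HasDerivAt (fun s => f (s, z.2)) (fu z) z.1)
    (hgv : ∀ z ∈ Icc (0 : ℝ × ℝ) 1, HasDerivAt (fun s => g (z.1, s)) (gv z) z.2)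
    (hc : ContinuousOn (fun z => fu z + gv z) (Icc (0 : ℝ × ℝ) 1)) :
    ∫ z in Icc (0 : ℝ × ℝ) 1, (fu z + gv z) =
      (((∫ x in (0 : ℝ)..1, g (x, 1)) - ∫ x in (0 : ℝ)..1, g (x, 0)) +
        ∫ y in (0 : ℝ)..1, f (1, y)) - ∫ y in (0 : ℝ)..1, f (0, y) := by
  have e : ∀ z ∈ Icc (0 : ℝ × ℝ) 1,
      fu z + gv z = fderiv ℝ f z (1, 0) + fderiv ℝ g z (0, 1) := by
    intro z hz
    have h1 : HasDerivAt (fun s : ℝ => (s, z.2)) ((1 : ℝ), (0 : ℝ)) z.1 :=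
      (hasDerivAt_id z.1).prodMk (hasDerivAt_const _ _)
    have h2 : HasDerivAt (fun s : ℝ => (z.1, s)) ((0 : ℝ), (1 : ℝ)) z.2 :=
      (hasDerivAt_const _ _).prodMk (hasDerivAt_id z.2)
    rw [(hfu z hz).unique ((hf z hz).hasFDerivAt.comp_hasDerivAt (f := fun s : ℝ => (s, z.2)) z.1 h1),
      (hgv z hz).unique ((hg z hz).hasFDerivAt.comp_hasDerivAt (f := fun s : ℝ => (z.1, s)) z.2 h2)]
  rw [setIntegral_congr_fun measurableSet_Icc e]
  have hsub : Ioo (0 : ℝ × ℝ).1 (1 : ℝ × ℝ).1 ×ˢ Ioo (0 : ℝ × ℝ).2 (1 : ℝ × ℝ).2 ⊆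
      Icc (0 : ℝ × ℝ) 1 := fun z hz => ⟨⟨hz.1.1.le, hz.2.1.le⟩, ⟨hz.1.2.le, hz.2.2.le⟩⟩
  exact integral_divergence_prod_Icc_of_hasFDerivAt_of_le f g (fderiv ℝ f) (fderiv ℝ g) 0 1
    zero_le_one (fun z hz => (hf z hz).continuousAt.continuousWithinAt)
    (fun z hz => (hg z hz).continuousAt.continuousWithinAt)
    (fun z hz => (hf z (hsub hz)).hasFDerivAt) (fun z hz => (hg z (hsub hz)).hasFDerivAt)
    ((hc.congr fun z hz => (e z hz).symm).integrableOn_compact isCompact_Icc)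

section Differentiability

variable {E : Type*} [NormedAddCommGroup E] [NormedSpace ℝ E] {x y w : E → E3} {z : E}

theorem differentiableAt_coord (h : DifferentiableAt ℝ x z) (i : Fin 3) :
    DifferentiableAt ℝ (fun s => x s i) z :=
  (PiLp.proj 2 (fun _ : Fin 3 => ℝ) i : E3 →L[ℝ] ℝ).differentiableAt.comp z h

theorem differentiableAt_radial_mul_det3 (hx : DifferentiableAt ℝ x z)
    (hy : DifferentiableAt ℝ y z) (hw : DifferentiableAt ℝ w z) (h : x z ∈ space) :
    DifferentiableAt ℝ (fun s => radial 2 2 (‖x s‖ ^ 2) * det3 (x s) (y s) (w s)) z := by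
  have h1 := (hasDerivAt_radial 2 2 (norm_sq_lt_one h)).differentiableAt
  have h2 : DifferentiableAt ℝ (fun s => ‖x s‖ ^ 2) z := hx.norm_sq ℝ
  have hx := differentiableAt_coord hx
  have hy := differentiableAt_coord hy
  have hw := differentiableAt_coord hw
  refine (DifferentiableAt.comp (g := radial 2 2) z h1 h2).mul ?_
  simp only [det3_eq]
  fun_prop

theorem differentiableAt_conormal (N W : Fin 4 → ℝ) (r : ℝ) (hx : DifferentiableAt ℝ x z)
    (hy : DifferentiableAt ℝ y z) (h : x z ∈ space) :
    DifferentiableAt ℝ (fun s => det4 N W (lift (x s)) (lift₀ (y s)) / (1 - ‖x s‖ ^ 2) / r) z := by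
  have h2 : DifferentiableAt ℝ (fun s => ‖x s‖ ^ 2) z := hx.norm_sq ℝ
  have hx := differentiableAt_coord hx
  have hy := differentiableAt_coord hy
  have : DifferentiableAt ℝ (fun s => det4 N W (lift (x s)) (lift₀ (y s))) z := by
    simp [det4, lift, lift₀]
    fun_prop
  simp only [div_eq_mul_inv]
  exact (this.mul (DifferentiableAt.inv (h2.const_sub 1) (one_sub_norm_sq_pos h).ne')).mul_const _

end Differentiability

theorem differentiable_triMap (a b c : E3) : Differentiable ℝ (triMap a b c) := by
  unfold triMap seg; fun_prop

theorem differentiable_triMapU (a b c : E3) : Differentiable ℝ (triMapU a b c) := by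
  unfold triMapU seg; fun_prop

theorem differentiable_triMapV (b c : E3) : Differentiable ℝ (triMapV b c) := by
  unfold triMapV; fun_prop

theorem hasDerivAt_triMap_fst (a b c : E3) (z : ℝ × ℝ) :
    HasDerivAt (fun s => triMap a b c (s, z.2)) (triMapU a b c z) z.1 :=
  hasDerivAt_seg a (seg b c z.2) z.1

theorem hasDerivAt_triMap_snd (a b c : E3) (z : ℝ × ℝ) :
    HasDerivAt (fun s => triMap a b c (z.1, s)) (triMapV b c z) z.2 := by
  have h := (hasDerivAt_seg b c z.2).const_smul z.1
  have h2 := (hasDerivAt_const z.2 ((1 - z.1) • a)).add h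
  exact h2.congr_deriv (zero_add _)

theorem hasDerivAt_triMapU_snd (a b c : E3) (z : ℝ × ℝ) :
    HasDerivAt (fun s => triMapU a b c (z.1, s)) (c - b) z.2 :=
  (hasDerivAt_seg b c z.2).sub_const a

theorem hasDerivAt_triMapV_fst (b c : E3) (z : ℝ × ℝ) :
    HasDerivAt (fun s => triMapV b c (s, z.2)) (c - b) z.1 := by
  exact ((hasDerivAt_id z.1).smul_const (c - b)).congr_deriv (one_smul _ _)

/-- The oriented volume of the tetrahedron `0abc`, as the integral over the triangle `abc` of a
primitive of the volume form. -/
def coneIntegral (a b c : E3) : ℝ := ∫ z in Icc (0 : ℝ × ℝ) 1,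
  radial 2 2 (‖triMap a b c z‖ ^ 2) * det3 (triMap a b c z) (triMapU a b c z) (triMapV b c z)

/-- The volume swept by the triangle `0ab` when its vertices move with the velocities `a'`, `b'`. -/
def sweptVolume (a b a' b' : E3) : ℝ := ∫ s in (0 : ℝ)..1,
  radial 2 2 (‖seg a b s‖ ^ 2) * det3 (seg a b s) (seg a' b' s) (b - a)

/-- A multiple of the hyperbolic length of the segment `ab`; the factor is the square root of the
Gram determinant of `lift a` and `lift b`. -/
def edgeLength (a b : E3) : ℝ := ∫ s in (0 : ℝ)..1, 1 / (1 - ‖seg a b s‖ ^ 2)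

theorem seg_one_sub (a b : E3) (s : ℝ) : seg a b (1 - s) = seg b a s := by
  simp [seg, add_comm]

theorem sweptVolume_swap (a b a' b' : E3) : sweptVolume b a b' a' = -sweptVolume a b a' b' := by
  have h := intervalIntegral.integral_comp_sub_left (a := 0) (b := 1)
    (fun s => radial 2 2 (‖seg a b s‖ ^ 2) * det3 (seg a b s) (seg a' b' s) (b - a)) 1
  simp only [seg_one_sub, sub_zero, sub_self] at h
  rw [sweptVolume, sweptVolume, ← h, ← intervalIntegral.integral_neg]
  congr 1; ext s
  simp only [det3_eq, PiLp.sub_apply]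
  ring

theorem edgeLength_swap (a b : E3) : edgeLength b a = edgeLength a b := by
  have h := intervalIntegral.integral_comp_sub_left (a := 0) (b := 1)
    (fun s => 1 / (1 - ‖seg a b s‖ ^ 2)) 1
  simp only [seg_one_sub, sub_zero, sub_self] at h
  rw [edgeLength, edgeLength, ← h]

theorem continuousOn_det3 {X : Type*} [TopologicalSpace X] {s : Set X} {x y z : X → E3}
    (hx : ContinuousOn x s) (hy : ContinuousOn y s) (hz : ContinuousOn z s) :
    ContinuousOn (fun t => det3 (x t) (y t) (z t)) s := by
  have h : ∀ {u : X → E3}, ContinuousOn u s → ∀ i, ContinuousOn (fun t => u t i) s := fun hu i =>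
    (PiLp.proj 2 (fun _ : Fin 3 => ℝ) i : E3 →L[ℝ] ℝ).continuous.comp_continuousOn hu
  have hx := h hx
  have hy := h hy
  have hz := h hz
  simp only [det3_eq]
  fun_prop

theorem continuousOn_radial_norm_sq {X : Type*} [TopologicalSpace X] {s : Set X} {x : X → E3}
    (k j : ℕ) (hx : ContinuousOn x s) (h : ∀ t ∈ s, x t ∈ space) :
    ContinuousOn (fun t => radial k j (‖x t‖ ^ 2)) s :=
  (continuousOn_radial k j).comp (hx.norm.pow 2) fun t ht => norm_sq_lt_one (h t ht)

theorem lor_normal_triMap (a b c : E3) (z : ℝ × ℝ) :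
    lor (normal a b c) (lift (triMap a b c z)) = 0 := by
  rw [triMap, lor_lift_seg, lor_lift_seg, lor_normal_left, lor_normal_mid, lor_normal_right]
  ring

/-- The contribution of the edge `ab` to the derivative of `coneIntegral a b c`, where `N` is the
normal of the triangle and `W` the derivative of `N`. -/
def edgeTerm (a b a' b' : E3) (N W : Fin 4 → ℝ) : ℝ :=
  sweptVolume a b a' b' - edgeLength a b * det4 N W (lift a) (lift b) / (2 * lor N N)

theorem edgeTerm_swap (a b a' b' : E3) (N W : Fin 4 → ℝ) :
    edgeTerm b a b' a' N W = -edgeTerm a b a' b' N W := by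
  have : det4 N W (lift b) (lift a) = -det4 N W (lift a) (lift b) := by simp only [det4]; ring
  rw [edgeTerm, edgeTerm, sweptVolume_swap, edgeLength_swap, this]
  ring

/-- The integral over the edge `ab` of the sum of the 1-forms whose exterior derivatives make up
the derivative of `coneIntegral`. -/
theorem integral_edge {a b a' b' : E3} (ha : a ∈ space) (hb : b ∈ space) (N W : Fin 4 → ℝ) :
    ∫ s in (0 : ℝ)..1, (radial 2 2 (‖seg a b s‖ ^ 2) * det3 (seg a b s) (seg a' b' s) (b - a) -
      det4 N W (lift (seg a b s)) (lift₀ (b - a)) / (1 - ‖seg a b s‖ ^ 2) / (2 * lor N N)) =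
      edgeTerm a b a' b' N W := by
  have hs : ContinuousOn (seg a b) (uIcc 0 1) := fun s _ =>
    (hasDerivAt_seg a b s).continuousAt.continuousWithinAt
  have hs' : ContinuousOn (seg a' b') (uIcc 0 1) := fun s _ =>
    (hasDerivAt_seg a' b' s).continuousAt.continuousWithinAt
  have hm : ∀ s ∈ uIcc (0 : ℝ) 1, seg a b s ∈ space := by
    rw [uIcc_of_le zero_le_one]; exact fun s hs => seg_mem ha hb hs
  have e : ∀ s, det4 N W (lift (seg a b s)) (lift₀ (b - a)) / (1 - ‖seg a b s‖ ^ 2) /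
      (2 * lor N N) = 1 / (1 - ‖seg a b s‖ ^ 2) *
        (det4 N W (lift a) (lift b) / (2 * lor N N)) := by
    intro s
    have : det4 N W (lift (seg a b s)) (lift₀ (b - a)) = det4 N W (lift a) (lift b) := by
      simp [det4, lift, lift₀, seg_apply]; ring
    rw [this]; ring
  simp only [e]
  rw [intervalIntegral.integral_sub, intervalIntegral.integral_mul_const, edgeTerm, sweptVolume,
    edgeLength, mul_div_assoc]
  · exact ((continuousOn_radial_norm_sq 2 2 hs hm).mul
      (continuousOn_det3 hs hs' continuousOn_const)).intervalIntegrable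
  · refine ContinuousOn.intervalIntegrable ?_
    refine ContinuousOn.mul (ContinuousOn.div continuousOn_const
      (continuousOn_const.sub (hs.norm.pow 2)) fun s hs => ?_) continuousOn_const
    exact (one_sub_norm_sq_pos (hm s hs)).ne'

/-- The derivative of the integrand of `coneIntegral` when the vertices move with the velocities
`a'`, `b'`, `c'`. -/
def coneIntegrandDeriv (a b c a' b' c' : E3) (z : ℝ × ℝ) : ℝ :=
  4 * radial 4 3 (‖triMap a b c z‖ ^ 2) * inner ℝ (triMap a b c z) (triMap a' b' c' z) *
      det3 (triMap a b c z) (triMapU a b c z) (triMapV b c z) +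
    radial 2 2 (‖triMap a b c z‖ ^ 2) *
      (det3 (triMap a' b' c' z) (triMapU a b c z) (triMapV b c z) +
        det3 (triMap a b c z) (triMapU a' b' c' z) (triMapV b c z) +
        det3 (triMap a b c z) (triMapU a b c z) (triMapV b' c' z))

section Continuity

variable {X : Type*} [TopologicalSpace X] {s : Set X} {a b c a' b' c' : X → E3} {z : X → ℝ × ℝ}

theorem continuousOn_triMap (ha : ContinuousOn a s) (hb : ContinuousOn b s)
    (hc : ContinuousOn c s) (hz : ContinuousOn z s) :
    ContinuousOn (fun q => triMap (a q) (b q) (c q) (z q)) s := by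
  simp only [triMap, seg]; fun_prop

theorem continuousOn_triMapU (ha : ContinuousOn a s) (hb : ContinuousOn b s)
    (hc : ContinuousOn c s) (hz : ContinuousOn z s) :
    ContinuousOn (fun q => triMapU (a q) (b q) (c q) (z q)) s := by
  simp only [triMapU, seg]; fun_prop

theorem continuousOn_triMapV (hb : ContinuousOn b s)
    (hc : ContinuousOn c s) (hz : ContinuousOn z s) :
    ContinuousOn (fun q => triMapV (b q) (c q) (z q)) s := by
  simp only [triMapV]; fun_prop

theorem continuousOn_coneIntegrand (ha : ContinuousOn a s) (hb : ContinuousOn b s)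
    (hc : ContinuousOn c s) (hz : ContinuousOn z s)
    (hm : ∀ q ∈ s, triMap (a q) (b q) (c q) (z q) ∈ space) :
    ContinuousOn (fun q => radial 2 2 (‖triMap (a q) (b q) (c q) (z q)‖ ^ 2) *
      det3 (triMap (a q) (b q) (c q) (z q)) (triMapU (a q) (b q) (c q) (z q))
        (triMapV (b q) (c q) (z q))) s :=
  have cx := continuousOn_triMap ha hb hc hz
  (continuousOn_radial_norm_sq 2 2 cx hm).mul
    (continuousOn_det3 cx (continuousOn_triMapU ha hb hc hz) (continuousOn_triMapV hb hc hz))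

theorem continuousOn_coneIntegrandDeriv (ha : ContinuousOn a s) (hb : ContinuousOn b s)
    (hc : ContinuousOn c s) (ha' : ContinuousOn a' s) (hb' : ContinuousOn b' s)
    (hc' : ContinuousOn c' s) (hz : ContinuousOn z s)
    (hm : ∀ q ∈ s, triMap (a q) (b q) (c q) (z q) ∈ space) :
    ContinuousOn (fun q => coneIntegrandDeriv (a q) (b q) (c q) (a' q) (b' q) (c' q) (z q)) s := by
  have cx := continuousOn_triMap ha hb hc hz
  have cu := continuousOn_triMapU ha hb hc hz
  have cv := continuousOn_triMapV hb hc hz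
  have cx' := continuousOn_triMap ha' hb' hc' hz
  have cu' := continuousOn_triMapU ha' hb' hc' hz
  have cv' := continuousOn_triMapV hb' hc' hz
  exact (((continuousOn_const.mul (continuousOn_radial_norm_sq 4 3 cx hm)).mul
    (cx.inner cx')).mul (continuousOn_det3 cx cu cv)).add
    ((continuousOn_radial_norm_sq 2 2 cx hm).mul (((continuousOn_det3 cx' cu cv).add
      (continuousOn_det3 cx cu' cv)).add (continuousOn_det3 cx cu cv')))

end Continuity

/-- At a point `x` of a plane with the normal `N`, the derivative of the integrand of `coneIntegral`
is a divergence. The indices indicate partial derivatives of `x`, `xt` is the velocity, and `W` the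
velocity of `N`. -/
theorem coneIntegrandDeriv_eq_divergence {N W : Fin 4 → ℝ} {x xt xu xv xut xvt xuv : E3} {h k u : ℝ}
    (hx : x ∈ space) (hN : lor N N ≠ 0) (hNx : lor N (lift x) = 0)
    (hrad : 3 * h + 4 * ‖x‖ ^ 2 * k = 1 / (1 - ‖x‖ ^ 2) ^ 2)
    (h3 : det3 xt xu xv = u * lor N (lift₀ xt))
    (h4 : det4 N (lift x) (lift₀ xu) (lift₀ xv) = -(u * lor N N))
    (hW : lor W (lift x) + lor N (lift₀ xt) = 0) :
    4 * k * inner ℝ x xt * det3 x xu xv + h * (det3 xt xu xv + det3 x xut xv + det3 x xu xvt) =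
      (-(4 * k * inner ℝ x xu * det3 x xv xt +
          h * (det3 xu xv xt + det3 x xuv xt + det3 x xv xut)) -
        ((det4 N W (lift₀ xu) (lift₀ xv) + det4 N W (lift x) (lift₀ xuv)) / (1 - ‖x‖ ^ 2) +
          2 * inner ℝ x xu * det4 N W (lift x) (lift₀ xv) / (1 - ‖x‖ ^ 2) ^ 2) / (2 * lor N N)) +
      (-(4 * k * inner ℝ x xv * det3 x xt xu +
          h * (det3 xv xt xu + det3 x xvt xu + det3 x xt xuv)) +
        ((det4 N W (lift₀ xv) (lift₀ xu) + det4 N W (lift x) (lift₀ xuv)) / (1 - ‖x‖ ^ 2) +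
          2 * inner ℝ x xv * det4 N W (lift x) (lift₀ xu) / (1 - ‖x‖ ^ 2) ^ 2) / (2 * lor N N)) := by
  have hq := (one_sub_norm_sq_pos hx).ne'
  have h1 := radial_closed (h := h) (k := k) x xt xu xv xut xvt xuv
  have h2 := conormal_curl (W := W) (e := xu) (f := xv) hx hNx
  rw [hrad, h3] at h1
  rw [h4] at h2
  have hW' : lor W (lift x) = -lor N (lift₀ xt) := by linarith
  rw [hW'] at h2
  have h2' := congrArg (fun r => r / (2 * lor N N)) h2
  have e : -2 * -lor N (lift₀ xt) * -(u * lor N N) / (1 - ‖x‖ ^ 2) ^ 2 / (2 * lor N N) =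
      -(1 / (1 - ‖x‖ ^ 2) ^ 2 * (u * lor N (lift₀ xt))) := by
    field_simp
  rw [e] at h2'
  rw [h3]
  linear_combination h1 + h2'

/-- The integral of `coneIntegrandDeriv` reduces to the edges, since its integrand is a divergence. -/
theorem setIntegral_coneIntegrandDeriv {a b c a' b' c' : E3} (ha : a ∈ space) (hb : b ∈ space)
    (hc : c ∈ space) {N W : Fin 4 → ℝ} (hNdef : N = normal a b c) (hN : lor N N ≠ 0)
    (hWa : lor W (lift a) + lor N (lift₀ a') = 0)
    (hWb : lor W (lift b) + lor N (lift₀ b') = 0)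
    (hWc : lor W (lift c) + lor N (lift₀ c') = 0) :
    ∫ z in Icc (0 : ℝ × ℝ) 1, coneIntegrandDeriv a b c a' b' c' z =
      edgeTerm a b a' b' N W + edgeTerm b c b' c' N W + edgeTerm c a c' a' N W := by
  have hm : ∀ z ∈ Icc (0 : ℝ × ℝ) 1, triMap a b c z ∈ space := fun z hz => triMap_mem ha hb hc hz
  have dx := differentiable_triMap a b c
  have du := differentiable_triMapU a b c
  have dv := differentiable_triMapV b c
  have dx' := differentiable_triMap a' b' c'
  have hfu := fun z hz => ((hasDerivAt_radial_mul_det3 (hasDerivAt_triMap_fst a b c z)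
    (hasDerivAt_triMapV_fst b c z) (hasDerivAt_triMap_fst a' b' c' z) (hm z hz)).neg).sub
    ((hasDerivAt_conormal N W (hasDerivAt_triMap_fst a b c z) (hasDerivAt_triMapV_fst b c z)
      (hm z hz)).div_const (2 * lor N N))
  have hgv := fun z hz => ((hasDerivAt_radial_mul_det3 (hasDerivAt_triMap_snd a b c z)
    (hasDerivAt_triMap_snd a' b' c' z) (hasDerivAt_triMapU_snd a b c z) (hm z hz)).neg).add
    ((hasDerivAt_conormal N W (hasDerivAt_triMap_snd a b c z) (hasDerivAt_triMapU_snd a b c z)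
      (hm z hz)).div_const (2 * lor N N))
  have hdiv := fun z (hz : z ∈ Icc (0 : ℝ × ℝ) 1) =>
    coneIntegrandDeriv_eq_divergence (N := N) (W := W) (xut := triMapU a' b' c' z)
      (xvt := triMapV b' c' z) (xuv := c - b) (hm z hz) hN (hNdef ▸ lor_normal_triMap a b c z)
      (radial_divergence (norm_sq_lt_one (hm z hz)))
      (hNdef ▸ det3_triMap' a b c (triMap a' b' c' z) z) (hNdef ▸ det4_normal_triMap a b c z)
      (by
        rw [triMap, triMap, lor_lift_seg, lor_lift_seg, lor_lift₀_seg, lor_lift₀_seg]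
        linear_combination (1 - z.1) * hWa + z.1 * (1 - z.2) * hWb + z.1 * z.2 * hWc)
  have hgreen := green_unit_square (f := fun z =>
      -(radial 2 2 (‖triMap a b c z‖ ^ 2) *
        det3 (triMap a b c z) (triMapV b c z) (triMap a' b' c' z)) -
      det4 N W (lift (triMap a b c z)) (lift₀ (triMapV b c z)) / (1 - ‖triMap a b c z‖ ^ 2) /
        (2 * lor N N))
    (g := fun z => -(radial 2 2 (‖triMap a b c z‖ ^ 2) *
        det3 (triMap a b c z) (triMap a' b' c' z) (triMapU a b c z)) +
      det4 N W (lift (triMap a b c z)) (lift₀ (triMapU a b c z)) / (1 - ‖triMap a b c z‖ ^ 2) /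
        (2 * lor N N))
    (fun z hz => ((differentiableAt_radial_mul_det3 dx.differentiableAt dv.differentiableAt
      dx'.differentiableAt (hm z hz)).neg).fun_sub
      (differentiableAt_conormal N W _ dx.differentiableAt dv.differentiableAt (hm z hz)))
    (fun z hz => ((differentiableAt_radial_mul_det3 dx.differentiableAt dx'.differentiableAt
      du.differentiableAt (hm z hz)).neg).fun_add
      (differentiableAt_conormal N W _ dx.differentiableAt du.differentiableAt (hm z hz)))
    hfu hgv (ContinuousOn.congr (continuousOn_coneIntegrandDeriv continuousOn_const
      continuousOn_const continuousOn_const continuousOn_const continuousOn_const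
      continuousOn_const continuousOn_id hm) fun z hz => (hdiv z hz).symm)
  refine (setIntegral_congr_fun measurableSet_Icc hdiv).trans (hgreen.trans ?_)
  have s0 : ∀ a b c : E3, ∀ s, triMap a b c (s, 0) = seg a b s := fun a b c s => by
    simp [triMap, seg]
  have s1 : ∀ a b c : E3, ∀ s, triMap a b c (s, 1) = seg a c s := fun a b c s => by
    simp [triMap, seg]
  have s2 : ∀ a b c : E3, ∀ s, triMap a b c (1, s) = seg b c s := fun a b c s => by
    simp [triMap, seg]
  have u0 : ∀ a b c : E3, ∀ s, triMapU a b c (s, 0) = b - a := fun a b c s => by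
    simp [triMapU, seg]
  have u1 : ∀ a b c : E3, ∀ s, triMapU a b c (s, 1) = c - a := fun a b c s => by
    simp [triMapU, seg]
  have v1 : ∀ s, triMapV b c (1, s) = c - b := fun s => by simp [triMapV]
  have v0 : ∀ s, triMapV b c (0, s) = 0 := fun s => by simp [triMapV]
  have z3 : ∀ x y : E3, det3 x 0 y = 0 := fun x y => by simp [det3_eq]
  have z4 : ∀ X, det4 N W X (lift₀ 0) = 0 := fun x => by simp [det4, lift₀]
  have sw : ∀ x y z : E3, det3 x z y = -det3 x y z := fun x y z => by simp only [det3_eq]; ring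
  have e1 : ∀ {a b a' b' : E3}, a ∈ space → b ∈ space → ∫ s in (0 : ℝ)..1,
      (-(radial 2 2 (‖seg a b s‖ ^ 2) * det3 (seg a b s) (seg a' b' s) (b - a)) +
      det4 N W (lift (seg a b s)) (lift₀ (b - a)) / (1 - ‖seg a b s‖ ^ 2) / (2 * lor N N)) =
      -edgeTerm a b a' b' N W := by
    intro a b a' b' ha hb
    rw [← integral_edge ha hb, ← intervalIntegral.integral_neg]
    congr 1; ext s; ring
  rw [edgeTerm_swap a c, ← neg_neg (edgeTerm a b a' b' N W), ← e1 ha hb, ← e1 ha hc,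
    ← integral_edge hb hc]
  simp only [s0, s1, s2, u0, u1, v0, v1, z3, z4, sw _ _ (c - b), mul_zero, zero_div, neg_zero,
    sub_zero, intervalIntegral.integral_zero, mul_neg, neg_neg]
  ring

/-- The derivative of the volume of the cone over a moving triangle. -/
theorem hasDerivAt_coneIntegral {a b c a' b' c' : ℝ → E3} {U : Set ℝ} (hU : IsOpen U)
    (ha : ∀ t ∈ U, HasDerivAt a (a' t) t) (hb : ∀ t ∈ U, HasDerivAt b (b' t) t)
    (hc : ∀ t ∈ U, HasDerivAt c (c' t) t) (ha' : ContinuousOn a' U) (hb' : ContinuousOn b' U)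
    (hc' : ContinuousOn c' U) (hma : ∀ t ∈ U, a t ∈ space) (hmb : ∀ t ∈ U, b t ∈ space)
    (hmc : ∀ t ∈ U, c t ∈ space) {t : ℝ} (ht : t ∈ U) {W : Fin 4 → ℝ}
    (hN : lor (normal (a t) (b t) (c t)) (normal (a t) (b t) (c t)) ≠ 0)
    (hW : HasDerivAt (fun s => normal (a s) (b s) (c s)) W t) :
    HasDerivAt (fun s => coneIntegral (a s) (b s) (c s))
      (edgeTerm (a t) (b t) (a' t) (b' t) (normal (a t) (b t) (c t)) W +
        edgeTerm (b t) (c t) (b' t) (c' t) (normal (a t) (b t) (c t)) W +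
        edgeTerm (c t) (a t) (c' t) (a' t) (normal (a t) (b t) (c t)) W) t := by
  set N := normal (a t) (b t) (c t) with hNdef
  -- the incidence relations, differentiated
  have hWx : ∀ {x x' : ℝ → E3}, HasDerivAt x (x' t) t →
      (∀ s, lor (normal (a s) (b s) (c s)) (lift (x s)) = 0) →
      lor W (lift (x t)) + lor N (lift₀ (x' t)) = 0 := by
    intro x x' hx h
    have h1 := hasDerivAt_lor hW (hasDerivAt_lift hx)
    simp only [h] at h1
    exact h1.unique (hasDerivAt_const t 0)
  have hWa := hWx (ha t ht) fun s => lor_normal_left _ _ _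
  have hWb := hWx (hb t ht) fun s => lor_normal_mid _ _ _
  have hWc := hWx (hc t ht) fun s => lor_normal_right _ _ _
  have hac : ContinuousOn a U := fun s hs => (ha s hs).continuousAt.continuousWithinAt
  have hbc : ContinuousOn b U := fun s hs => (hb s hs).continuousAt.continuousWithinAt
  have hcc : ContinuousOn c U := fun s hs => (hc s hs).continuousAt.continuousWithinAt
  have hf : MapsTo Prod.fst (U ×ˢ Icc (0 : ℝ × ℝ) 1) U := fun q hq => hq.1
  have hmem : ∀ s ∈ U, ∀ z ∈ Icc (0 : ℝ × ℝ) 1, triMap (a s) (b s) (c s) z ∈ space :=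
    fun s hs z hz => triMap_mem (hma _ hs) (hmb _ hs) (hmc _ hs) hz
  have main := hasDerivAt_setIntegral_of_compact (μ := volume) hU
    (isCompact_Icc (a := (0 : ℝ × ℝ)) (b := 1))
    (f' := fun s z => coneIntegrandDeriv (a s) (b s) (c s) (a' s) (b' s) (c' s) z)
    (fun s hs => continuousOn_coneIntegrand continuousOn_const continuousOn_const
      continuousOn_const continuousOn_id (hmem s hs))
    (continuousOn_coneIntegrandDeriv (hac.comp continuousOn_fst hf) (hbc.comp continuousOn_fst hf)
      (hcc.comp continuousOn_fst hf) (ha'.comp continuousOn_fst hf) (hb'.comp continuousOn_fst hf)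
      (hc'.comp continuousOn_fst hf) continuousOn_snd fun q hq => hmem q.1 hq.1 q.2 hq.2)
    (fun s hs z hz => hasDerivAt_radial_mul_det3
      (hasDerivAt_seg_param (ha s hs) (hasDerivAt_seg_param (hb s hs) (hc s hs) z.2) z.1)
      ((hasDerivAt_seg_param (hb s hs) (hc s hs) z.2).sub (ha s hs))
      (((hc s hs).sub (hb s hs)).const_smul z.1) (hmem s hs z hz)) ht
  exact main.congr_deriv (setIntegral_coneIntegrandDeriv (hma t ht) (hmb t ht) (hmc t ht) hNdef hN
    hWa hWb hWc)

theorem continuousOn_coneIntegral {X : Type*} [TopologicalSpace X] [FirstCountableTopology X]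
    {s : Set X} {a b c : X → E3} (ha : ContinuousOn a s) (hb : ContinuousOn b s)
    (hc : ContinuousOn c s) (hma : ∀ t ∈ s, a t ∈ space) (hmb : ∀ t ∈ s, b t ∈ space)
    (hmc : ∀ t ∈ s, c t ∈ space) : ContinuousOn (fun t => coneIntegral (a t) (b t) (c t)) s := by
  have hf : MapsTo Prod.fst (s ×ˢ Icc (0 : ℝ × ℝ) 1) s := fun q hq => hq.1
  exact continuousOn_setIntegral_of_compact isCompact_Icc
    (continuousOn_coneIntegrand (ha.comp continuousOn_fst hf) (hb.comp continuousOn_fst hf)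
      (hc.comp continuousOn_fst hf) continuousOn_snd
      fun q hq => triMap_mem (hma _ hq.1) (hmb _ hq.1) (hmc _ hq.1) hq.2)

/-! ### Volumes of tetrahedra -/

/-- A plane, given by its homogeneous coordinates, is a null set. -/
theorem volume_plane_eq_zero {X : Fin 4 → ℝ} (hX : X ≠ 0) :
    volume {x : E3 | lor X (lift x) = 0} = 0 := by
  set n : E3 := WithLp.toLp 2 ![X 1, X 2, X 3] with hn
  have hl : ∀ x, lor X (lift x) = inner ℝ n x - X 0 := by
    intro x; rw [inner_eq]; simp [lor, lift, hn]
  rcases eq_or_ne n 0 with h0 | h0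
  · have : X 0 ≠ 0 := by
      intro h
      apply hX
      have h1 : ∀ i, n i = 0 := fun i => by rw [h0]; rfl
      ext i
      fin_cases i
      exacts [h, h1 0, h1 1, h1 2]
    simp [hl, h0, this]
  · rcases eq_empty_or_nonempty {x : E3 | lor X (lift x) = 0} with he | ⟨p, hp⟩
    · simp [he]
    · refine measure_mono_null (t := (AffineSubspace.mk' p (innerSL ℝ n).ker : Set E3)) ?_
        (Measure.addHaar_affineSubspace _ _ ?_)
      · intro x hx
        have hx : lor X (lift x) = 0 := hx
        have hp : lor X (lift p) = 0 := hp
        rw [hl] at hx hp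
        simp [AffineSubspace.mem_mk', inner_sub_right]
        linarith
      · intro h
        have h1 := congrArg AffineSubspace.direction h
        rw [AffineSubspace.direction_mk', AffineSubspace.direction_top] at h1
        have h2 : n ∈ (innerSL ℝ n).ker := by rw [h1]; trivial
        simp at h2
        exact h0 h2

theorem det3_sub_eq_lor (o a b x : E3) :
    det3 (o - x) (a - x) (b - x) = -lor (normal o a b) (lift x) := by
  simp [det3_eq, lor, normal, lift]; ring

theorem lor_normal_eq_det3 (o a b c : E3) :
    lor (normal o a b) (lift c) = det3 (a - o) (b - o) (c - o) := by
  simp [det3_eq, lor, normal, lift]; ring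

theorem normal_ne_zero {o a b c : E3} (h : det3 (a - o) (b - o) (c - o) ≠ 0) :
    normal o a b ≠ 0 := by
  intro h0
  apply h
  rw [← lor_normal_eq_det3, h0]
  simp [lor]

theorem mem_segment_iff_seg {a b x : E3} :
    x ∈ segment ℝ a b ↔ ∃ s ∈ Icc (0 : ℝ) 1, seg a b s = x := by
  rw [segment_eq_image]; rfl

theorem mem_convexHull_triangle {a b c x : E3} :
    x ∈ convexHull ℝ {a, b, c} ↔ ∃ z ∈ Icc (0 : ℝ × ℝ) 1, triMap a b c z = x := by
  rw [convexHull_insert (by simp), convexHull_pair, mem_convexJoin]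
  simp only [mem_singleton_iff, exists_eq_left, mem_segment_iff_seg]
  constructor
  · rintro ⟨y, ⟨v, hv, rfl⟩, u, hu, rfl⟩
    exact ⟨(u, v), ⟨⟨hu.1, hv.1⟩, ⟨hu.2, hv.2⟩⟩, rfl⟩
  · rintro ⟨z, hz, rfl⟩
    exact ⟨_, ⟨z.2, ⟨hz.1.2, hz.2.2⟩, rfl⟩, z.1, ⟨hz.1.1, hz.2.1⟩, rfl⟩

theorem mem_convexHull_tetrahedron {o a b c x : E3} :
    x ∈ convexHull ℝ {o, a, b, c} ↔ ∃ r ∈ Icc (0 : ℝ) 1, ∃ z ∈ Icc (0 : ℝ × ℝ) 1,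
      seg o (triMap a b c z) r = x := by
  rw [convexHull_insert (by simp), mem_convexJoin]
  simp only [mem_singleton_iff, exists_eq_left, mem_segment_iff_seg, mem_convexHull_triangle]
  constructor
  · rintro ⟨y, ⟨z, hz, rfl⟩, r, hr, rfl⟩
    exact ⟨r, hr, z, hz, rfl⟩
  · rintro ⟨r, hr, z, hz, rfl⟩
    exact ⟨_, ⟨z, hz, rfl⟩, r, hr, rfl⟩

theorem convexHull_subset_space {s : Set E3} (hs : s ⊆ space) : convexHull ℝ s ⊆ space :=
  convexHull_min hs (convex_ball _ _)

theorem density_pos {x : E3} (hx : x ∈ space) : 0 < density x := by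
  have := one_sub_norm_sq_pos hx
  unfold density; positivity

theorem continuousOn_density : ContinuousOn density space := by
  unfold density
  refine ContinuousOn.inv₀ (by fun_prop) fun x hx => ?_
  exact pow_ne_zero _ (one_sub_norm_sq_pos hx).ne'

theorem measurable_density : Measurable density := by
  unfold density; fun_prop

theorem vol_apply {A : Set E3} (hA : MeasurableSet A) (hs : A ⊆ space) :
    vol A = ∫⁻ x in A, ENNReal.ofReal (density x) := by
  rw [vol, withDensity_apply _ hA, Measure.restrict_restrict hA, inter_eq_left.2 hs]

theorem vol_toReal {A : Set E3} (hA : MeasurableSet A) (hs : A ⊆ space) :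
    (vol A).toReal = ∫ x in A, density x := by
  rw [vol_apply hA hs, integral_eq_lintegral_of_nonneg_ae]
  · exact (ae_restrict_iff' hA).2 (Eventually.of_forall fun x hx => (density_pos (hs hx)).le)
  · exact measurable_density.aestronglyMeasurable

/-- The parametrization of the tetrahedron `oabc` by the unit cube. -/
def tetMap (o a b c : E3) (y : E3) : E3 := seg o (triMap a b c (y 1, y 2)) (y 0)

theorem det_eq_det3 (L : E3 →L[ℝ] E3) :
    L.det = det3 (L (EuclideanSpace.single 0 1)) (L (EuclideanSpace.single 1 1))
      (L (EuclideanSpace.single 2 1)) := by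
  rw [ContinuousLinearMap.det, ← LinearMap.det_toMatrix (EuclideanSpace.basisFun (Fin 3) ℝ).toBasis,
    ← Matrix.det_transpose, det3]
  congr 1
  ext i j
  fin_cases i <;> simp [LinearMap.toMatrix_apply]

theorem exists_hasFDerivAt_tetMap (o a b c y : E3) : ∃ L : E3 →L[ℝ] E3,
    HasFDerivAt (tetMap o a b c) L y ∧
      L.det = y 0 ^ 2 * y 1 * det3 (a - o) (b - o) (c - o) := by
  have hp : ∀ i, HasFDerivAt (fun y : E3 => y i) (PiLp.proj 2 (fun _ : Fin 3 => ℝ) i : E3 →L[ℝ] ℝ) y :=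
    fun i => (PiLp.proj 2 (fun _ : Fin 3 => ℝ) i : E3 →L[ℝ] ℝ).hasFDerivAt
  have hseg : ∀ {f : E3 → E3} {f' : E3 →L[ℝ] E3} (p : E3) (i : Fin 3), HasFDerivAt f f' y →
      HasFDerivAt (fun y => seg p (f y) (y i)) _ y := fun p i hf =>
    (((hp i).const_sub 1).smul_const p).add ((hp i).smul hf)
  have h := hseg o 0 (hseg a 1 (hseg b 2 (hasFDerivAt_const c y)))
  refine ⟨_, h, ?_⟩
  rw [det_eq_det3]
  simp [det3_eq, seg]
  ring

/-- The half-open unit cube on which `tetMap` is injective. -/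
def halfCube : Set E3 := {y | (y 0 ∈ Ioc (0 : ℝ) 1 ∧ y 1 ∈ Ioc (0 : ℝ) 1) ∧ y 2 ∈ Icc (0 : ℝ) 1}

theorem measurableSet_halfCube : MeasurableSet halfCube := by
  unfold halfCube; measurability

theorem det3_tetMap (o a b c y : E3) :
    det3 (tetMap o a b c y - o) (b - o) (c - o) =
        y 0 * (1 - y 1) * det3 (a - o) (b - o) (c - o) ∧
      det3 (a - o) (tetMap o a b c y - o) (c - o) =
        y 0 * y 1 * (1 - y 2) * det3 (a - o) (b - o) (c - o) ∧
      det3 (a - o) (b - o) (tetMap o a b c y - o) =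
        y 0 * y 1 * y 2 * det3 (a - o) (b - o) (c - o) := by
  refine ⟨?_, ?_, ?_⟩ <;>
  · simp only [det3_eq, tetMap, triMap, seg_apply, PiLp.sub_apply]
    ring

theorem injOn_tetMap {o a b c : E3} (h : det3 (a - o) (b - o) (c - o) ≠ 0) :
    InjOn (tetMap o a b c) halfCube := by
  rintro x ⟨⟨h0, h1⟩, h2⟩ y ⟨⟨k0, k1⟩, k2⟩ hxy
  obtain ⟨e1, e2, e3⟩ := det3_tetMap o a b c x
  obtain ⟨f1, f2, f3⟩ := det3_tetMap o a b c y
  rw [hxy] at e1 e2 e3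
  have g1 := mul_right_cancel₀ h (e1.symm.trans f1)
  have g2 := mul_right_cancel₀ h (e2.symm.trans f2)
  have g3 := mul_right_cancel₀ h (e3.symm.trans f3)
  have i0 : x 0 = y 0 := by linear_combination g1 + g2 + g3
  have i1 : x 1 = y 1 := by
    have : y 0 * x 1 = y 0 * y 1 := by rw [i0] at g2 g3; linear_combination g2 + g3
    exact mul_left_cancel₀ k0.1.ne' this
  have i2 : x 2 = y 2 := by
    rw [i0, i1] at g3
    exact mul_left_cancel₀ (mul_pos k0.1 k1.1).ne' g3
  ext i
  fin_cases i
  exacts [i0, i1, i2]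

theorem volume_preserving_cube :
    MeasurePreserving (fun y : E3 => ((y 0, (y 1, y 2)) : ℝ × ℝ × ℝ)) volume volume :=
  ((MeasurePreserving.id volume).prod (volume_preserving_finTwoArrow ℝ)).comp
    ((volume_preserving_piFinSuccAbove (fun _ : Fin 3 => ℝ) 0).comp
      (EuclideanSpace.volume_preserving_symm_measurableEquiv_toLp (Fin 3)))

theorem measurableEmbedding_cube :
    MeasurableEmbedding (fun y : E3 => ((y 0, (y 1, y 2)) : ℝ × ℝ × ℝ)) :=
  (((MeasurableEquiv.refl ℝ).prodCongr MeasurableEquiv.finTwoArrow).measurableEmbedding.comp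
    (MeasurableEquiv.piFinSuccAbove (fun _ : Fin 3 => ℝ) 0).measurableEmbedding).comp
      (MeasurableEquiv.toLp 2 (Fin 3 → ℝ)).symm.measurableEmbedding

/-- The oriented volume of the tetrahedron `oabc`. -/
def tetVolume (o a b c : E3) : ℝ :=
  SignType.sign (det3 (a - o) (b - o) (c - o)) * (vol (convexHull ℝ {o, a, b, c})).toReal

theorem measurableSet_tetrahedron (o a b c : E3) : MeasurableSet (convexHull ℝ {o, a, b, c}) :=
  ((toFinite {o, a, b, c}).isCompact_convexHull ℝ).measurableSet

/-- The oriented volume of a tetrahedron as an integral over the unit cube. -/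
theorem tetVolume_eq_integral {o a b c : E3} (ho : o ∈ space) (ha : a ∈ space) (hb : b ∈ space)
    (hc : c ∈ space) : tetVolume o a b c = det3 (a - o) (b - o) (c - o) *
      ∫ w in Icc (0 : ℝ × ℝ × ℝ) 1, w.1 ^ 2 * w.2.1 * density (seg o (triMap a b c w.2) w.1) := by
  rcases eq_or_ne (det3 (a - o) (b - o) (c - o)) 0 with h | h
  · simp [tetVolume, h]
  set H := convexHull ℝ {o, a, b, c} with hH
  have hHs : H ⊆ space := convexHull_subset_space (by
    rintro x (rfl | rfl | rfl | rfl) <;> assumption)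
  have hmap : ∀ {y : E3}, y ∈ halfCube → tetMap o a b c y ∈ H := fun {y} hy =>
    mem_convexHull_tetrahedron.2 ⟨y 0, ⟨hy.1.1.1.le, hy.1.1.2⟩, (y 1, y 2),
      ⟨⟨hy.1.2.1.le, hy.2.1⟩, ⟨hy.1.2.2, hy.2.2⟩⟩, rfl⟩
  have himg : H =ᵐ[volume] tetMap o a b c '' halfCube := by
    refine (ae_eq_set.2 ⟨?_, ?_⟩)
    · refine measure_mono_null (fun x hx => ?_) (volume_plane_eq_zero (normal_ne_zero h))
      obtain ⟨r, hr, z, hz, rfl⟩ := mem_convexHull_tetrahedron.1 hx.1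
      show lor _ _ = 0
      by_cases h0 : r = 0 ∨ z.1 = 0
      · rcases h0 with rfl | h0
        · rw [lor_lift_seg, lor_normal_left]; ring
        · rw [lor_lift_seg, lor_normal_left, triMap, lor_lift_seg, lor_normal_mid, h0]; ring
      · rw [not_or] at h0
        refine absurd ?_ hx.2
        refine ⟨WithLp.toLp 2 ![r, z.1, z.2], ⟨⟨⟨?_, hr.2⟩, ⟨?_, hz.2.1⟩⟩, ⟨hz.1.2, hz.2.2⟩⟩, rfl⟩
        · exact lt_of_le_of_ne hr.1 (Ne.symm h0.1)
        · exact lt_of_le_of_ne hz.1.1 (Ne.symm h0.2)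
    · rw [sdiff_eq_empty.2 (by rintro _ ⟨y, hy, rfl⟩; exact hmap hy)]
      exact measure_empty
  choose L hL hLdet using exists_hasFDerivAt_tetMap o a b c
  rw [tetVolume, vol_toReal (measurableSet_tetrahedron o a b c) hHs, setIntegral_congr_set himg,
    integral_image_eq_integral_abs_det_fderiv_smul volume measurableSet_halfCube
      (fun y _ => (hL y).hasFDerivWithinAt) (injOn_tetMap h)]
  have e : EqOn (fun y => |(L y).det| • density (tetMap o a b c y)) (fun y =>
      |det3 (a - o) (b - o) (c - o)| *
        (y 0 ^ 2 * y 1 * density (seg o (triMap a b c (y 1, y 2)) (y 0)))) halfCube := by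
    intro y hy
    have h1 : 0 ≤ y 0 ^ 2 * y 1 := mul_nonneg (sq_nonneg _) hy.1.2.1.le
    simp only [hLdet, abs_mul _ (det3 _ _ _), abs_of_nonneg h1, smul_eq_mul, tetMap]
    ring
  have hcube : halfCube =ᵐ[volume]
      (fun y : E3 => ((y 0, (y 1, y 2)) : ℝ × ℝ × ℝ)) ⁻¹' Icc 0 1 := by
    refine (ae_eq_set.2 ⟨?_, ?_⟩)
    · rw [sdiff_eq_empty.2 ?_, measure_empty]
      intro y hy
      exact ⟨⟨hy.1.1.1.le, hy.1.2.1.le, hy.2.1⟩, ⟨hy.1.1.2, hy.1.2.2, hy.2.2⟩⟩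
    · refine measure_mono_null (t := {x : E3 | lor ![0, 1, 0, 0] (lift x) = 0} ∪
        {x : E3 | lor ![0, 0, 1, 0] (lift x) = 0}) ?_ (measure_union_null
          (volume_plane_eq_zero fun h => by simpa using congrFun h 1)
          (volume_plane_eq_zero fun h => by simpa using congrFun h 2))
      rintro y ⟨⟨⟨h0, h1, h2⟩, ⟨k0, k1, k2⟩⟩, hn⟩
      by_contra hcon
      simp only [mem_union, not_or] at hcon
      simp [lor, lift] at hcon h0 h1 h2 k0 k1 k2
      exact hn ⟨⟨⟨lt_of_le_of_ne h0 (Ne.symm hcon.1), k0⟩,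
        ⟨lt_of_le_of_ne h1 (Ne.symm hcon.2), k1⟩⟩, ⟨h2, k2⟩⟩
  rw [setIntegral_congr_fun measurableSet_halfCube e, integral_const_mul,
    setIntegral_congr_set hcube,
    volume_preserving_cube.setIntegral_preimage_emb measurableEmbedding_cube
      (fun w => w.1 ^ 2 * w.2.1 * density (seg o (triMap a b c w.2) w.1)), ← mul_assoc]
  congr 1
  exact sign_mul_abs _

theorem continuousOn_tetVolume {a b c : E3} (ha : a ∈ space) (hb : b ∈ space) (hc : c ∈ space) :
    ContinuousOn (fun o => tetVolume o a b c) space := by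
  refine ContinuousOn.congr ?_ fun o ho => tetVolume_eq_integral ho ha hb hc
  refine (continuousOn_det3 (by fun_prop) (by fun_prop) (by fun_prop)).mul ?_
  refine continuousOn_setIntegral_of_compact isCompact_Icc ?_
  have : ContinuousOn (fun q : E3 × ℝ × ℝ × ℝ => seg q.1 (triMap a b c q.2.2) q.2.1)
      (space ×ˢ Icc (0 : ℝ × ℝ × ℝ) 1) := by
    simp only [triMap, seg]; fun_prop
  refine ContinuousOn.mul (by fun_prop) (continuousOn_density.comp this ?_)
  rintro ⟨o, w⟩ ⟨ho, hw⟩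
  exact seg_mem ho (triMap_mem ha hb hc ⟨hw.1.2, hw.2.2⟩) ⟨hw.1.1, hw.2.1⟩

theorem tetVolume_zero (a b c : E3) : tetVolume 0 a b c = coneVolume a b c := by
  simp [tetVolume, coneVolume]

theorem coneVolume_eq_coneIntegral {a b c : E3} (ha : a ∈ space) (hb : b ∈ space)
    (hc : c ∈ space) : coneVolume a b c = coneIntegral a b c := by
  have h0 : (0 : E3) ∈ space := by simp [space]
  have hcont : ContinuousOn (fun w : ℝ × ℝ × ℝ =>
      w.1 ^ 2 * w.2.1 * density (seg 0 (triMap a b c w.2) w.1)) (Icc 0 1) := by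
    have : ContinuousOn (fun w : ℝ × ℝ × ℝ => seg 0 (triMap a b c w.2) w.1) (Icc 0 1) := by
      simp only [triMap, seg]; fun_prop
    refine ContinuousOn.mul (by fun_prop) (continuousOn_density.comp this ?_)
    intro w hw
    exact seg_mem h0 (triMap_mem ha hb hc ⟨hw.1.2, hw.2.2⟩) ⟨hw.1.1, hw.2.1⟩
  have hint := hcont.integrableOn_compact (μ := volume) isCompact_Icc
  rw [← tetVolume_zero, tetVolume_eq_integral h0 ha hb hc, coneIntegral]
  have hI : Icc (0 : ℝ × ℝ × ℝ) 1 = Icc (0 : ℝ) 1 ×ˢ Icc (0 : ℝ × ℝ) 1 := by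
    rw [Icc_prod_eq]; rfl
  rw [hI] at hint ⊢
  rw [Measure.volume_eq_prod, ← Measure.prod_restrict, integral_prod_symm, ← integral_const_mul]
  · congr 1; ext z
    rw [det3_triMap]
    simp only [sub_zero, radial, density]
    rw [← integral_mul_const, ← integral_const_mul]
    congr 1; ext r
    simp only [seg, smul_zero, zero_add, norm_smul, mul_pow, Real.norm_eq_abs, sq_abs]
    ring
  · rw [Measure.prod_restrict]; exact hint

/-! ### Nondegenerate triangles -/

theorem AffineIndependent.not_smul {a b c : E3} (h : AffineIndependent ℝ ![a, b, c]) :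
    a ≠ b ∧ ∀ s : ℝ, c - a ≠ s • (b - a) := by
  have h1 := affineIndependent_iff_not_collinear_set.1 h
  refine ⟨fun hab => h1 ?_, fun s hs => h1 ?_⟩
  · subst hab; simp [collinear_pair]
  · rw [collinear_iff_of_mem (p₀ := a) (by simp)]
    refine ⟨b - a, ?_⟩
    rintro p (rfl | rfl | rfl)
    · exact ⟨0, by simp⟩
    · exact ⟨1, by simp⟩
    · exact ⟨s, by rw [← hs]; simp⟩

theorem lor_normal_self_pos {a b c : E3} (ha : a ∈ space)
    (h : AffineIndependent ℝ ![a, b, c]) : 0 < lor (normal a b c) (normal a b c) := by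
  obtain ⟨hab, hs⟩ := AffineIndependent.not_smul h
  have h1 := lor_normal_normal (c := c) (d := c) ha hab
  have h2 : lor (normal a b c) (normal b a c) = -lor (normal a b c) (normal a b c) := by
    simp [lor, normal, det3_eq]; ring
  have h3 : orth a (b - a) (c - a) ≠ 0 := by
    rw [orth, sub_ne_zero]; exact hs _
  have := one_sub_norm_sq_pos ha
  have := metric_self_pos ha (sub_ne_zero.2 hab.symm)
  have := metric_self_pos ha h3
  rw [h2, neg_inj] at h1
  rw [h1]; positivity

theorem differentiableAt_normal {a b c : ℝ → E3} {t : ℝ} (ha : DifferentiableAt ℝ a t)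
    (hb : DifferentiableAt ℝ b t) (hc : DifferentiableAt ℝ c t) :
    DifferentiableAt ℝ (fun s => normal (a s) (b s) (c s)) t := by
  have ha := differentiableAt_coord ha
  have hb := differentiableAt_coord hb
  have hc := differentiableAt_coord hc
  refine differentiableAt_pi.2 fun i => ?_
  fin_cases i <;> simp [normal, det3_eq] <;> fun_prop

end Klein

namespace OrientedClosedSurface

open Klein Set Filter Topology

variable {V : Type*} (S : OrientedClosedSurface V)

/-! ### Constancy of the oriented volume -/

theorem tri_rotate_iff {a b c : V} : S.tri b c a ↔ S.tri a b c :=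
  ⟨fun h => S.tri_rotate (S.tri_rotate h), fun h => S.tri_rotate h⟩

variable {S} in
theorem IsPolyhedral.lor_pos {p : V → E3} (h : S.IsPolyhedral p) {a b c : V} (habc : S.tri a b c) :
    0 < lor (normal (p a) (p b) (p c)) (normal (p a) (p b) (p c)) :=
  lor_normal_self_pos (h.1 a) (h.2 a b c habc)

variable {S} in
theorem IsPolyhedral.ne {p : V → E3} (h : S.IsPolyhedral p) {a b c : V} (habc : S.tri a b c) :
    p a ≠ p b :=
  (AffineIndependent.not_smul (h.2 a b c habc)).1

variable [Fintype V]

open Classical in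
theorem sum_rotate (f : V → V → V → ℝ) :
    (∑ a, ∑ b, ∑ c, if S.tri a b c then f b c a else 0) =
      ∑ a, ∑ b, ∑ c, if S.tri a b c then f a b c else 0 := by
  rw [Finset.sum_comm]
  simp_rw [← S.tri_rotate_iff (V := V)]
  refine Finset.sum_congr rfl fun b _ => ?_
  rw [Finset.sum_comm]

open Classical in
/-- A sum over the directed edges of the triangles vanishes if the contributions of the two
triangles at each edge cancel. -/
theorem sum_eq_zero_of_edges (f : V → V → V → ℝ)
    (h : ∀ a b c d, S.tri a b c → S.tri b a d → f a b c + f b a d = 0) :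
    (∑ a, ∑ b, ∑ c, if S.tri a b c then f a b c else 0) = 0 := by
  set g : V → V → ℝ := fun a b => ∑ c, if S.tri a b c then f a b c else 0 with hg
  have single : ∀ {a b c}, S.tri a b c → g a b = f a b c := by
    intro a b c h
    rw [hg]
    simp only
    rw [Finset.sum_eq_single c, if_pos h]
    · intro d _ hd
      exact if_neg fun h' => hd (S.tri_unique h' h)
    · simp
  have anti : ∀ a b, g a b = -g b a := by
    intro a b
    by_cases hab : ∃ c, S.tri a b c
    · obtain ⟨c, hc⟩ := hab
      obtain ⟨d, hd⟩ := S.tri_opposite hc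
      rw [single hc, single hd, eq_neg_iff_add_eq_zero]
      exact h a b c d hc hd
    · have hba : ¬ ∃ d, S.tri b a d := fun ⟨d, hd⟩ => hab (S.tri_opposite hd)
      rw [not_exists] at hab hba
      simp [hg, hab, hba]
  have : ∑ a, ∑ b, g a b = -∑ a, ∑ b, g a b := by
    conv_lhs => rw [Finset.sum_comm]
    rw [← Finset.sum_neg_distrib]
    refine Finset.sum_congr rfl fun b _ => ?_
    rw [← Finset.sum_neg_distrib]
    exact Finset.sum_congr rfl fun a _ => anti a b
  change ∑ a, ∑ b, g a b = 0
  linarith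

open Classical in
/-- The oriented volume is stationary if the dihedral angles are constant. -/
theorem hasDerivAt_orientedVolume {p : ℝ → V → E3} {U : Set ℝ} (hU : IsOpen U)
    (hpoly : ∀ t ∈ U, S.IsPolyhedral (p t)) (hsmooth : ∀ v, ContDiffOn ℝ 1 (fun t => p t v) U)
    (hangle : ∀ a b c d, S.tri a b c → S.tri b a d → ∀ s ∈ U, ∀ t ∈ U,
      dihedralAngle (p s a) (p s b) (p s c) (p s d) = dihedralAngle (p t a) (p t b) (p t c) (p t d))
    {t : ℝ} (ht : t ∈ U) : HasDerivAt (fun s => S.orientedVolume (p s)) 0 t := by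
  have hd : ∀ v, ∀ s ∈ U, HasDerivAt (fun s => p s v) (deriv (fun s => p s v) s) s := fun v s hs =>
    (((hsmooth v).differentiableOn one_ne_zero).differentiableAt (hU.mem_nhds hs)).hasDerivAt
  have hd' : ∀ v, ContinuousOn (deriv fun s => p s v) U := fun v =>
    (hsmooth v).continuousOn_deriv_of_isOpen hU le_rfl
  set N : V → V → V → ℝ → Fin 4 → ℝ := fun a b c s => normal (p s a) (p s b) (p s c) with hNdef
  have hN : ∀ a b c, HasDerivAt (N a b c) (deriv (N a b c) t) t := fun a b c =>
    (differentiableAt_normal (hd a t ht).differentiableAt (hd b t ht).differentiableAt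
      (hd c t ht).differentiableAt).hasDerivAt
  have hrot : ∀ a b c, N b c a = N a b c := fun a b c => funext fun s => normal_rotate _ _ _
  set f : V → V → V → ℝ := fun a b c => edgeTerm (p t a) (p t b) (deriv (fun s => p s a) t)
    (deriv (fun s => p s b) t) (N a b c t) (deriv (N a b c) t) with hf
  have hzero : (∑ a, ∑ b, ∑ c, if S.tri a b c then f a b c else 0) = 0 := by
    refine S.sum_eq_zero_of_edges f fun a b c d habc hbad => ?_
    have hγ := gram_lift_pos ((hpoly t ht).1 a) ((hpoly t ht).ne habc)
    have key := rotation_speed_eq (hN a b c) (hN b a d) (hasDerivAt_lift (hd a t ht))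
      (hasDerivAt_lift (hd b t ht)) (lor_normal_left _ _ _) (lor_normal_mid _ _ _)
      (lor_normal_mid _ _ _) (lor_normal_left _ _ _) hγ (by
        filter_upwards [hU.mem_nhds ht] with s hs
        exact dihedralAngle_eq_imp ((hpoly t ht).1 a) ((hpoly t ht).ne habc) ((hpoly s hs).1 a)
          ((hpoly s hs).ne habc) (hangle a b c d habc hbad t ht s hs))
    have h1 := ((hpoly t ht).lor_pos habc).ne'
    have h2 := ((hpoly t ht).lor_pos hbad).ne'
    simp only [hf]
    rw [edgeTerm_swap (p t a) (p t b), edgeTerm, edgeTerm]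
    simp only [hNdef] at key ⊢
    field_simp
    linear_combination (edgeLength (p t a) (p t b)) * key
  have hV : ∀ s ∈ U, S.orientedVolume (p s) =
      (∑ a, ∑ b, ∑ c, if S.tri a b c then coneIntegral (p s a) (p s b) (p s c) else 0) / 3 := by
    intro s hs
    rw [orientedVolume]
    simp only [coneVolume_eq_coneIntegral ((hpoly s hs).1 _) ((hpoly s hs).1 _) ((hpoly s hs).1 _)]
  refine HasDerivAt.congr_of_eventuallyEq ?_ (eventually_of_mem (hU.mem_nhds ht) hV)
  have hsum : HasDerivAt (fun s => ∑ a, ∑ b, ∑ c,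
      if S.tri a b c then coneIntegral (p s a) (p s b) (p s c) else 0)
      (∑ a, ∑ b, ∑ c, if S.tri a b c then (f a b c + f b c a + f c a b) else 0) t := by
    refine HasDerivAt.fun_sum fun a _ => HasDerivAt.fun_sum fun b _ => HasDerivAt.fun_sum fun c _ => ?_
    split_ifs with habc
    · have := hasDerivAt_coneIntegral hU (hd a) (hd b) (hd c) (hd' a) (hd' b) (hd' c)
        (fun s hs => (hpoly s hs).1 a) (fun s hs => (hpoly s hs).1 b) (fun s hs => (hpoly s hs).1 c)
        ht ((hpoly t ht).lor_pos habc).ne' (hN a b c)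
      simp only [hf, hrot a b c, ← hrot c a b]
      exact this
    · exact hasDerivAt_const _ _
  refine (hsum.div_const 3).congr_deriv ?_
  have e1 := S.sum_rotate f
  have e2 := S.sum_rotate fun a b c => f b c a
  simp only [ite_add_zero, Finset.sum_add_distrib]
  rw [e2, e1, hzero]
  norm_num

/-- The oriented volume of a smooth family of polyhedral surfaces with constant dihedral angles is
constant. -/
theorem orientedVolume_eq {I : Set ℝ} (hI : I.OrdConnected) {p : ℝ → V → E3}
    (hpoly : ∀ t ∈ I, S.IsPolyhedral (p t)) (hsmooth : ∀ v, ContDiffOn ℝ 1 (fun t => p t v) I)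
    (hangle : ∀ a b c d, S.tri a b c → S.tri b a d → ∀ s ∈ I, ∀ t ∈ I,
      dihedralAngle (p s a) (p s b) (p s c) (p s d) = dihedralAngle (p t a) (p t b) (p t c) (p t d))
    {s t : ℝ} (hs : s ∈ I) (ht : t ∈ I) : S.orientedVolume (p s) = S.orientedVolume (p t) := by
  wlog hst : s < t generalizing s t
  · rcases eq_or_lt_of_le (not_lt.1 hst) with h | h
    · rw [h]
    · exact (this ht hs h).symm
  classical
  have hsub : Icc s t ⊆ I := hI.out hs ht
  have hcont : ContinuousOn (fun r => S.orientedVolume (p r)) I := by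
    have : ContinuousOn (fun r => (∑ a, ∑ b, ∑ c, if S.tri a b c then
        coneIntegral (p r a) (p r b) (p r c) else 0) / 3) I := by
      refine ContinuousOn.div_const (continuousOn_finsetSum _ fun a _ => continuousOn_finsetSum _
        fun b _ => continuousOn_finsetSum _ fun c _ => ?_) 3
      split_ifs
      · exact continuousOn_coneIntegral (hsmooth a).continuousOn (hsmooth b).continuousOn
          (hsmooth c).continuousOn (fun r hr => (hpoly r hr).1 a) (fun r hr => (hpoly r hr).1 b)
          fun r hr => (hpoly r hr).1 c
      · exact continuousOn_const
    refine this.congr fun r hr => ?_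
    rw [orientedVolume]
    simp only [coneVolume_eq_coneIntegral ((hpoly r hr).1 _) ((hpoly r hr).1 _) ((hpoly r hr).1 _)]
  have hsub' : Ioo s t ⊆ I := Ioo_subset_Icc_self.trans hsub
  obtain ⟨c, hc, hslope⟩ := exists_hasDerivAt_eq_slope (fun r => S.orientedVolume (p r)) (fun _ => 0)
    hst (hcont.mono hsub) fun r hr => S.hasDerivAt_orientedVolume isOpen_Ioo
      (fun t ht => hpoly t (hsub' ht)) (fun v => (hsmooth v).mono hsub')
      (fun a b c d h1 h2 s hs t ht => hangle a b c d h1 h2 s (hsub' hs) t (hsub' ht)) hr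
  have := sub_pos.2 hst
  field_simp at hslope
  linarith

end OrientedClosedSurface

namespace Klein

open Set Filter Topology

/-! ### Signed indicator functions of tetrahedra -/

/-- The orientation determinant of `a, b, c` as seen from `x`. -/
def sdet (x a b c : E3) : ℝ := det3 (a - x) (b - x) (c - x)

/-- The indicator function of the tetrahedron `oabc`, with the sign of its orientation. -/
def signedInd (o a b c x : E3) : ℝ :=
  SignType.sign (sdet o a b c) * (convexHull ℝ {o, a, b, c}).indicator 1 x

theorem sdet_eq_lor (x a b c : E3) : sdet x a b c = lor (normal x a b) (lift c) :=
  (lor_normal_eq_det3 _ _ _ _).symm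

theorem sdet_eq_neg_lor (x a b c : E3) : sdet x a b c = -lor (normal a b c) (lift x) :=
  det3_sub_eq_lor _ _ _ _

theorem sdet_rotate (x a b c : E3) : sdet x b c a = sdet x a b c := by
  simp only [sdet, det3_eq]; ring

theorem sdet_swap' (x a b c : E3) : sdet x a c b = -sdet x a b c := by
  simp only [sdet, det3_eq]; ring

theorem sdet_sum (o a b c x : E3) :
    sdet o a b c = sdet x a b c - sdet x o b c - sdet x o c a - sdet x o a b := by
  simp only [sdet, det3_eq, PiLp.sub_apply]; ring

theorem sdet_cramer (o a b c x : E3) : sdet x a b c • (o - x) =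
    sdet x o b c • (a - x) + sdet x o c a • (b - x) + sdet x o a b • (c - x) := by
  ext i
  fin_cases i <;> simp [sdet, det3_eq] <;> ring

theorem mem_convexHull_four {o a b c x : E3} : x ∈ convexHull ℝ {o, a, b, c} ↔
    ∃ w₀ w₁ w₂ w₃ : ℝ, 0 ≤ w₀ ∧ 0 ≤ w₁ ∧ 0 ≤ w₂ ∧ 0 ≤ w₃ ∧ w₀ + w₁ + w₂ + w₃ = 1 ∧
      w₀ • o + w₁ • a + w₂ • b + w₃ • c = x := by
  constructor
  · rw [mem_convexHull_tetrahedron]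
    rintro ⟨r, hr, z, hz, rfl⟩
    have h1 := hz.1.1
    have h2 := hz.1.2
    have h3 := hz.2.1
    have h4 := hz.2.2
    simp only [Prod.fst_zero, Prod.snd_zero, Prod.fst_one, Prod.snd_one] at h1 h2 h3 h4
    have h5 := hr.1
    have h6 := hr.2
    refine ⟨1 - r, r * (1 - z.1), r * (z.1 * (1 - z.2)), r * (z.1 * z.2), by linarith,
      mul_nonneg h5 (by linarith), mul_nonneg h5 (mul_nonneg h1 (by linarith)), by positivity,
      by ring, ?_⟩
    simp only [triMap, seg]
    module
  · rintro ⟨w₀, w₁, w₂, w₃, h0, h1, h2, h3, hs, rfl⟩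
    have hc := convex_convexHull ℝ ({o, a, b, c} : Set E3)
    have hm : ∀ i : Fin 4, ![o, a, b, c] i ∈ convexHull ℝ ({o, a, b, c} : Set E3) := by
      intro i
      apply subset_convexHull
      fin_cases i <;> simp
    have := hc.sum_mem (t := Finset.univ) (w := ![w₀, w₁, w₂, w₃]) (z := ![o, a, b, c])
      (by intro i _; fin_cases i <;> assumption) (by simpa [Fin.sum_univ_four] using hs)
      (fun i _ => hm i)
    simpa [Fin.sum_univ_four] using this

theorem mem_convexHull_three {a b c x : E3} : x ∈ convexHull ℝ {a, b, c} ↔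
    ∃ w₁ w₂ w₃ : ℝ, 0 ≤ w₁ ∧ 0 ≤ w₂ ∧ 0 ≤ w₃ ∧ w₁ + w₂ + w₃ = 1 ∧
      w₁ • a + w₂ • b + w₃ • c = x := by
  have : ({a, b, c} : Set E3) = {a, a, b, c} := by simp
  rw [this, mem_convexHull_four]
  constructor
  · rintro ⟨w₀, w₁, w₂, w₃, h0, h1, h2, h3, hs, rfl⟩
    exact ⟨w₀ + w₁, w₂, w₃, by positivity, h2, h3, hs, by module⟩
  · rintro ⟨w₁, w₂, w₃, h1, h2, h3, hs, rfl⟩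
    exact ⟨0, w₁, w₂, w₃, le_rfl, h1, h2, h3, by linarith, by module⟩

theorem sdet_combination {o a b c : E3} {w₀ w₁ w₂ w₃ : ℝ} (hs : w₀ + w₁ + w₂ + w₃ = 1) :
    sdet (w₀ • o + w₁ • a + w₂ • b + w₃ • c) a b c = w₀ * sdet o a b c ∧
    sdet (w₀ • o + w₁ • a + w₂ • b + w₃ • c) o b c = -w₁ * sdet o a b c ∧
    sdet (w₀ • o + w₁ • a + w₂ • b + w₃ • c) o c a = -w₂ * sdet o a b c ∧
    sdet (w₀ • o + w₁ • a + w₂ • b + w₃ • c) o a b = -w₃ * sdet o a b c := by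
  obtain rfl : w₀ = 1 - w₁ - w₂ - w₃ := by linarith
  refine ⟨?_, ?_, ?_, ?_⟩ <;>
  · simp only [sdet, det3_eq, PiLp.sub_apply, PiLp.add_apply, PiLp.smul_apply, smul_eq_mul]
    ring

/-- The sign of a tetrahedron at a point, read off from four orientations seen from the point. -/
def signs (s s₁ s₂ s₃ : Bool) : ℤ :=
  if s && !s₁ && !s₂ && !s₃ then 1 else if !s && s₁ && s₂ && s₃ then -1 else 0

theorem signedInd_eq_signs {o a b c x : E3} (h : sdet x a b c ≠ 0) (h₁ : sdet x o b c ≠ 0)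
    (h₂ : sdet x o c a ≠ 0) (h₃ : sdet x o a b ≠ 0) : signedInd o a b c x =
      signs (0 < sdet x a b c) (0 < sdet x o b c) (0 < sdet x o c a) (0 < sdet x o a b) := by
  have hsum := sdet_sum o a b c x
  have key : x ∈ convexHull ℝ {o, a, b, c} ↔
      (0 < sdet x a b c ∧ sdet x o b c < 0 ∧ sdet x o c a < 0 ∧ sdet x o a b < 0) ∨
      (sdet x a b c < 0 ∧ 0 < sdet x o b c ∧ 0 < sdet x o c a ∧ 0 < sdet x o a b) := by
    constructor
    · intro hx
      obtain ⟨w₀, w₁, w₂, w₃, p0, p1, p2, p3, hs, rfl⟩ := mem_convexHull_four.1 hx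
      obtain ⟨e0, e1, e2, e3⟩ := sdet_combination (o := o) (a := a) (b := b) (c := c) hs
      rw [e0] at h ⊢
      rw [e1] at h₁ ⊢
      rw [e2] at h₂ ⊢
      rw [e3] at h₃ ⊢
      have q0 := lt_of_le_of_ne p0 (left_ne_zero_of_mul h).symm
      have q1 := lt_of_le_of_ne p1 (neg_ne_zero.1 (left_ne_zero_of_mul h₁)).symm
      have q2 := lt_of_le_of_ne p2 (neg_ne_zero.1 (left_ne_zero_of_mul h₂)).symm
      have q3 := lt_of_le_of_ne p3 (neg_ne_zero.1 (left_ne_zero_of_mul h₃)).symm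
      rcases (right_ne_zero_of_mul h).lt_or_gt with k | k
      · right; refine ⟨?_, ?_, ?_, ?_⟩ <;> nlinarith
      · left; refine ⟨?_, ?_, ?_, ?_⟩ <;> nlinarith
    · intro hsign
      have hK : sdet o a b c ≠ 0 := by
        rw [hsum]
        rcases hsign with ⟨k, k1, k2, k3⟩ | ⟨k, k1, k2, k3⟩
        · exact (by linarith : (0 : ℝ) < _).ne'
        · exact (by linarith : _ < (0 : ℝ)).ne
      refine mem_convexHull_four.2 ⟨sdet x a b c / sdet o a b c, -sdet x o b c / sdet o a b c,
        -sdet x o c a / sdet o a b c, -sdet x o a b / sdet o a b c, ?_, ?_, ?_, ?_, ?_, ?_⟩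
      iterate 4
        rcases hsign with ⟨k, k1, k2, k3⟩ | ⟨k, k1, k2, k3⟩
        · exact div_nonneg (by linarith) (by linarith)
        · exact div_nonneg_of_nonpos (by linarith) (by linarith)
      · field_simp; linarith
      · refine smul_right_injective _ hK ?_
        simp only [smul_add, smul_smul, mul_div_cancel₀ _ hK]
        have hc := sdet_cramer o a b c x
        rw [hsum]
        ext i
        have hi := congrArg (fun v : E3 => v i) hc
        simp only [PiLp.add_apply, PiLp.smul_apply, PiLp.sub_apply, smul_eq_mul] at hi ⊢
        linear_combination hi
  rw [signedInd]
  by_cases hx : x ∈ convexHull ℝ {o, a, b, c}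
  · rw [indicator_of_mem hx]
    rcases key.1 hx with ⟨k, k1, k2, k3⟩ | ⟨k, k1, k2, k3⟩
    · have : 0 < sdet o a b c := by linarith
      simp [signs, sign_pos this, k, k1.le, k2.le, k3.le]
    · have : sdet o a b c < 0 := by linarith
      simp [signs, sign_neg this, k.le, k1, k2, k3]
  · rw [indicator_of_notMem hx]
    rw [key, not_or] at hx
    rcases h.lt_or_gt with k | k <;> rcases h₁.lt_or_gt with k1 | k1 <;>
    rcases h₂.lt_or_gt with k2 | k2 <;> rcases h₃.lt_or_gt with k3 | k3 <;>
    simp [signs, k, k1, k2, k3, not_lt.2 k.le, not_lt.2 k1.le, not_lt.2 k2.le, not_lt.2 k3.le] at hx ⊢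

/-- Three signs which are neither all positive nor all negative. -/
def mixed (p q r : Bool) : Bool := !(p && q && r) && (p || q || r)

/-- The signed indicator functions of the five tetrahedra spanned by five points satisfy the cocycle
identity: the orientations of the triples seen from a generic point only have to satisfy the
Grassmann-Plücker relations. -/
theorem signs_cocycle : ∀ abc oqa oqb oqc oab obc oca qab qbc qca : Bool,
    mixed (oqa == obc) (oqb == oca) (oqc == oab) →
    mixed (oqa == qbc) (oqb == qca) (oqc == qab) →
    mixed (oqa == abc) (oab == qca) (oca != qab) →
    mixed (oqb == abc) (obc == qab) (oab != qbc) →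
    mixed (oqc == abc) (oca == qbc) (obc != qca) →
    signs abc obc oca oab - signs abc qbc qca qab =
      signs qab oab (!oqb) oqa + signs qbc obc (!oqc) oqb + signs qca oca (!oqa) oqc := by
  decide +kernel

theorem mixed_of_sum_eq_zero {p q r : ℝ} (hp : p ≠ 0) (hq : q ≠ 0) (h : p + q + r = 0) :
    mixed (0 < p) (0 < q) (0 < r) := by
  rcases hp.lt_or_gt with h1 | h1 <;> rcases hq.lt_or_gt with h2 | h2 <;>
    rcases lt_trichotomy r 0 with h3 | h3 | h3 <;>
    first
    | (exfalso; linarith)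
    | simp [mixed, h1, h2, h3, not_lt.2 h1.le, not_lt.2 h2.le, not_lt.2 h3.le]

theorem decide_mul_pos {p q : ℝ} (hp : p ≠ 0) (hq : q ≠ 0) :
    decide (0 < p * q) = (decide (0 < p) == decide (0 < q)) := by
  rcases hp.lt_or_gt with h1 | h1 <;> rcases hq.lt_or_gt with h2 | h2
  · simp [mul_pos_of_neg_of_neg h1 h2, not_lt.2 h1.le, not_lt.2 h2.le]
  · simp [not_lt.2 (mul_neg_of_neg_of_pos h1 h2).le, not_lt.2 h1.le, h2]
  · simp [not_lt.2 (mul_neg_of_pos_of_neg h1 h2).le, not_lt.2 h2.le, h1]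
  · simp [mul_pos h1 h2, h1, h2]

theorem decide_neg_pos {p : ℝ} (hp : p ≠ 0) : decide (0 < -p) = !decide (0 < p) := by
  rcases hp.lt_or_gt with h1 | h1
  · simp [h1, not_lt.2 h1.le]
  · simp [h1, not_lt.2 h1.le]

/-- Moving the apex of a tetrahedron from `o` to `q` changes the signed indicator function by terms
belonging to the edges of the base. -/
theorem signedInd_sub_signedInd {o q a b c x : E3} (abc : sdet x a b c ≠ 0)
    (oqa : sdet x o q a ≠ 0) (oqb : sdet x o q b ≠ 0) (oqc : sdet x o q c ≠ 0)
    (oab : sdet x o a b ≠ 0) (obc : sdet x o b c ≠ 0) (oca : sdet x o c a ≠ 0)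
    (qab : sdet x q a b ≠ 0) (qbc : sdet x q b c ≠ 0) (qca : sdet x q c a ≠ 0) :
    signedInd o a b c x - signedInd q a b c x =
      signedInd o q a b x + signedInd o q b c x + signedInd o q c a x := by
  have sw : ∀ y, sdet x o y q = -sdet x o q y := fun y => sdet_swap' _ _ _ _
  have nz : ∀ {y}, sdet x o q y ≠ 0 → sdet x o y q ≠ 0 := fun {y} h => by rw [sw]; simpa using h
  have relation : ∀ {p q r s t u : ℝ}, p ≠ 0 → q ≠ 0 → r ≠ 0 → s ≠ 0 → t ≠ 0 → u ≠ 0 →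
      p * q + r * s + t * u = 0 →
      mixed (decide (0 < p) == decide (0 < q)) (decide (0 < r) == decide (0 < s))
        (decide (0 < t) == decide (0 < u)) := by
    intro p q r s t u hp hq hr hs ht hu h
    rw [← decide_mul_pos hp hq, ← decide_mul_pos hr hs, ← decide_mul_pos ht hu]
    exact mixed_of_sum_eq_zero (mul_ne_zero hp hq) (mul_ne_zero hr hs) h
  have relation' : ∀ {p q r s t u : ℝ}, p ≠ 0 → q ≠ 0 → r ≠ 0 → s ≠ 0 → t ≠ 0 → u ≠ 0 →
      p * q + r * s - t * u = 0 →
      mixed (decide (0 < p) == decide (0 < q)) (decide (0 < r) == decide (0 < s))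
        (decide (0 < t) != decide (0 < u)) := by
    intro p q r s t u hp hq hr hs ht hu h
    have := relation hp hq hr hs (neg_ne_zero.2 ht) hu (by linarith)
    rw [decide_neg_pos ht] at this
    generalize decide (0 < t) = t', decide (0 < u) = u' at this ⊢
    cases t' <;> cases u' <;> exact this
  have key := signs_cocycle (0 < sdet x a b c) (0 < sdet x o q a) (0 < sdet x o q b)
    (0 < sdet x o q c) (0 < sdet x o a b) (0 < sdet x o b c) (0 < sdet x o c a)
    (0 < sdet x q a b) (0 < sdet x q b c) (0 < sdet x q c a)
    (relation oqa obc oqb oca oqc oab (by simp only [sdet, det3_eq]; ring))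
    (relation oqa qbc oqb qca oqc qab (by simp only [sdet, det3_eq]; ring))
    (relation' oqa abc oab qca oca qab (by simp only [sdet, det3_eq]; ring))
    (relation' oqb abc obc qab oab qbc (by simp only [sdet, det3_eq]; ring))
    (relation' oqc abc oca qbc obc qca (by simp only [sdet, det3_eq]; ring))
  rw [signedInd_eq_signs abc obc oca oab, signedInd_eq_signs abc qbc qca qab,
    signedInd_eq_signs qab oab (nz oqb) oqa, signedInd_eq_signs qbc obc (nz oqc) oqb,
    signedInd_eq_signs qca oca (nz oqa) oqc]
  simp only [sw, decide_neg_pos oqa, decide_neg_pos oqb, decide_neg_pos oqc]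
  exact_mod_cast key

theorem signedInd_swap (o q a b x : E3) : signedInd o q b a x = -signedInd o q a b x := by
  have : ({o, q, b, a} : Set E3) = {o, q, a, b} := by
    rw [Set.pair_comm b a]
  rw [signedInd, signedInd, this, sdet_swap', Left.sign_neg]
  push_cast; ring

/-! ### Crossing a triangle -/

theorem sdet_line (q a b x x' : E3) (h : q = 2 • x - x') (t : ℝ) :
    sdet (seg x x' t) q a b = (1 + t) * sdet x q a b := by
  subst h
  simp only [sdet, det3_eq, PiLp.sub_apply, seg_apply, two_smul, PiLp.add_apply]
  ring

theorem sdet_seg (a b c x x' : E3) (t : ℝ) :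
    sdet (seg x x' t) a b c = (1 - t) * sdet x a b c + t * sdet x' a b c := by
  rw [sdet_eq_neg_lor, sdet_eq_neg_lor, sdet_eq_neg_lor, lor_lift_seg]; ring

theorem seg_mem_segment (x x' : E3) {t : ℝ} (ht : t ∈ Icc (0 : ℝ) 1) : seg x x' t ∈ segment ℝ x x' :=
  mem_segment_iff_seg.2 ⟨t, ht, rfl⟩

theorem seg_self_one (x x' : E3) : seg x x' 1 = x' := by simp [seg]

theorem sdet_line_end {q a b x x' : E3} (h : q = 2 • x - x') :
    sdet x' q a b = 2 * sdet x q a b := by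
  have := sdet_line q a b x x' h 1
  rw [seg_self_one] at this
  rw [this]; norm_num

/-- The point of the segment from `x` to `x'` on a plane which separates `x` from `x'`. -/
theorem exists_seg_zero {d d' : ℝ} (h : d * d' < 0) :
    ∃ t ∈ Icc (0 : ℝ) 1, (1 - t) * d + t * d' = 0 := by
  have hne : d - d' ≠ 0 := by
    intro h0
    have : d = d' := by linarith
    subst this
    nlinarith [mul_self_nonneg d]
  have hsq : 0 < (d - d') ^ 2 := by positivity
  refine ⟨d / (d - d'), ⟨?_, ?_⟩, by field_simp; ring⟩
  · rw [show d / (d - d') = (d * (d - d')) / (d - d') ^ 2 by field_simp]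
    apply div_nonneg _ hsq.le
    nlinarith [mul_self_nonneg d]
  · rw [show d / (d - d') = (d * (d - d')) / (d - d') ^ 2 by field_simp, div_le_one hsq]
    nlinarith [mul_self_nonneg d']

/-- A point of the plane of `a, b, c` lies in the triangle if the three orientations which are
proportional to its barycentric coordinates have the same sign. -/
theorem mem_convexHull_of_combination {a b c z : E3} {d₁ d₂ d₃ : ℝ}
    (hs : (0 < d₁ ∧ 0 < d₂ ∧ 0 < d₃) ∨ (d₁ < 0 ∧ d₂ < 0 ∧ d₃ < 0))
    (h : d₁ • (a - z) + d₂ • (b - z) + d₃ • (c - z) = 0) : z ∈ convexHull ℝ {a, b, c} := by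
  have main : ∀ {d₁ d₂ d₃ : ℝ}, 0 < d₁ → 0 < d₂ → 0 < d₃ →
      d₁ • (a - z) + d₂ • (b - z) + d₃ • (c - z) = 0 → z ∈ convexHull ℝ {a, b, c} := by
    intro d₁ d₂ d₃ k1 k2 k3 h
    have hs : 0 < d₁ + d₂ + d₃ := add_pos (add_pos k1 k2) k3
    refine mem_convexHull_three.2 ⟨d₁ / (d₁ + d₂ + d₃), d₂ / (d₁ + d₂ + d₃), d₃ / (d₁ + d₂ + d₃),
      (div_pos k1 hs).le, (div_pos k2 hs).le, (div_pos k3 hs).le, ?_, ?_⟩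
    · rw [← add_div, ← add_div, div_self hs.ne']
    · refine smul_right_injective _ hs.ne' ?_
      simp only [smul_add, smul_smul, mul_div_cancel₀ _ hs.ne']
      rw [← sub_eq_zero, ← h]
      module
  rcases hs with ⟨k1, k2, k3⟩ | ⟨k1, k2, k3⟩
  · exact main k1 k2 k3 h
  · refine main (neg_pos.2 k1) (neg_pos.2 k2) (neg_pos.2 k3) ?_
    rw [← neg_eq_zero, ← h]
    module

/-- If the apex `q` lies on the line through `x` and `x'`, beyond `x`, then a tetrahedron with this
apex distinguishes `x` from `x'` only if its base meets the segment from `x` to `x'`. -/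
theorem signedInd_eq_of_segment {q a b c x x' : E3} (hq : q = 2 • x - x')
    (h : sdet x a b c ≠ 0) (h' : sdet x' a b c ≠ 0) (h₁ : sdet x q b c ≠ 0)
    (h₂ : sdet x q c a ≠ 0) (h₃ : sdet x q a b ≠ 0)
    (hseg : Disjoint (segment ℝ x x') (convexHull ℝ {a, b, c})) :
    signedInd q a b c x = signedInd q a b c x' := by
  have e₁ := sdet_line_end (a := b) (b := c) hq
  have e₂ := sdet_line_end (a := c) (b := a) hq
  have e₃ := sdet_line_end (a := a) (b := b) hq
  have p2 : ∀ r : ℝ, decide (0 < 2 * r) = decide (0 < r) := fun r => by simp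
  rw [signedInd_eq_signs h h₁ h₂ h₃, signedInd_eq_signs h' (by simpa [e₁] using h₁)
    (by simpa [e₂] using h₂) (by simpa [e₃] using h₃), e₁, e₂, e₃, p2, p2, p2]
  by_cases hD : sdet x a b c * sdet x' a b c < 0
  · -- the three signs cannot be equal: otherwise the segment would meet the triangle
    have hmix : ¬ ((0 < sdet x q b c ∧ 0 < sdet x q c a ∧ 0 < sdet x q a b) ∨
        (sdet x q b c < 0 ∧ sdet x q c a < 0 ∧ sdet x q a b < 0)) := by
      intro hs
      obtain ⟨t, ht, htz⟩ := exists_seg_zero hD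
      rw [← sdet_seg] at htz
      refine disjoint_left.1 hseg (seg_mem_segment x x' ht) ?_
      have hc := sdet_cramer q a b c (seg x x' t)
      rw [htz, zero_smul, sdet_line _ _ _ _ _ hq, sdet_line _ _ _ _ _ hq,
        sdet_line _ _ _ _ _ hq] at hc
      have ht1 : 0 < 1 + t := by linarith [ht.1]
      refine mem_convexHull_of_combination ?_ hc.symm
      rcases hs with ⟨k1, k2, k3⟩ | ⟨k1, k2, k3⟩
      · exact Or.inl ⟨mul_pos ht1 k1, mul_pos ht1 k2, mul_pos ht1 k3⟩
      · exact Or.inr ⟨mul_neg_of_pos_of_neg ht1 k1, mul_neg_of_pos_of_neg ht1 k2,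
          mul_neg_of_pos_of_neg ht1 k3⟩
    rcases h₁.lt_or_gt with k1 | k1 <;> rcases h₂.lt_or_gt with k2 | k2 <;>
    rcases h₃.lt_or_gt with k3 | k3 <;>
    simp [k1, k2, k3] at hmix <;> simp [signs, k1, k2, k3, not_lt.2 k1.le, not_lt.2 k2.le, not_lt.2 k3.le]
  · have : decide (0 < sdet x a b c) = decide (0 < sdet x' a b c) := by
      rcases h.lt_or_gt with k | k <;> rcases h'.lt_or_gt with k' | k'
      · simp [not_lt.2 k.le, not_lt.2 k'.le]
      · exact absurd (mul_neg_of_neg_of_pos k k') hD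
      · exact absurd (mul_neg_of_pos_of_neg k k') hD
      · simp [k, k']
    rw [this]

/-- The jump of the signed indicator function across the base. -/
theorem signedInd_sub_of_segment {q a b c x x' : E3} (hq : q = 2 • x - x')
    (h : 0 < sdet x a b c) (h' : sdet x' a b c < 0) (h₁ : sdet x q b c ≠ 0)
    (h₂ : sdet x q c a ≠ 0) (h₃ : sdet x q a b ≠ 0)
    (hseg : ∀ z ∈ segment ℝ x x', sdet z a b c = 0 → z ∈ convexHull ℝ {a, b, c}) :
    signedInd q a b c x - signedInd q a b c x' = 1 := by
  have e₁ := sdet_line_end (a := b) (b := c) hq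
  have e₂ := sdet_line_end (a := c) (b := a) hq
  have e₃ := sdet_line_end (a := a) (b := b) hq
  have p2 : ∀ r : ℝ, decide (0 < 2 * r) = decide (0 < r) := fun r => by simp
  obtain ⟨t, ht, htz⟩ := exists_seg_zero (mul_neg_of_pos_of_neg h h')
  rw [← sdet_seg] at htz
  obtain ⟨w₁, w₂, w₃, g1, g2, g3, hw, hz⟩ :=
    mem_convexHull_three.1 (hseg _ (seg_mem_segment x x' ht) htz)
  obtain ⟨-, f1, f2, f3⟩ := sdet_combination (o := q) (a := a) (b := b) (c := c)
    (show 0 + w₁ + w₂ + w₃ = 1 by linarith)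
  rw [zero_smul, zero_add, hz, sdet_line _ _ _ _ _ hq] at f1 f2 f3
  have hsum := sdet_sum q a b c x
  have hsum' := sdet_sum q a b c x'
  rw [e₁, e₂, e₃] at hsum'
  have hK : 0 < sdet q a b c := by linarith
  have t0 : 0 < 1 + t := by linarith [ht.1]
  have neg : ∀ {d w : ℝ}, d ≠ 0 → 0 ≤ w → (1 + t) * d = -w * sdet q a b c → d < 0 := by
    intro d w hd hw he
    refine lt_of_le_of_ne ?_ hd
    by_contra hcon
    have := mul_pos t0 (not_le.1 hcon)
    nlinarith [mul_nonneg hw hK.le]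
  have k1 := neg h₁ g1 f1
  have k2 := neg h₂ g2 f2
  have k3 := neg h₃ g3 f3
  rw [signedInd_eq_signs h.ne' h₁ h₂ h₃, signedInd_eq_signs h'.ne (by simpa [e₁] using h₁)
    (by simpa [e₂] using h₂) (by simpa [e₃] using h₃), e₁, e₂, e₃, p2, p2, p2]
  simp [signs, h, k2.le, k3.le, not_lt.2 h'.le, not_lt.2 k1.le]

theorem ae_lor_ne_zero {X : Fin 4 → ℝ} (hX : X ≠ 0) : ∀ᵐ x : E3, lor X (lift x) ≠ 0 := by
  have h := volume_plane_eq_zero hX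
  rw [ae_iff]
  simpa using h

theorem exists_mem_of_ae {P : E3 → Prop} (h : ∀ᵐ x, P x) {U : Set E3} (hU : IsOpen U)
    (hne : U.Nonempty) : ∃ x ∈ U, P x :=
  (Measure.dense_of_ae h).exists_mem_open hU hne |>.imp fun _ h => ⟨h.2, h.1⟩

end Klein

namespace OrientedClosedSurface

open Klein Set Filter Topology

variable {V : Type*} (S : OrientedClosedSurface V)

/-! ### The winding number -/

/-- The point `x` is in general position with respect to the apex `o` and the surface. -/
def IsGeneric (p : V → E3) (o x : E3) : Prop :=
  ∀ a b c, S.tri a b c → sdet x (p a) (p b) (p c) ≠ 0 ∧ sdet x o (p a) (p b) ≠ 0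

/-- The point `x'` is in general position with respect to the edges, seen from `x`. -/
def IsGenericPair (p : V → E3) (x x' : E3) : Prop :=
  ∀ a b c, S.tri a b c → sdet x x' (p a) (p b) ≠ 0

variable {S}

theorem IsGeneric.all {p : V → E3} {o x : E3} (h : S.IsGeneric p o x) {a b c : V}
    (habc : S.tri a b c) : sdet x (p a) (p b) (p c) ≠ 0 ∧ sdet x o (p b) (p c) ≠ 0 ∧
      sdet x o (p c) (p a) ≠ 0 ∧ sdet x o (p a) (p b) ≠ 0 :=
  ⟨(h a b c habc).1, (h b c a (S.tri_rotate habc)).2,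
    (h c a b (S.tri_rotate (S.tri_rotate habc))).2, (h a b c habc).2⟩

theorem IsGeneric.normal_ne_zero {p : V → E3} {o x : E3} (h : S.IsGeneric p o x) {a b c : V}
    (habc : S.tri a b c) : normal x (p a) (p b) ≠ 0 ∧ normal x o (p a) ≠ 0 := by
  constructor
  · intro h0
    apply (h a b c habc).1
    rw [sdet_eq_lor, h0]; simp [lor]
  · intro h0
    apply (h a b c habc).2
    rw [sdet_eq_lor, h0]; simp [lor]

theorem IsGenericPair.isGeneric {p : V → E3} {o x x' : E3} (h : S.IsGenericPair p x x')
    (hx : S.IsGeneric p o x) : S.IsGeneric p (2 • x - x') x := by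
  intro a b c habc
  refine ⟨(hx a b c habc).1, ?_⟩
  have : sdet x (2 • x - x') (p a) (p b) = -sdet x x' (p a) (p b) := by
    simp only [sdet, det3_eq, PiLp.sub_apply, two_smul, PiLp.add_apply]; ring
  rw [this]
  exact neg_ne_zero.2 (h a b c habc)

theorem IsGenericPair.isGeneric' {p : V → E3} {o x x' : E3} (h : S.IsGenericPair p x x')
    (hx : S.IsGeneric p o x) (hx' : S.IsGeneric p o x') : S.IsGeneric p (2 • x - x') x' := by
  intro a b c habc
  refine ⟨(hx' a b c habc).1, ?_⟩
  rw [sdet_line_end rfl]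
  exact mul_ne_zero two_ne_zero (h.isGeneric hx a b c habc).2

variable [Fintype V]

theorem ae_isGenericPair {p : V → E3} {o x : E3} (h : S.IsGeneric p o x) :
    ∀ᵐ x', S.IsGenericPair p x x' := by
  simp only [IsGenericPair, ae_all_iff]
  intro a b c habc
  filter_upwards [ae_lor_ne_zero (h.normal_ne_zero habc).1] with x' hx'
  rwa [← sdet_rotate, ← sdet_eq_lor] at *

theorem ae_isGeneric {p : V → E3} (hp : S.IsPolyhedral p) {o : E3}
    (ho : ∀ a b c, S.tri a b c → normal o (p a) (p b) ≠ 0) : ∀ᵐ x, S.IsGeneric p o x := by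
  simp only [IsGeneric, ae_all_iff]
  intro a b c habc
  have h1 : normal (p a) (p b) (p c) ≠ 0 := by
    intro h0
    have := hp.lor_pos habc
    rw [h0] at this
    simp [lor] at this
  filter_upwards [ae_lor_ne_zero h1, ae_lor_ne_zero (ho a b c habc)] with x hx hx'
  rw [sdet_eq_neg_lor, sdet_eq_neg_lor]
  exact ⟨neg_ne_zero.2 hx, neg_ne_zero.2 hx'⟩

variable (S) in
open Classical in
/-- The winding number of the surface around `x`, computed by counting the tetrahedra with the apex
`o` over the triangles which contain `x`. (Each triangle is counted three times.) -/
def winding (p : V → E3) (o x : E3) : ℝ :=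
  (∑ a, ∑ b, ∑ c, if S.tri a b c then signedInd o (p a) (p b) (p c) x else 0) / 3

/-- The winding number does not change when the apex is moved from `o` to `q`, if no vertex lies on a
plane through `o`, `q` and `x`: the terms by which the signed indicator functions change belong to
the edges and cancel. -/
theorem winding_apex_aux {p : V → E3} {o q x : E3} (ho : S.IsGeneric p o x)
    (hq : S.IsGeneric p q x) (hoq : ∀ v, sdet x o q (p v) ≠ 0) :
    S.winding p o x = S.winding p q x := by
  classical
  rw [← sub_eq_zero, winding, winding, ← sub_div, ← Finset.sum_sub_distrib]
  simp only [← Finset.sum_sub_distrib]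
  set f : V → V → V → ℝ := fun a b _ => signedInd o q (p a) (p b) x with hf
  have e : ∀ a b c, ((if S.tri a b c then signedInd o (p a) (p b) (p c) x else 0) -
      if S.tri a b c then signedInd q (p a) (p b) (p c) x else 0) =
      if S.tri a b c then (f a b c + f b c a + f c a b) else 0 := by
    intro a b c
    split_ifs with habc
    · obtain ⟨h, h1, h2, h3⟩ := ho.all habc
      obtain ⟨-, k1, k2, k3⟩ := hq.all habc
      exact signedInd_sub_signedInd h (hoq a) (hoq b) (hoq c) h3 h1 h2 k3 k1 k2
    · exact sub_zero _
  have e1 := S.sum_rotate f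
  have e2 := S.sum_rotate fun a b c => f b c a
  have hzero := S.sum_eq_zero_of_edges f fun a b c d _ _ => by
    simp only [hf]; rw [signedInd_swap o q (p a) (p b)]; ring
  simp only [e, ite_add_zero, Finset.sum_add_distrib]
  rw [e2, e1, hzero]
  norm_num

/-- The winding number does not depend on the apex. -/
theorem winding_apex {p : V → E3} {o q x : E3} (ho : S.IsGeneric p o x)
    (hq : S.IsGeneric p q x) : S.winding p o x = S.winding p q x := by
  have h1 : ∀ {o}, S.IsGeneric p o x → ∀ᵐ r : E3, ∀ v, sdet x o r (p v) ≠ 0 := by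
    intro o ho
    rw [ae_all_iff]
    intro v
    obtain ⟨b, c, hv⟩ := S.vertex_mem v
    filter_upwards [ae_lor_ne_zero (ho.normal_ne_zero hv).2] with r hr
    rw [sdet_swap', sdet_eq_lor]
    exact neg_ne_zero.2 hr
  have h2 : ∀ᵐ r : E3, S.IsGeneric p r x := by
    simp only [IsGeneric, ae_all_iff]
    intro a b c habc
    filter_upwards [ae_lor_ne_zero (ho.normal_ne_zero habc).1] with r hr
    rw [← sdet_eq_lor, sdet_rotate] at hr
    exact ⟨(ho a b c habc).1, hr⟩
  -- pass through an apex in general position with respect to both `o` and `q`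
  obtain ⟨r, -, ⟨k1, k2⟩, k3⟩ := exists_mem_of_ae (((h1 ho).and (h1 hq)).and h2) isOpen_univ
    univ_nonempty
  rw [winding_apex_aux ho k3 k1, winding_apex_aux hq k3 k2]

/-- The winding number does not change along a segment which avoids the surface. -/
theorem winding_eq_of_segment {p : V → E3} {o x x' : E3} (hx : S.IsGeneric p o x)
    (hx' : S.IsGeneric p o x') (h : S.IsGenericPair p x x')
    (hseg : Disjoint (segment ℝ x x') (S.carrier p)) :
    S.winding p o x = S.winding p o x' := by
  have g := h.isGeneric hx
  have g' := h.isGeneric' hx hx'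
  rw [winding_apex hx g, winding_apex hx' g', winding, winding]
  congr 1
  refine Finset.sum_congr rfl fun a _ => Finset.sum_congr rfl fun b _ => Finset.sum_congr rfl
    fun c _ => ?_
  split_ifs with habc
  · obtain ⟨k, k1, k2, k3⟩ := g.all habc
    refine signedInd_eq_of_segment rfl k (g' a b c habc).1 k1 k2 k3 (hseg.mono_right ?_)
    exact fun z hz => ⟨a, b, c, habc, hz⟩
  · rfl

/-- The winding number jumps by `1` where a segment crosses a single triangle. -/
theorem winding_sub_of_segment {p : V → E3} {o x x' : E3} (hx : S.IsGeneric p o x)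
    (hx' : S.IsGeneric p o x') (h : S.IsGenericPair p x x') {a b c : V} (habc : S.tri a b c)
    (hpos : 0 < sdet x (p a) (p b) (p c)) (hneg : sdet x' (p a) (p b) (p c) < 0)
    (hseg : ∀ z ∈ segment ℝ x x', sdet z (p a) (p b) (p c) = 0 →
      z ∈ convexHull ℝ {p a, p b, p c})
    (hother : ∀ a' b' c', S.tri a' b' c' → ¬ ((a', b', c') = (a, b, c) ∨ (a', b', c') = (b, c, a) ∨
      (a', b', c') = (c, a, b)) → Disjoint (segment ℝ x x') (convexHull ℝ {p a', p b', p c'})) :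
    S.winding p o x - S.winding p o x' = 1 := by
  classical
  have g := h.isGeneric hx
  have g' := h.isGeneric' hx hx'
  have hab := S.tri_ne habc
  have hbc := S.tri_ne (S.tri_rotate habc)
  have hca := S.tri_ne (S.tri_rotate (S.tri_rotate habc))
  rw [winding_apex hx g, winding_apex hx' g', winding, winding, ← sub_div, ← Finset.sum_sub_distrib]
  simp only [← Finset.sum_sub_distrib]
  set q := 2 • x - x'
  have rot : ∀ (u v w : E3) (y : E3), signedInd q v w u y = signedInd q u v w y := by
    intro u v w y
    have : ({q, v, w, u} : Set E3) = {q, u, v, w} := by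
      ext z; simp only [mem_insert_iff, mem_singleton_iff]; tauto
    rw [signedInd, signedInd, this, sdet_rotate]
  have jump : signedInd q (p a) (p b) (p c) x - signedInd q (p a) (p b) (p c) x' = 1 := by
    obtain ⟨k, k1, k2, k3⟩ := g.all habc
    exact signedInd_sub_of_segment rfl hpos hneg k1 k2 k3 hseg
  have jump₂ : signedInd q (p b) (p c) (p a) x - signedInd q (p b) (p c) (p a) x' = 1 := by
    rw [rot (p a) (p b), rot (p a) (p b), jump]
  have jump₃ : signedInd q (p c) (p a) (p b) x - signedInd q (p c) (p a) (p b) x' = 1 := by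
    rw [rot (p b) (p c), rot (p b) (p c), jump₂]
  have e : ∀ a' b' c', ((if S.tri a' b' c' then signedInd q (p a') (p b') (p c') x else 0) -
      if S.tri a' b' c' then signedInd q (p a') (p b') (p c') x' else 0) =
      (if (a', b', c') = (a, b, c) then 1 else 0) + (if (a', b', c') = (b, c, a) then 1 else 0) +
        (if (a', b', c') = (c, a, b) then 1 else 0) := by
    intro a' b' c'
    by_cases hrot : (a', b', c') = (a, b, c) ∨ (a', b', c') = (b, c, a) ∨ (a', b', c') = (c, a, b)
    · rcases hrot with h | h | h <;> simp only [Prod.mk.injEq] at h <;>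
        obtain ⟨rfl, rfl, rfl⟩ := h
      · simp [habc, hab, hca.symm, jump]
      · simp [S.tri_rotate habc, hab.symm, hbc, jump₂]
      · simp [S.tri_rotate (S.tri_rotate habc), hca, hbc.symm, jump₃]
    · have hr := hrot
      simp only [not_or] at hr
      rw [if_neg hr.1, if_neg hr.2.1, if_neg hr.2.2]
      split_ifs with ht
      · obtain ⟨k, k1, k2, k3⟩ := g.all ht
        simp [q, signedInd_eq_of_segment rfl k (g' _ _ _ ht).1 k1 k2 k3 (hother _ _ _ ht hrot)]
      · simp
  simp only [e, Finset.sum_add_distrib]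
  have single : ∀ u v w : V, (∑ a', ∑ b', ∑ c', if (a', b', c') = (u, v, w) then (1 : ℝ) else 0) = 1 := by
    intro u v w
    rw [Finset.sum_eq_single u, Finset.sum_eq_single v, Finset.sum_eq_single w] <;> simp +contextual
  rw [single, single, single]
  norm_num

end OrientedClosedSurface

namespace Klein

open Set Filter Topology

/-! ### Barycentric coordinates in a triangle -/

/-- The relative interior of the triangle `abc`. -/
def triInt (a b c : E3) : Set E3 :=
  {x | ∃ w₁ w₂ w₃ : ℝ, 0 < w₁ ∧ 0 < w₂ ∧ 0 < w₃ ∧ w₁ + w₂ + w₃ = 1 ∧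
    w₁ • a + w₂ • b + w₃ • c = x}

theorem triInt_subset (a b c : E3) : triInt a b c ⊆ convexHull ℝ {a, b, c} := by
  rintro x ⟨w₁, w₂, w₃, h1, h2, h3, hs, hx⟩
  exact mem_convexHull_three.2 ⟨w₁, w₂, w₃, h1.le, h2.le, h3.le, hs, hx⟩

theorem convex_triInt (a b c : E3) : Convex ℝ (triInt a b c) := by
  rintro x ⟨w₁, w₂, w₃, h1, h2, h3, hs, rfl⟩ y ⟨v₁, v₂, v₃, k1, k2, k3, ks, rfl⟩ s t h0 h0' hst
  have pos : ∀ {w v : ℝ}, 0 < w → 0 < v → 0 < s * w + t * v := by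
    intro w v hw hv
    rcases h0.eq_or_lt with rfl | h
    · obtain rfl : t = 1 := by linarith
      simpa using hv
    · have := mul_pos h hw
      have := mul_nonneg h0' hv.le
      linarith
  refine ⟨s * w₁ + t * v₁, s * w₂ + t * v₂, s * w₃ + t * v₃, pos h1 k1, pos h2 k2, pos h3 k3, ?_,
    by module⟩
  linear_combination s * hs + t * ks + hst

theorem triInt_rotate (a b c : E3) : triInt b c a = triInt a b c := by
  ext x
  constructor
  · rintro ⟨w₁, w₂, w₃, h1, h2, h3, hs, rfl⟩
    exact ⟨w₃, w₁, w₂, h3, h1, h2, by linarith, by module⟩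
  · rintro ⟨w₁, w₂, w₃, h1, h2, h3, hs, rfl⟩
    exact ⟨w₂, w₃, w₁, h2, h3, h1, by linarith, by module⟩

theorem triInt_nonempty (a b c : E3) : (triInt a b c).Nonempty :=
  ⟨_, 1 / 3, 1 / 3, 1 / 3, by norm_num, by norm_num, by norm_num, by norm_num, rfl⟩

theorem sdet_eq_zero_of_mem {a b c x : E3} (hx : x ∈ convexHull ℝ {a, b, c}) :
    sdet x a b c = 0 := by
  obtain ⟨w₁, w₂, w₃, -, -, -, hs, rfl⟩ := mem_convexHull_three.1 hx
  have := (sdet_combination (o := a) (a := a) (b := b) (c := c)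
    (show 0 + w₁ + w₂ + w₃ = 1 by linarith)).1
  simpa using this

theorem AffineIndependent.eq_zero {a b c : E3} (h : AffineIndependent ℝ ![a, b, c]) {x y z : ℝ}
    (hs : x + y + z = 0) (h0 : x • a + y • b + z • c = 0) : x = 0 ∧ y = 0 ∧ z = 0 := by
  obtain ⟨hab, hcol⟩ := AffineIndependent.not_smul h
  obtain rfl : x = -y - z := by linarith
  have h1 : y • (b - a) + z • (c - a) = 0 := by rw [← h0]; module
  obtain rfl : z = 0 := by
    by_contra hz
    refine hcol (-y / z) (smul_right_injective _ hz ?_)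
    simp only [smul_smul, mul_div_cancel₀ _ hz]
    rw [neg_smul, eq_neg_iff_add_eq_zero, add_comm]
    exact h1
  rw [zero_smul, add_zero, smul_eq_zero, sub_eq_zero] at h1
  obtain rfl := h1.resolve_right hab.symm
  simp

/-- Barycentric coordinates are unique. -/
theorem AffineIndependent.weights {a b c : E3} (h : AffineIndependent ℝ ![a, b, c])
    {w₁ w₂ w₃ v₁ v₂ v₃ : ℝ} (hs : w₁ + w₂ + w₃ = 1) (ks : v₁ + v₂ + v₃ = 1)
    (he : w₁ • a + w₂ • b + w₃ • c = v₁ • a + v₂ • b + v₃ • c) :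
    w₁ = v₁ ∧ w₂ = v₂ ∧ w₃ = v₃ := by
  obtain ⟨h1, h2, h3⟩ := AffineIndependent.eq_zero h (x := w₁ - v₁) (y := w₂ - v₂) (z := w₃ - v₃)
    (by linarith) (by rw [← sub_eq_zero] at he; rw [← he]; module)
  exact ⟨sub_eq_zero.1 h1, sub_eq_zero.1 h2, sub_eq_zero.1 h3⟩

theorem not_mem_convexHull_pair {a b c : E3} (h : AffineIndependent ℝ ![a, b, c])
    {w₁ w₂ w₃ : ℝ} (hs : w₁ + w₂ + w₃ = 1) (h1 : w₁ ≠ 0) :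
    w₁ • a + w₂ • b + w₃ • c ∉ convexHull ℝ {b, c} := by
  rw [convexHull_pair]
  rintro ⟨s, t, -, -, hst, he⟩
  refine h1 (AffineIndependent.weights h hs (v₁ := 0) (v₂ := s) (v₃ := t) (by linarith) ?_).1
  rw [← he]; module

theorem not_mem_convexHull_of_neg {a b c : E3} (h : AffineIndependent ℝ ![a, b, c])
    {w₁ w₂ w₃ : ℝ} (hs : w₁ + w₂ + w₃ = 1) (h3 : w₃ < 0) :
    w₁ • a + w₂ • b + w₃ • c ∉ convexHull ℝ {a, b, c} := by
  intro hx
  obtain ⟨v₁, v₂, v₃, -, -, k3, ks, he⟩ := mem_convexHull_three.1 hx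
  have := (AffineIndependent.weights h ks hs he).2.2
  linarith

theorem continuous_sdet (a b c : E3) : Continuous fun x => sdet x a b c := by
  simp only [sdet, det3_eq, PiLp.sub_apply]
  fun_prop

theorem normal_ne_zero_of_affineIndependent {a b c : E3} (h : AffineIndependent ℝ ![a, b, c]) :
    normal a b c ≠ 0 := by
  obtain ⟨hab, hs⟩ := AffineIndependent.not_smul h
  intro h0
  have e1 := congrFun h0 1
  have e2 := congrFun h0 2
  have e3 := congrFun h0 3
  simp only [normal, Matrix.cons_val, Pi.zero_apply] at e1 e2 e3
  have hu : ‖b - a‖ ^ 2 ≠ 0 := by simpa [sub_eq_zero] using hab.symm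
  refine hs (inner ℝ (b - a) (c - a) / ‖b - a‖ ^ 2) (smul_right_injective _ hu ?_)
  simp only [smul_smul, mul_div_cancel₀ _ hu]
  ext i
  simp only [PiLp.smul_apply, smul_eq_mul, inner_eq, norm_sq_eq, PiLp.sub_apply]
  fin_cases i <;> simp only [Fin.zero_eta, Fin.mk_one, Fin.reduceFinMk]
  · linear_combination (b 1 - a 1) * -e3 + (b 2 - a 2) * e2
  · linear_combination (b 0 - a 0) * e3 - (b 2 - a 2) * e1
  · linear_combination -(b 0 - a 0) * e2 + (b 1 - a 1) * e1

theorem exists_sdet_ne_zero {a b c : E3} (h : AffineIndependent ℝ ![a, b, c]) :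
    ∃ o, sdet o a b c ≠ 0 := by
  obtain ⟨o, -, ho⟩ := exists_mem_of_ae
    (ae_lor_ne_zero (normal_ne_zero_of_affineIndependent h)) isOpen_univ univ_nonempty
  exact ⟨o, by rw [sdet_eq_neg_lor]; exact neg_ne_zero.2 ho⟩

/-- Near a relatively interior point of a triangle the plane is covered by the triangle. -/
theorem eventually_mem_convexHull {a b c q : E3} (h : AffineIndependent ℝ ![a, b, c])
    (hq : q ∈ triInt a b c) : ∀ᶠ z in 𝓝 q, sdet z a b c = 0 → z ∈ convexHull ℝ {a, b, c} := by
  obtain ⟨o, ho⟩ := exists_sdet_ne_zero h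
  obtain ⟨w₁, w₂, w₃, h1, h2, h3, hs, rfl⟩ := hq
  obtain ⟨-, e1, e2, e3⟩ := sdet_combination (o := o) (a := a) (b := b) (c := c)
    (show 0 + w₁ + w₂ + w₃ = 1 by linarith)
  rw [zero_smul, zero_add] at e1 e2 e3
  have key : ∀ᶠ z in 𝓝 (w₁ • a + w₂ • b + w₃ • c),
      (0 < sdet z o b c ∧ 0 < sdet z o c a ∧ 0 < sdet z o a b) ∨
      (sdet z o b c < 0 ∧ sdet z o c a < 0 ∧ sdet z o a b < 0) := by
    rcases ho.lt_or_gt with k | k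
    · have c1 := (continuous_sdet o b c).continuousAt.eventually (lt_mem_nhds
        (show 0 < sdet (w₁ • a + w₂ • b + w₃ • c) o b c by rw [e1]; nlinarith))
      have c2 := (continuous_sdet o c a).continuousAt.eventually (lt_mem_nhds
        (show 0 < sdet (w₁ • a + w₂ • b + w₃ • c) o c a by rw [e2]; nlinarith))
      have c3 := (continuous_sdet o a b).continuousAt.eventually (lt_mem_nhds
        (show 0 < sdet (w₁ • a + w₂ • b + w₃ • c) o a b by rw [e3]; nlinarith))
      filter_upwards [c1, c2, c3] with z k1 k2 k3 using Or.inl ⟨k1, k2, k3⟩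
    · have c1 := (continuous_sdet o b c).continuousAt.eventually (gt_mem_nhds
        (show sdet (w₁ • a + w₂ • b + w₃ • c) o b c < 0 by rw [e1]; nlinarith))
      have c2 := (continuous_sdet o c a).continuousAt.eventually (gt_mem_nhds
        (show sdet (w₁ • a + w₂ • b + w₃ • c) o c a < 0 by rw [e2]; nlinarith))
      have c3 := (continuous_sdet o a b).continuousAt.eventually (gt_mem_nhds
        (show sdet (w₁ • a + w₂ • b + w₃ • c) o a b < 0 by rw [e3]; nlinarith))
      filter_upwards [c1, c2, c3] with z k1 k2 k3 using Or.inr ⟨k1, k2, k3⟩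
  filter_upwards [key] with z hz h0
  refine mem_convexHull_of_combination hz ?_
  rw [← sdet_cramer, h0, zero_smul]

/-- There are points on both sides of a plane arbitrarily near each of its points. -/
theorem frequently_side {a b c q : E3} (h : AffineIndependent ℝ ![a, b, c])
    (hq : sdet q a b c = 0) {σ : ℝ} (hσ : σ ≠ 0) : ∃ᶠ z in 𝓝 q, 0 < σ * sdet z a b c := by
  obtain ⟨o, ho⟩ := exists_sdet_ne_zero h
  have hc : Continuous fun t : ℝ => seg q o (t * (σ * sdet o a b c)) := by
    unfold seg; fun_prop
  have ht : Tendsto (fun t : ℝ => seg q o (t * (σ * sdet o a b c))) (𝓝[>] 0) (𝓝 q) := by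
    have := hc.tendsto 0
    rw [zero_mul, show seg q o 0 = q by simp [seg]] at this
    exact this.mono_left nhdsWithin_le_nhds
  refine ht.frequently (Eventually.frequently ?_)
  filter_upwards [self_mem_nhdsWithin] with t ht
  rw [sdet_seg, hq, show σ * ((1 - t * (σ * sdet o a b c)) * 0 + t * (σ * sdet o a b c) * sdet o a b c)
    = t * (σ * sdet o a b c) ^ 2 by ring]
  exact mul_pos ht (by positivity)

end Klein

namespace OrientedClosedSurface

open Klein Set Filter Topology

/-! ### Incidences in an embedded surface -/

variable {V : Type*} {S : OrientedClosedSurface V}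

theorem tri_distinct (S : OrientedClosedSurface V) {a b c : V} (h : S.tri a b c) :
    a ≠ b ∧ b ≠ c ∧ c ≠ a :=
  ⟨S.tri_ne h, S.tri_ne (S.tri_rotate h), S.tri_ne (S.tri_rotate (S.tri_rotate h))⟩

/-- If `a` and `b` are different vertices of the positively ordered triangle `xyz`, then this triangle
is a rotation of a triangle `abw` or `baw`. -/
theorem tri_of_mem {a b x y z : V} (h : S.tri x y z) (hab : a ≠ b)
    (ha : a ∈ ({x, y, z} : Set V)) (hb : b ∈ ({x, y, z} : Set V)) :
    ∃ w, (∀ p : V → E3,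
      convexHull ℝ {p x, p y, p z} = convexHull ℝ {p a, p b, p w}) ∧
      ((S.tri a b w ∧ ((x, y, z) = (a, b, w) ∨ (x, y, z) = (b, w, a) ∨ (x, y, z) = (w, a, b))) ∨
       (S.tri b a w ∧ ((x, y, z) = (b, a, w) ∨ (x, y, z) = (a, w, b) ∨ (x, y, z) = (w, b, a)))) := by
  have h' := S.tri_rotate h
  have h'' := S.tri_rotate h'
  simp only [mem_insert_iff, mem_singleton_iff] at ha hb
  have perm : ∀ {u v w u' v' w' : E3}, (∀ t, (t = u ∨ t = v ∨ t = w) ↔ (t = u' ∨ t = v' ∨ t = w')) →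
      convexHull ℝ ({u, v, w} : Set E3) = convexHull ℝ {u', v', w'} := by
    intro u v w u' v' w' ht
    congr 1
    ext t
    simpa using ht t
  rcases ha with rfl | rfl | rfl <;> rcases hb with rfl | rfl | rfl <;>
    first
    | exact absurd rfl hab
    | exact ⟨_, fun p => perm (by intro; tauto), Or.inl ⟨h, by simp⟩⟩
    | exact ⟨_, fun p => perm (by intro; tauto), Or.inl ⟨h', by simp⟩⟩
    | exact ⟨_, fun p => perm (by intro; tauto), Or.inl ⟨h'', by simp⟩⟩
    | exact ⟨_, fun p => perm (by intro; tauto), Or.inr ⟨h, by simp⟩⟩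
    | exact ⟨_, fun p => perm (by intro; tauto), Or.inr ⟨h', by simp⟩⟩
    | exact ⟨_, fun p => perm (by intro; tauto), Or.inr ⟨h'', by simp⟩⟩

theorem IsEmbedded.mem_of_weight {p : V → E3} (hp : S.IsPolyhedral p) (he : S.IsEmbedded p)
    {a b c a' b' c' : V} (h : S.tri a b c) (h' : S.tri a' b' c') {w₁ w₂ w₃ : ℝ}
    (h1 : 0 < w₁) (h2 : 0 ≤ w₂) (h3 : 0 ≤ w₃) (hs : w₁ + w₂ + w₃ = 1)
    (hx : w₁ • p a + w₂ • p b + w₃ • p c ∈ convexHull ℝ {p a', p b', p c'}) :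
    a ∈ ({a', b', c'} : Set V) := by
  by_contra hcon
  refine not_mem_convexHull_pair (hp.2 a b c h) hs h1.ne' ?_
  have hmem := he a b c a' b' c' h h'
    ⟨mem_convexHull_three.2 ⟨w₁, w₂, w₃, h1.le, h2, h3, hs, rfl⟩, hx⟩
  refine convexHull_mono ?_ hmem
  rintro _ ⟨v, ⟨hv, hv'⟩, rfl⟩
  rcases hv with rfl | rfl | hv
  · exact absurd hv' hcon
  · exact Or.inl rfl
  · rw [mem_singleton_iff.1 hv]; exact Or.inr rfl

/-- A relatively interior point of a triangle of an embedded surface lies in no other triangle. -/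
theorem IsEmbedded.rotation_of_triInt {p : V → E3} (hp : S.IsPolyhedral p) (he : S.IsEmbedded p)
    {a b c a' b' c' : V} (h : S.tri a b c) (h' : S.tri a' b' c') {q : E3}
    (hq : q ∈ triInt (p a) (p b) (p c)) (hq' : q ∈ convexHull ℝ {p a', p b', p c'}) :
    (a', b', c') = (a, b, c) ∨ (a', b', c') = (b, c, a) ∨ (a', b', c') = (c, a, b) := by
  obtain ⟨w₁, w₂, w₃, h1, h2, h3, hs, rfl⟩ := hq
  have ma := he.mem_of_weight hp h h' h1 h2.le h3.le hs hq'
  have mb := he.mem_of_weight hp (S.tri_rotate h) h' h2 h3.le h1.le (by linarith)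
    (by convert hq' using 1; module)
  have mc := he.mem_of_weight hp (S.tri_rotate (S.tri_rotate h)) h' h3 h1.le h2.le (by linarith)
    (by convert hq' using 1; module)
  obtain ⟨hab, hbc, hca⟩ := S.tri_distinct h
  obtain ⟨w, -, ⟨hw, hr⟩ | ⟨hw, hr⟩⟩ := tri_of_mem h' hab ma mb
  · obtain rfl := S.tri_unique h hw
    exact hr
  · exfalso
    have hcw : c = w := by
      rcases hr with hr | hr | hr <;> simp only [Prod.mk.injEq] at hr <;>
        obtain ⟨rfl, rfl, rfl⟩ := hr <;>
        simp only [mem_insert_iff, mem_singleton_iff] at mc <;>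
        simp_all [eq_comm]
    subst hcw
    exact S.tri_not_swap h hw

/-- The midpoint of an edge of an embedded surface lies only in the two triangles at the edge. -/
theorem IsEmbedded.eq_of_midpoint {p : V → E3} (hp : S.IsPolyhedral p) (he : S.IsEmbedded p)
    {a b c d a' b' c' : V} (h : S.tri a b c) (hd : S.tri b a d) (h' : S.tri a' b' c')
    (hm : (1 / 2 : ℝ) • p a + (1 / 2 : ℝ) • p b ∈ convexHull ℝ {p a', p b', p c'}) :
    convexHull ℝ {p a', p b', p c'} = convexHull ℝ {p a, p b, p c} ∨
      convexHull ℝ {p a', p b', p c'} = convexHull ℝ {p b, p a, p d} := by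
  have ma := he.mem_of_weight hp h h' (w₁ := 1 / 2) (w₂ := 1 / 2) (w₃ := 0) (by norm_num)
    (by norm_num) le_rfl (by norm_num) (by convert hm using 1; module)
  have mb := he.mem_of_weight hp hd h' (w₁ := 1 / 2) (w₂ := 1 / 2) (w₃ := 0) (by norm_num)
    (by norm_num) le_rfl (by norm_num) (by convert hm using 1; module)
  obtain ⟨w, hw, ⟨k, -⟩ | ⟨k, -⟩⟩ := tri_of_mem h' (S.tri_ne h) ma mb
  · left; rw [hw p, S.tri_unique h k]
  · right; rw [hw p, S.tri_unique hd k, insert_comm]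

end OrientedClosedSurface

namespace Klein

open Set Filter Topology

/-! ### Sides of a triangle -/

/-- If a relation assigns to each point of a preconnected set at most one value, and near each point
some value is assigned everywhere, then this value is the same at all points. -/
theorem value_eq_of_isPreconnected {X γ : Type*} [TopologicalSpace X] {s : Set X}
    (hs : IsPreconnected s) (Q : X → γ → Prop)
    (hex : ∀ x ∈ s, ∃ c, ∀ᶠ y in 𝓝[s] x, Q y c)
    (hu : ∀ x ∈ s, ∀ c c', Q x c → Q x c' → c = c') {x y : X} (hx : x ∈ s) (hy : y ∈ s) {c : γ}
    (h : Q x c) : Q y c := by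
  refine (hs.induction₂ (fun x y => ∀ c, Q x c ↔ Q y c) (fun x hx => ?_)
    (fun x y z _ _ _ h1 h2 c => (h1 c).trans (h2 c)) (fun x y _ _ h c => (h c).symm) hx hy c).1 h
  obtain ⟨c₀, hc₀⟩ := hex x hx
  have h0 : Q x c₀ := hc₀.self_of_nhdsWithin hx
  filter_upwards [hc₀, self_mem_nhdsWithin] with y hy hys c
  constructor
  · intro h; rwa [hu x hx c c₀ h h0]
  · intro h; rwa [hu y hys c c₀ h hy]

/-- The set `C` contains the points near `q` on one side of the plane of `abc`, given by the sign
of `σ`. -/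
def Side (σ : ℝ) (a b c q : E3) (C : Set E3) : Prop :=
  ∀ᶠ z in 𝓝 q, 0 < σ * sdet z a b c → z ∈ C

/-- The set `C` is a connected component of `U`. -/
def IsComponent (U C : Set E3) : Prop := ∃ y ∈ U, C = connectedComponentIn U y

theorem IsComponent.eq_of_mem {U C C' : Set E3} (h : IsComponent U C) (h' : IsComponent U C') {x : E3}
    (hx : x ∈ C) (hx' : x ∈ C') : C = C' := by
  obtain ⟨y, -, rfl⟩ := h
  obtain ⟨y', -, rfl⟩ := h'
  rw [connectedComponentIn_eq hx, connectedComponentIn_eq hx']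

theorem IsComponent.subset {U C : Set E3} (h : IsComponent U C) : C ⊆ U := by
  obtain ⟨y, -, rfl⟩ := h
  exact connectedComponentIn_subset _ _

theorem IsComponent.subset_of_mem {U C K : Set E3} (h : IsComponent U C) (hK : IsPreconnected K)
    (hKU : K ⊆ U) {x : E3} (hx : x ∈ C) (hxK : x ∈ K) : K ⊆ C := by
  obtain ⟨y, -, rfl⟩ := h
  rw [connectedComponentIn_eq hx]
  exact hK.subset_connectedComponentIn hxK hKU

theorem Side.eq {σ : ℝ} {a b c q : E3} {U C C' : Set E3} (h : AffineIndependent ℝ ![a, b, c])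
    (hq : q ∈ triInt a b c) (hσ : σ ≠ 0) (hC : IsComponent U C) (hC' : IsComponent U C')
    (hs : Side σ a b c q C) (hs' : Side σ a b c q C') : C = C' := by
  obtain ⟨z, ⟨hz, hz'⟩, hpos⟩ :=
    ((hs.and hs').and_frequently
      (frequently_side h (sdet_eq_zero_of_mem (triInt_subset _ _ _ hq)) hσ)).exists
  exact hC.eq_of_mem hC' (hz hpos) (hz' hpos)

theorem Side.eventually {σ : ℝ} {a b c q : E3} {C : Set E3} (hs : Side σ a b c q C) :
    ∀ᶠ q' in 𝓝 q, Side σ a b c q' C :=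
  eventually_eventually_nhds.2 hs

theorem Side.rotate {σ : ℝ} {a b c q : E3} {C : Set E3} (hs : Side σ a b c q C) :
    Side σ b c a q C := by
  simpa only [Side, sdet_rotate] using hs

theorem sdet_convex (a b c x y : E3) {s t : ℝ} (h : s + t = 1) :
    sdet (s • x + t • y) a b c = s * sdet x a b c + t * sdet y a b c := by
  obtain rfl : s = 1 - t := by linarith
  exact sdet_seg a b c x y t

theorem convex_side (σ : ℝ) (a b c : E3) : Convex ℝ {z | 0 < σ * sdet z a b c} := by
  intro x hx y hy s t hs ht hst
  simp only [mem_ofPred_eq] at hx hy ⊢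
  rw [sdet_convex _ _ _ _ _ hst]
  rcases hs.eq_or_lt with rfl | hs
  · obtain rfl : t = 1 := by linarith
    simpa using hy
  · have := mul_pos hs hx
    have := mul_nonneg ht hy.le
    nlinarith

theorem isCompact_hull (a b c : E3) : IsCompact (convexHull ℝ {a, b, c}) :=
  (toFinite {a, b, c}).isCompact_convexHull ℝ

end Klein

namespace OrientedClosedSurface

open Klein Set Filter Topology

variable {V : Type*} {S : OrientedClosedSurface V}

theorem IsPolyhedral.hull_subset {p : V → E3} (hp : S.IsPolyhedral p) (a b c : V) :
    convexHull ℝ {p a, p b, p c} ⊆ space :=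
  convexHull_subset_space (by rintro x (rfl | rfl | rfl) <;> exact hp.1 _)

/-- All points near the relative interior of a triangle on one of its sides are in `C`. -/
def TriSide (S : OrientedClosedSurface V) (p : V → E3) (σ : ℝ) (a b c : V) (C : Set E3) : Prop :=
  IsComponent (space \ S.carrier p) C ∧
    ∀ q ∈ triInt (p a) (p b) (p c), Side σ (p a) (p b) (p c) q C

theorem TriSide.rotate {p : V → E3} {σ : ℝ} {a b c : V} {C : Set E3} (h : S.TriSide p σ a b c C) :
    S.TriSide p σ b c a C :=
  ⟨h.1, fun q hq => (h.2 q (triInt_rotate (p a) (p b) (p c) ▸ hq)).rotate⟩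

theorem sdet_of_rotation {p : V → E3} {a b c a' b' c' : V} (h : (a', b', c') = (a, b, c) ∨
    (a', b', c') = (b, c, a) ∨ (a', b', c') = (c, a, b)) (z : E3) :
    sdet z (p a') (p b') (p c') = sdet z (p a) (p b) (p c) := by
  rcases h with h | h | h <;> simp only [Prod.mk.injEq] at h <;> obtain ⟨rfl, rfl, rfl⟩ := h
  · rfl
  · exact sdet_rotate _ _ _ _
  · exact (sdet_rotate _ _ _ _).symm

variable [Finite V]

theorem isCompact_carrier (S : OrientedClosedSurface V) (p : V → E3) : IsCompact (S.carrier p) := by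
  have : S.carrier p = ⋃ x ∈ {x : V × V × V | S.tri x.1 x.2.1 x.2.2},
      convexHull ℝ {p x.1, p x.2.1, p x.2.2} := by
    ext x; simp [carrier]
  rw [this]
  exact (toFinite _).isCompact_biUnion fun x _ => isCompact_hull _ _ _

theorem isOpen_complement (S : OrientedClosedSurface V) (p : V → E3) :
    IsOpen (space \ S.carrier p) :=
  Metric.isOpen_ball.sdiff (S.isCompact_carrier p).isClosed

/-- Near a relatively interior point of a triangle, an embedded surface is the plane of the
triangle. -/
theorem IsEmbedded.eventually_near {p : V → E3} (hp : S.IsPolyhedral p) (he : S.IsEmbedded p)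
    {a b c : V} (h : S.tri a b c) {q : E3} (hq : q ∈ triInt (p a) (p b) (p c)) :
    ∀ᶠ z in 𝓝 q, z ∈ space ∧
      (∀ a' b' c', S.tri a' b' c' → ¬ ((a', b', c') = (a, b, c) ∨ (a', b', c') = (b, c, a) ∨
        (a', b', c') = (c, a, b)) → z ∉ convexHull ℝ {p a', p b', p c'}) ∧
      (sdet z (p a) (p b) (p c) = 0 → z ∈ convexHull ℝ {p a, p b, p c}) := by
  refine Eventually.and (Metric.isOpen_ball.mem_nhds (hp.hull_subset a b c (triInt_subset _ _ _ hq)))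
    (Eventually.and ?_ (eventually_mem_convexHull (hp.2 a b c h) hq))
  simp only [eventually_all]
  intro a' b' c' h' hrot
  exact (isCompact_hull _ _ _).isClosed.isOpen_compl.mem_nhds
    fun hq' => hrot (he.rotation_of_triInt hp h h' hq hq')

theorem IsEmbedded.exists_side {p : V → E3} (hp : S.IsPolyhedral p) (he : S.IsEmbedded p)
    {a b c : V} (h : S.tri a b c) {q : E3} (hq : q ∈ triInt (p a) (p b) (p c)) {σ : ℝ} (hσ : σ ≠ 0) :
    ∃ C, IsComponent (space \ S.carrier p) C ∧ Side σ (p a) (p b) (p c) q C := by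
  obtain ⟨δ, hδ, hB⟩ := Metric.eventually_nhds_iff_ball.1 (he.eventually_near hp h hq)
  have hsub : Metric.ball q δ ∩ {z | 0 < σ * sdet z (p a) (p b) (p c)} ⊆ space \ S.carrier p := by
    rintro z ⟨hz, hpos⟩
    obtain ⟨h1, h2, -⟩ := hB z hz
    refine ⟨h1, ?_⟩
    rintro ⟨a', b', c', h', hz'⟩
    have hrot := not_not.1 fun hr => h2 a' b' c' h' hr hz'
    have := sdet_eq_zero_of_mem hz'
    rw [sdet_of_rotation hrot] at this
    simp [this] at hpos
  obtain ⟨y, hpos, hy⟩ := ((frequently_side (hp.2 a b c h)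
    (sdet_eq_zero_of_mem (triInt_subset _ _ _ hq)) hσ).and_eventually (Metric.ball_mem_nhds q hδ)).exists
  refine ⟨_, ⟨y, hsub ⟨hy, hpos⟩, rfl⟩, ?_⟩
  filter_upwards [Metric.ball_mem_nhds q hδ] with z hz hzpos
  exact ((convex_ball q δ).inter (convex_side σ _ _ _)).isPreconnected.subset_connectedComponentIn
    ⟨hy, hpos⟩ hsub ⟨hz, hzpos⟩

/-- Each side of a triangle of an embedded surface belongs to a single component of the
complement. -/
theorem IsEmbedded.triSide_of_side {p : V → E3} (hp : S.IsPolyhedral p) (he : S.IsEmbedded p)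
    {a b c : V} (h : S.tri a b c) {q : E3} (hq : q ∈ triInt (p a) (p b) (p c)) {σ : ℝ} (hσ : σ ≠ 0)
    {C : Set E3} (hC : IsComponent (space \ S.carrier p) C) (hs : Side σ (p a) (p b) (p c) q C) :
    S.TriSide p σ a b c C := by
  refine ⟨hC, fun q' hq' => ?_⟩
  refine (value_eq_of_isPreconnected (convex_triInt (p a) (p b) (p c)).isPreconnected
    (fun q C => IsComponent (space \ S.carrier p) C ∧ Side σ (p a) (p b) (p c) q C)
    (fun q hq => ?_) (fun q hq C C' h1 h2 => ?_) hq hq' ⟨hC, hs⟩).2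
  · obtain ⟨C, hC, hs⟩ := he.exists_side hp h hq hσ
    exact ⟨C, (hs.eventually.filter_mono nhdsWithin_le_nhds).mono fun _ h => ⟨hC, h⟩⟩
  · exact h1.2.eq (hp.2 a b c h) hq hσ h1.1 h2.1 h2.2

theorem IsEmbedded.exists_triSide {p : V → E3} (hp : S.IsPolyhedral p) (he : S.IsEmbedded p)
    {a b c : V} (h : S.tri a b c) {σ : ℝ} (hσ : σ ≠ 0) : ∃ C, S.TriSide p σ a b c C := by
  obtain ⟨q, hq⟩ := triInt_nonempty (p a) (p b) (p c)
  obtain ⟨C, hC, hs⟩ := he.exists_side hp h hq hσ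
  exact ⟨C, he.triSide_of_side hp h hq hσ hC hs⟩

end OrientedClosedSurface

namespace Klein

open Set Filter Topology

/-! ### The wedge between two triangles at an edge -/

/-- Polar coordinates, with the angle in `[0, 2π)`. -/
theorem exists_polar {x y : ℝ} (h : ¬ (x = 0 ∧ y = 0)) :
    ∃ ρ > 0, ∃ α ∈ Ico 0 (2 * Real.pi), x = ρ * Real.cos α ∧ y = ρ * Real.sin α := by
  have hz : (⟨x, y⟩ : ℂ) ≠ 0 := by
    intro h0
    exact h ⟨congrArg Complex.re h0, congrArg Complex.im h0⟩
  have h1 := Complex.norm_mul_cos_arg ⟨x, y⟩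
  have h2 := Complex.norm_mul_sin_arg ⟨x, y⟩
  have h3 := Complex.neg_pi_lt_arg ⟨x, y⟩
  have h4 := Complex.arg_le_pi ⟨x, y⟩
  have h5 := Real.pi_pos
  refine ⟨‖(⟨x, y⟩ : ℂ)‖, norm_pos_iff.2 hz, ?_⟩
  rcases le_or_gt 0 (Complex.arg ⟨x, y⟩) with h6 | h6
  · exact ⟨_, ⟨h6, by linarith⟩, h1.symm, h2.symm⟩
  · refine ⟨Complex.arg ⟨x, y⟩ + 2 * Real.pi, ⟨by linarith, by linarith⟩, ?_, ?_⟩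
    · rw [Real.cos_add_two_pi]; exact h1.symm
    · rw [Real.sin_add_two_pi]; exact h2.symm

theorem det3_cramer (u v w y : E3) : det3 u v w • y =
    det3 y v w • u + det3 u y w • v + det3 u v y • w := by
  ext i
  fin_cases i <;> simp [det3_eq] <;> ring

/-- The orientations of the triangles `abc` and `bad` as seen from `m + x w + y n`, where `m` is the
midpoint of `ab`, in coordinates with respect to the basis `u = b - a`, `w = c - m`, `n`. -/
theorem sdet_wedge (a u w n : E3) (s p q x y : ℝ) :
    sdet (a + (1 / 2 : ℝ) • u + x • w + y • n) a (a + u) (a + (1 / 2 : ℝ) • u + w) =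
      -y * det3 u w n ∧
    sdet (a + (1 / 2 : ℝ) • u + x • w + y • n) (a + u) a
      (a + (1 / 2 : ℝ) • u + (s • u + p • w + q • n)) = (p * y - q * x) * det3 u w n := by
  constructor <;>
  · simp only [sdet, det3_eq, PiLp.sub_apply, PiLp.add_apply, PiLp.smul_apply, smul_eq_mul]
    ring

/-- Turn about the midpoint of the edge `ab`, in a plane transversal to the edge, from the triangle
`abc` into its side given by `σ` until the triangle `bad` is reached. A small arc of this kind arrives
at `bad` from the side given by `σ`. In between it does not meet the two triangles, nor a given
closed set which does not contain the midpoint of the edge. -/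
theorem exists_arc {a b c d : E3} (habc : AffineIndependent ℝ ![a, b, c])
    (hbad : AffineIndependent ℝ ![b, a, d]) (hdisj : Disjoint (triInt a b c) (triInt b a d))
    {K : Set E3} (hK : IsClosed K) (hm : (1 / 2 : ℝ) • a + (1 / 2 : ℝ) • b ∉ K) {σ : ℝ} (hσ : σ ≠ 0) :
    ∃ (γ : ℝ → E3) (α : ℝ), Continuous γ ∧ 0 < α ∧ γ 0 ∈ triInt a b c ∧ γ α ∈ triInt b a d ∧
      (∀ θ ∈ Ioo 0 α, γ θ ∉ K ∧ γ θ ∉ convexHull ℝ {a, b, c} ∧ γ θ ∉ convexHull ℝ {b, a, d}) ∧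
      (∀ᶠ θ in 𝓝[>] 0, 0 < σ * sdet (γ θ) a b c) ∧ (∀ᶠ θ in 𝓝[<] α, 0 < σ * sdet (γ θ) b a d) := by
  obtain ⟨o, ho⟩ := exists_sdet_ne_zero habc
  obtain ⟨u, rfl⟩ : ∃ u, b = a + u := ⟨b - a, by abel⟩
  have hmid : (1 / 2 : ℝ) • a + (1 / 2 : ℝ) • (a + u) = a + (1 / 2 : ℝ) • u := by module
  rw [hmid] at hm
  obtain ⟨w, rfl⟩ : ∃ w, c = a + (1 / 2 : ℝ) • u + w := ⟨c - (a + (1 / 2 : ℝ) • u), by abel⟩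
  -- a vector at the midpoint which points to the side of `abc` given by `σ`
  obtain ⟨n, hn⟩ : ∃ n, 0 < -σ * det3 u w n := by
    refine ⟨(σ * sdet o a (a + u) (a + (1 / 2 : ℝ) • u + w)) • (o - (a + (1 / 2 : ℝ) • u)), ?_⟩
    have : -σ * det3 u w ((σ * sdet o a (a + u) (a + (1 / 2 : ℝ) • u + w)) •
        (o - (a + (1 / 2 : ℝ) • u))) = (σ * sdet o a (a + u) (a + (1 / 2 : ℝ) • u + w)) ^ 2 := by
      simp only [sdet, det3_eq, PiLp.sub_apply, PiLp.add_apply, PiLp.smul_apply, smul_eq_mul]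
      ring
    rw [this]
    positivity
  have hD : det3 u w n ≠ 0 := right_ne_zero_of_mul hn.ne'
  obtain ⟨s, p, q, rfl⟩ : ∃ s p q : ℝ, d = a + (1 / 2 : ℝ) • u + (s • u + p • w + q • n) := by
    refine ⟨det3 (d - (a + (1 / 2 : ℝ) • u)) w n / det3 u w n,
      det3 u (d - (a + (1 / 2 : ℝ) • u)) n / det3 u w n,
      det3 u w (d - (a + (1 / 2 : ℝ) • u)) / det3 u w n, ?_⟩
    have h1 := det3_cramer u w n (d - (a + (1 / 2 : ℝ) • u))
    have h2 : d - (a + (1 / 2 : ℝ) • u) = (det3 u w n)⁻¹ • (det3 u w n • (d - (a + (1 / 2 : ℝ) • u))) :=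
      (inv_smul_smul₀ hD _).symm
    rw [h1] at h2
    refine sub_eq_iff_eq_add'.1 (h2.trans ?_)
    simp only [div_eq_inv_mul]
    module
  -- `bad` is nondegenerate
  have hpq : ¬ (p = 0 ∧ q = 0) := by
    rintro ⟨rfl, rfl⟩
    have := (AffineIndependent.eq_zero hbad (x := -(1 / 2) - s) (y := -(1 / 2) + s) (z := 1)
      (by ring) (by module)).2.2
    norm_num at this
  obtain ⟨ρ, hρ, α, hα, rfl, rfl⟩ := exists_polar hpq
  -- the ends of the arc of radius `r` are in the triangles, and the arc is near the midpoint
  obtain ⟨δ, hδ, hball⟩ := Metric.isOpen_iff.1 hK.isOpen_compl _ hm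
  obtain ⟨r, hr0, hr1, hr2, hr3⟩ : ∃ r > 0, r < 1 ∧ r / ρ * (1 + 2 * |s|) < 1 ∧
      r * (‖w‖ + ‖n‖) < δ := by
    have t1 : Tendsto (fun r : ℝ => r) (𝓝[>] 0) (𝓝 0) := tendsto_id.mono_left nhdsWithin_le_nhds
    have t2 : Tendsto (fun r : ℝ => r / ρ * (1 + 2 * |s|)) (𝓝[>] 0) (𝓝 0) := by
      have := (t1.div_const ρ).mul_const (1 + 2 * |s|)
      simpa using this
    have t3 : Tendsto (fun r : ℝ => r * (‖w‖ + ‖n‖)) (𝓝[>] 0) (𝓝 0) := by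
      simpa using t1.mul_const (‖w‖ + ‖n‖)
    obtain ⟨r, ⟨⟨h1, h2⟩, h3⟩, h4⟩ := ((((t1.eventually (gt_mem_nhds one_pos)).and
      (t2.eventually (gt_mem_nhds one_pos))).and (t3.eventually (gt_mem_nhds hδ))).and
      self_mem_nhdsWithin).exists
    exact ⟨r, h4, h1, h2, h3⟩
  have hk : 0 < r / ρ := div_pos hr0 hρ
  have hρk : r / ρ * ρ = r := div_mul_cancel₀ _ hρ.ne'
  set k := r / ρ
  have hks := mul_le_mul_of_nonneg_left (neg_abs_le s) hk.le
  have hks' := mul_le_mul_of_nonneg_left (le_abs_self s) hk.le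
  set γ : ℝ → E3 := fun θ => a + (1 / 2 : ℝ) • u + (r * Real.cos θ) • w + (r * Real.sin θ) • n
    with hγ
  have hγ0 : γ 0 ∈ triInt a (a + u) (a + (1 / 2 : ℝ) • u + w) := by
    refine ⟨(1 - r) / 2, (1 - r) / 2, r, by linarith, by linarith, hr0, by ring, ?_⟩
    simp only [hγ, Real.cos_zero, Real.sin_zero, mul_zero, mul_one]
    module
  have hγα : γ α ∈ triInt (a + u) a
      (a + (1 / 2 : ℝ) • u + (s • u + (ρ * Real.cos α) • w + (ρ * Real.sin α) • n)) := by
    refine ⟨(1 - k) / 2 - k * s, (1 - k) / 2 + k * s, k, by linarith, by linarith, hk, by ring, ?_⟩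
    simp only [hγ]
    rw [← hρk]
    module
  -- for `α = 0` the two triangles would overlap
  have hα0 : 0 < α := by
    refine hα.1.lt_of_ne ?_
    rintro rfl
    exact disjoint_left.1 hdisj hγ0 hγα
  have s1 : ∀ θ, σ * sdet (γ θ) a (a + u) (a + (1 / 2 : ℝ) • u + w) =
      (-σ * det3 u w n) * r * Real.sin θ := by
    intro θ
    rw [hγ, (sdet_wedge a u w n s 0 0 _ _).1]; ring
  have s2 : ∀ θ, σ * sdet (γ θ) (a + u) a
      (a + (1 / 2 : ℝ) • u + (s • u + (ρ * Real.cos α) • w + (ρ * Real.sin α) • n)) =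
      (-σ * det3 u w n) * r * ρ * Real.sin (α - θ) := by
    intro θ
    rw [hγ, (sdet_wedge a u w n s _ _ _ _).2, Real.sin_sub]; ring
  have sin_zero : ∀ θ ∈ Ioo 0 (2 * Real.pi), Real.sin θ = 0 → θ = Real.pi := by
    intro θ hθ h0
    obtain ⟨k, hk⟩ := Real.sin_eq_zero_iff.1 h0
    have hpi := Real.pi_pos
    have h1 : (0 : ℝ) < k := by
      by_contra hc
      have := mul_nonpos_of_nonpos_of_nonneg (not_lt.1 hc) hpi.le
      linarith [hθ.1]
    have h2 : (k : ℝ) < 2 := by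
      by_contra hc
      have := mul_le_mul_of_nonneg_right (not_lt.1 hc) hpi.le
      linarith [hθ.2]
    obtain rfl : k = 1 := by
      have h1' : (0 : ℤ) < k := by exact_mod_cast h1
      have h2' : k < (2 : ℤ) := by exact_mod_cast h2
      omega
    simpa using hk.symm
  refine ⟨γ, α, by fun_prop, hα0, hγ0, hγα, fun θ hθ => ⟨?_, ?_, ?_⟩, ?_, ?_⟩
  · refine hball ?_
    rw [Metric.mem_ball, dist_eq_norm]
    have e : γ θ - (a + (1 / 2 : ℝ) • u) = r • (Real.cos θ • w + Real.sin θ • n) := by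
      simp only [hγ]; module
    rw [e, norm_smul, Real.norm_of_nonneg hr0.le]
    refine lt_of_le_of_lt (mul_le_mul_of_nonneg_left ?_ hr0.le) hr3
    refine (norm_add_le _ _).trans (add_le_add ?_ ?_) <;> rw [norm_smul]
    · exact mul_le_of_le_one_left (norm_nonneg _) (Real.abs_cos_le_one θ)
    · exact mul_le_of_le_one_left (norm_nonneg _) (Real.abs_sin_le_one θ)
  · intro hmem
    have h0 := s1 θ
    rw [sdet_eq_zero_of_mem hmem, mul_zero, zero_eq_mul] at h0
    -- in the plane of `abc` the arc has reached the half-plane opposite to `c`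
    have hθπ := sin_zero θ ⟨hθ.1, hθ.2.trans hα.2⟩ (h0.resolve_left (mul_pos hn hr0).ne')
    refine not_mem_convexHull_of_neg habc (w₁ := (1 + r) / 2) (w₂ := (1 + r) / 2) (w₃ := -r)
      (by ring) (by linarith) ?_
    convert hmem using 1
    simp only [hγ, hθπ, Real.cos_pi, Real.sin_pi]
    module
  · intro hmem
    have h0 := s2 θ
    rw [sdet_eq_zero_of_mem hmem, mul_zero, zero_eq_mul] at h0
    -- similarly, the half-plane opposite to `d`
    have hθπ := sin_zero (α - θ) ⟨by linarith [hθ.2], by linarith [hθ.1, hα.2]⟩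
      (h0.resolve_left (mul_pos (mul_pos hn hr0) hρ).ne')
    obtain rfl : θ = α - Real.pi := by linarith
    refine not_mem_convexHull_of_neg hbad (w₁ := (1 + k) / 2 + k * s) (w₂ := (1 + k) / 2 - k * s)
      (w₃ := -k) (by ring) (by linarith) ?_
    convert hmem using 1
    simp only [hγ, Real.cos_sub_pi, Real.sin_sub_pi]
    rw [← hρk]
    module
  · filter_upwards [Ioo_mem_nhdsGT Real.pi_pos] with θ hθ
    rw [s1]
    exact mul_pos (mul_pos hn hr0) (Real.sin_pos_of_mem_Ioo hθ)
  · filter_upwards [Ioo_mem_nhdsLT (show α - Real.pi < α by linarith [Real.pi_pos])] with θ hθ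
    rw [s2]
    exact mul_pos (mul_pos (mul_pos hn hr0) hρ)
      (Real.sin_pos_of_mem_Ioo ⟨by linarith [hθ.2], by linarith [hθ.1]⟩)

/-! ### The two sides of an embedded surface -/

/-- Three points of the ball model lie on a plane. The normal of the plane is not given by `normal`,
which vanishes if the points are collinear. -/
theorem exists_plane (a b c : E3) : ∃ X : Fin 4 → ℝ, X ≠ 0 ∧ lor X (lift a) = 0 ∧
    lor X (lift b) = 0 ∧ lor X (lift c) = 0 := by
  let f : (Fin 4 → ℝ) →ₗ[ℝ] (Fin 3 → ℝ) :=
    { toFun := fun X => ![lor X (lift a), lor X (lift b), lor X (lift c)]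
      map_add' := fun X Y => by
        ext i; fin_cases i <;> simp [lor] <;> ring
      map_smul' := fun r X => by
        ext i; fin_cases i <;> simp [lor] <;> ring }
  obtain ⟨X, hX, h0⟩ := (Submodule.ne_bot_iff _).1
    (LinearMap.ker_ne_bot_of_finrank_lt (f := f) (by simp))
  have h := LinearMap.mem_ker.1 hX
  exact ⟨X, h0, congrFun h 0, congrFun h 1, congrFun h 2⟩

end Klein

namespace OrientedClosedSurface

open Klein Set Filter Topology

variable {V : Type*} {S : OrientedClosedSurface V} [Finite V]

/-- Triangles which are adjacent along an edge have the same component on their sides of the same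
sign. -/
theorem IsEmbedded.triSide_adjacent {p : V → E3} (hp : S.IsPolyhedral p) (he : S.IsEmbedded p)
    {a b c d : V} (h : S.tri a b c) (hd : S.tri b a d) {σ : ℝ} (hσ : σ ≠ 0) {C : Set E3}
    (hC : S.TriSide p σ a b c C) : S.TriSide p σ b a d C := by
  obtain ⟨C', hC'⟩ := he.exists_triSide hp hd hσ
  suffices C = C' by rwa [this]
  -- `K` is the union of the triangles which do not contain the midpoint of the edge, and of the
  -- complement of the ball model
  set T : Set (V × V × V) := {x | S.tri x.1 x.2.1 x.2.2 ∧
    (1 / 2 : ℝ) • p a + (1 / 2 : ℝ) • p b ∉ convexHull ℝ {p x.1, p x.2.1, p x.2.2}}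
  set K : Set E3 := spaceᶜ ∪ ⋃ x ∈ T, convexHull ℝ {p x.1, p x.2.1, p x.2.2} with hKdef
  have hK : IsClosed K := (Metric.isOpen_ball.isClosed_compl).union
    ((toFinite T).isClosed_biUnion fun x _ => (isCompact_hull _ _ _).isClosed)
  have hm : (1 / 2 : ℝ) • p a + (1 / 2 : ℝ) • p b ∉ K := by
    simp only [hKdef, mem_union, mem_compl_iff, not_or, not_not, mem_iUnion, not_exists]
    exact ⟨convex_ball _ _ (hp.1 a) (hp.1 b) (by norm_num) (by norm_num) (by norm_num),
      fun x hx => hx.2⟩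
  have hdisj : Disjoint (triInt (p a) (p b) (p c)) (triInt (p b) (p a) (p d)) := by
    refine disjoint_left.2 fun q hq hq' => ?_
    obtain ⟨hab, hbc, hca⟩ := S.tri_distinct h
    rcases he.rotation_of_triInt hp h hd hq (triInt_subset _ _ _ hq') with hr | hr | hr <;>
      simp only [Prod.mk.injEq] at hr
    · exact hab hr.2.1
    · exact hca hr.2.1.symm
    · exact hbc hr.1
  obtain ⟨γ, α, hγ, hα, h0, h1, harc, hs0, hs1⟩ :=
    exists_arc (hp.2 a b c h) (hp.2 b a d hd) hdisj hK hm hσ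
  have hU : γ '' Ioo 0 α ⊆ space \ S.carrier p := by
    rintro _ ⟨θ, hθ, rfl⟩
    obtain ⟨k1, k2, k3⟩ := harc θ hθ
    simp only [hKdef, mem_union, mem_compl_iff, not_or, not_not, mem_iUnion, not_exists] at k1
    refine ⟨k1.1, ?_⟩
    rintro ⟨a', b', c', h', hz⟩
    by_cases hmem : (1 / 2 : ℝ) • p a + (1 / 2 : ℝ) • p b ∈ convexHull ℝ {p a', p b', p c'}
    · rcases he.eq_of_midpoint hp h hd h' hmem with e | e <;> rw [e] at hz
      · exact k2 hz
      · exact k3 hz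
    · exact k1.2 (a', b', c') ⟨h', hmem⟩ hz
  have hpre : IsPreconnected (γ '' Ioo 0 α) := isPreconnected_Ioo.image _ hγ.continuousOn
  have m0 : ∃ θ ∈ Ioo 0 α, γ θ ∈ C := by
    have := ((hγ.tendsto 0).mono_left (nhdsWithin_le_nhds (s := Ioi 0))).eventually (hC.2 _ h0)
    obtain ⟨θ, ⟨k1, k2⟩, k3⟩ := ((this.and hs0).and (Ioo_mem_nhdsGT hα)).exists
    exact ⟨θ, k3, k1 k2⟩
  have m1 : ∃ θ ∈ Ioo 0 α, γ θ ∈ C' := by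
    have := ((hγ.tendsto α).mono_left (nhdsWithin_le_nhds (s := Iio α))).eventually (hC'.2 _ h1)
    obtain ⟨θ, ⟨k1, k2⟩, k3⟩ := ((this.and hs1).and (Ioo_mem_nhdsLT hα)).exists
    exact ⟨θ, k3, k1 k2⟩
  obtain ⟨θ, hθ, hm0⟩ := m0
  obtain ⟨θ', hθ', hm1⟩ := m1
  exact hC.1.eq_of_mem hC'.1 (hC.1.subset_of_mem hpre hU hm0 ⟨θ, hθ, rfl⟩ ⟨θ', hθ', rfl⟩) hm1

/-- On a connected embedded surface, all triangles have the same component on their sides of the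
same sign. -/
theorem IsEmbedded.triSide_of_connected {p : V → E3} (hp : S.IsPolyhedral p) (he : S.IsEmbedded p)
    (hc : S.Connected) {a b c a' b' c' : V} (h : S.tri a b c) (h' : S.tri a' b' c') {σ : ℝ}
    (hσ : σ ≠ 0) {C : Set E3} (hC : S.TriSide p σ a b c C) : S.TriSide p σ a' b' c' C := by
  -- around a vertex
  have link : ∀ v x z, Relation.ReflTransGen (fun x y => S.tri v x y) x z →
      ∀ y w, S.tri v x y → S.tri v z w → S.TriSide p σ v x y C → S.TriSide p σ v z w C := by
    intro v x z hr
    induction hr with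
    | refl => intro y w h1 h2 hT; rwa [← S.tri_unique h1 h2]
    | tail _ hyz ih =>
      intro y w h1 h2 hT
      exact he.triSide_adjacent hp (S.tri_rotate (S.tri_rotate hyz)) h2 hσ
        (ih y _ h1 hyz hT).rotate.rotate
  -- along a path of edges
  have vert : ∀ v w, Relation.ReflTransGen (fun x y => ∃ z, S.tri x y z) v w →
      ∀ x y x' y', S.tri v x y → S.tri w x' y' → S.TriSide p σ v x y C →
        S.TriSide p σ w x' y' C := by
    intro v w hr
    induction hr with
    | refl => intro x y x' y' h1 h2 hT; exact link _ _ _ (S.link_connected h1 h2) _ _ h1 h2 hT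
    | tail _ hyz ih =>
      obtain ⟨z, hz⟩ := hyz
      intro x y x' y' h1 h2 hT
      have hz' := S.tri_rotate hz
      exact link _ _ _ (S.link_connected hz' h2) _ _ hz' h2 (ih x y _ z h1 hz hT).rotate
  exact vert a a' (hc a a') b c b' c' h h' hC

/-- Every component of the complement of an embedded surface contains a side of some triangle. -/
theorem IsEmbedded.exists_triSide_of_component {p : V → E3} (hp : S.IsPolyhedral p)
    (he : S.IsEmbedded p) (hne : ∃ a b c, S.tri a b c) {C : Set E3}
    (hC : IsComponent (space \ S.carrier p) C) :
    ∃ σ : ℝ, (σ = 1 ∨ σ = -1) ∧ ∃ a b c, S.tri a b c ∧ S.TriSide p σ a b c C := by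
  classical
  obtain ⟨a₀, b₀, c₀, h₀⟩ := hne
  obtain ⟨q₀, hq₀⟩ := triInt_nonempty (p a₀) (p b₀) (p c₀)
  choose X hX hXq hXa hXb using fun a b : V => exists_plane q₀ (p a) (p b)
  -- a point `x` of `C` from which `q₀` is not seen in line with a point of an edge
  obtain ⟨x, hxC, hx1, hx2⟩ : ∃ x ∈ C, (∀ a b c, S.tri a b c → sdet x (p a) (p b) (p c) ≠ 0) ∧
      ∀ a b, lor (X a b) (lift x) ≠ 0 := by
    have hopen : IsOpen C := by
      obtain ⟨y, -, rfl⟩ := hC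
      exact (S.isOpen_complement p).connectedComponentIn
    have hnon : C.Nonempty := by
      obtain ⟨y, hy, rfl⟩ := hC
      exact ⟨y, mem_connectedComponentIn hy⟩
    refine exists_mem_of_ae ?_ hopen hnon
    refine Eventually.and ?_ ?_
    · simp only [ae_all_iff]
      intro a b c h
      filter_upwards [ae_lor_ne_zero (normal_ne_zero_of_affineIndependent (hp.2 a b c h))] with x hx
      rw [sdet_eq_neg_lor]; exact neg_ne_zero.2 hx
    · simp only [ae_all_iff]
      exact fun a b => ae_lor_ne_zero (hX a b)
  have hxU := hC.subset hxC
  -- the first point `z` of the surface on the segment from `x` to `q₀`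
  have hcont : Continuous fun t : ℝ => seg x q₀ t := by unfold seg; fun_prop
  have hA : IsCompact (Icc (0 : ℝ) 1 ∩ (fun t => seg x q₀ t) ⁻¹' S.carrier p) :=
    isCompact_Icc.inter_right ((S.isCompact_carrier p).isClosed.preimage hcont)
  have hA1 : (Icc (0 : ℝ) 1 ∩ (fun t => seg x q₀ t) ⁻¹' S.carrier p).Nonempty := by
    refine ⟨1, by simp, a₀, b₀, c₀, h₀, ?_⟩
    change seg x q₀ 1 ∈ _
    rw [seg_self_one]; exact triInt_subset _ _ _ hq₀
  obtain ⟨t, ⟨ht, htc⟩, hmin⟩ := hA.exists_isLeast hA1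
  have ht0 : 0 < t := by
    refine ht.1.lt_of_ne ?_
    rintro rfl
    refine hxU.2 ?_
    simpa [seg] using htc
  have hq₀s : q₀ ∈ space := hp.hull_subset _ _ _ (triInt_subset _ _ _ hq₀)
  have hsegU : (fun s => seg x q₀ s) '' Ico 0 t ⊆ space \ S.carrier p := by
    rintro _ ⟨s, hs, rfl⟩
    refine ⟨(convex_ball _ _).segment_subset hxU.1 hq₀s
      (seg_mem_segment x q₀ ⟨hs.1, hs.2.le.trans ht.2⟩), fun hc => ?_⟩
    exact absurd (hmin ⟨⟨hs.1, hs.2.le.trans ht.2⟩, hc⟩) (not_le.2 hs.2)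
  have hsegC : (fun s => seg x q₀ s) '' Ico 0 t ⊆ C :=
    hC.subset_of_mem (isPreconnected_Ico.image _ hcont.continuousOn) hsegU hxC
      ⟨0, ⟨le_rfl, ht0⟩, by simp [seg]⟩
  obtain ⟨a, b, c, habc, hz⟩ := htc
  change seg x q₀ t ∈ _ at hz
  -- the point `z` is not on an edge
  have edge : ∀ u v : V, ∀ s r : ℝ, s + r = 1 → seg x q₀ t = s • p u + r • p v →
      q₀ = s • p u + r • p v := by
    intro u v s r hsr hzs
    have h1 : lor (X u v) (lift (seg x q₀ t)) = 0 := by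
      rw [hzs]
      obtain rfl : s = 1 - r := by linarith
      have := lor_lift_seg (X u v) (p u) (p v) r
      rw [hXa, hXb, mul_zero, mul_zero, add_zero] at this
      exact this
    rw [lor_lift_seg, hXq, mul_zero, add_zero, mul_eq_zero] at h1
    have h2 : t = 1 := by linarith [h1.resolve_right (hx2 u v)]
    rw [← hzs, h2, seg_self_one]
  obtain ⟨w₁, w₂, w₃, k1, k2, k3, hs, hzw⟩ := mem_convexHull_three.1 hz
  have hq₀' : ∀ u v w : V, S.tri u v w → ∀ s r : ℝ, s + r = 1 → 0 ≤ s → 0 ≤ r →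
      seg x q₀ t ≠ s • p u + r • p v := by
    intro u v w huvw s r hsr hs0 hr0 hzs
    have hq := edge u v s r hsr hzs
    have hmem : q₀ ∈ convexHull ℝ {p u, p v, p w} :=
      mem_convexHull_three.2 ⟨s, r, 0, hs0, hr0, le_rfl, by linarith, by rw [hq]; module⟩
    have hrot := he.rotation_of_triInt hp h₀ huvw hq₀ hmem
    have hq₀'' : q₀ ∈ triInt (p u) (p v) (p w) := by
      rcases hrot with hr | hr | hr <;> simp only [Prod.mk.injEq] at hr <;>
        obtain ⟨rfl, rfl, rfl⟩ := hr
      · exact hq₀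
      · rwa [triInt_rotate]
      · rwa [← triInt_rotate]
    obtain ⟨v₁, v₂, v₃, l1, l2, l3, ls, hv⟩ := hq₀''
    have := (AffineIndependent.weights (hp.2 u v w huvw) ls (v₁ := s) (v₂ := r) (v₃ := 0)
      (by linarith) (by rw [hv, hq]; module)).2.2
    linarith
  have hint : seg x q₀ t ∈ triInt (p a) (p b) (p c) := by
    refine ⟨w₁, w₂, w₃, k1.lt_of_ne ?_, k2.lt_of_ne ?_, k3.lt_of_ne ?_, hs, hzw⟩
    · rintro rfl
      exact hq₀' b c a (S.tri_rotate habc) w₂ w₃ (by linarith) k2 k3 (by rw [← hzw]; module)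
    · rintro rfl
      exact hq₀' c a b (S.tri_rotate (S.tri_rotate habc)) w₃ w₁ (by linarith) k3 k1
        (by rw [← hzw]; module)
    · rintro rfl
      exact hq₀' a b c habc w₁ w₂ (by linarith) k1 k2 (by rw [← hzw]; module)
  -- the segment approaches `z` from the side of `x`
  have hlin : ∀ s, t * sdet (seg x q₀ s) (p a) (p b) (p c) =
      (t - s) * sdet x (p a) (p b) (p c) := by
    intro s
    have h1 := sdet_eq_zero_of_mem hz
    rw [sdet_seg] at h1 ⊢
    linear_combination s * h1
  have hx0 := hx1 a b c habc
  obtain ⟨σ, hσ1, hσ⟩ : ∃ σ : ℝ, (σ = 1 ∨ σ = -1) ∧ 0 < σ * sdet x (p a) (p b) (p c) := by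
    rcases hx0.lt_or_gt with h | h
    · exact ⟨-1, Or.inr rfl, by linarith⟩
    · exact ⟨1, Or.inl rfl, by linarith⟩
  have hσ0 : σ ≠ 0 := left_ne_zero_of_mul hσ.ne'
  obtain ⟨C', hC', hside⟩ := he.exists_side hp habc hint hσ0
  have hev := ((hcont.tendsto t).mono_left (nhdsWithin_le_nhds (s := Iio t))).eventually hside
  obtain ⟨s, hsC', hs⟩ := (hev.and (Ioo_mem_nhdsLT ht0)).exists
  have hpos : 0 < σ * sdet (seg x q₀ s) (p a) (p b) (p c) := by
    have h1 : t * (σ * sdet (seg x q₀ s) (p a) (p b) (p c)) =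
        (t - s) * (σ * sdet x (p a) (p b) (p c)) := by linear_combination σ * hlin s
    have h2 := mul_pos (sub_pos.2 hs.2) hσ
    rw [← h1] at h2
    exact pos_of_mul_pos_right h2 ht0.le
  have hCC' : C = C' := hC.eq_of_mem hC' (hsegC ⟨s, ⟨hs.1.le, hs.2⟩, rfl⟩) (hsC' hpos)
  subst hCC'
  exact ⟨σ, hσ1, a, b, c, habc, he.triSide_of_side hp habc hint hσ0 hC hside⟩

end OrientedClosedSurface

namespace Klein

open Set Filter Topology

/-! ### Integration with respect to the hyperbolic volume -/

theorem vol_closedBall_lt_top {r : ℝ} (hr : r < 1) : vol (Metric.closedBall 0 r) < ⊤ := by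
  have hsub : Metric.closedBall (0 : E3) r ⊆ space := Metric.closedBall_subset_ball hr
  rw [vol_apply Metric.isClosed_closedBall.measurableSet hsub]
  exact ((continuousOn_density.mono hsub).integrableOn_compact
    (isCompact_closedBall 0 r)).lintegral_lt_top

theorem ae_vol {P : E3 → Prop} (h : ∀ᵐ x, P x) : ∀ᵐ x ∂vol, x ∈ space ∧ P x := by
  refine (withDensity_absolutelyContinuous _ _).ae_le ?_
  filter_upwards [ae_restrict_mem Metric.isOpen_ball.measurableSet, ae_restrict_of_ae h] with x h1 h2
  exact ⟨h1, h2⟩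

theorem vol_tetrahedron_lt_top {o a b c : E3} {r : ℝ} (hr : r < 1)
    (h : ∀ x ∈ ({o, a, b, c} : Set E3), ‖x‖ ≤ r) : vol (convexHull ℝ {o, a, b, c}) < ⊤ := by
  refine lt_of_le_of_lt (measure_mono (convexHull_min ?_ (convex_closedBall 0 r)))
    (vol_closedBall_lt_top hr)
  intro x hx
  simpa using h x hx

theorem integrable_signedInd {o a b c : E3} (h : vol (convexHull ℝ {o, a, b, c}) < ⊤) :
    Integrable (signedInd o a b c) vol := by
  refine Integrable.const_mul ?_ _
  exact (integrable_indicator_iff (measurableSet_tetrahedron o a b c)).2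
    (integrableOn_const (C := (1 : ℝ)) h.ne)

theorem integral_signedInd (o a b c : E3) : ∫ x, signedInd o a b c x ∂vol = tetVolume o a b c := by
  simp only [signedInd]
  rw [integral_const_mul, integral_indicator_one (measurableSet_tetrahedron o a b c)]
  rfl

end Klein

namespace OrientedClosedSurface

open Klein Set Filter Topology

variable {V : Type*} {S : OrientedClosedSurface V}

theorem TriSide.unique {p : V → E3} (hp : S.IsPolyhedral p) {a b c : V} (h : S.tri a b c) {σ : ℝ}
    (hσ : σ ≠ 0) {C C' : Set E3} (hC : S.TriSide p σ a b c C) (hC' : S.TriSide p σ a b c C') :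
    C = C' := by
  obtain ⟨q, hq⟩ := triInt_nonempty (p a) (p b) (p c)
  exact (hC.2 q hq).eq (hp.2 a b c h) hq hσ hC.1 hC'.1 (hC'.2 q hq)

theorem IsGeneric.not_mem_carrier {p : V → E3} {o x : E3} (h : S.IsGeneric p o x) :
    x ∉ S.carrier p := by
  rintro ⟨a, b, c, habc, hx⟩
  exact (h a b c habc).1 (sdet_eq_zero_of_mem hx)

theorem IsPolyhedral.exists_radius [Finite V] {p : V → E3} (hp : S.IsPolyhedral p) {o : E3}
    (ho : o ∈ space) : ∃ r < 1, ‖o‖ ≤ r ∧ ∀ v, ‖p v‖ ≤ r := by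
  obtain ⟨i, hi⟩ := Finite.exists_max fun i : Option V => ‖i.elim o p‖
  refine ⟨‖i.elim o p‖, ?_, hi none, fun v => hi (some v)⟩
  cases i with
  | none => simpa [space] using ho
  | some v => simpa [space] using hp.1 v

theorem norm_le_of_mem_carrier {p : V → E3} {r : ℝ} (hv : ∀ v, ‖p v‖ ≤ r) {x : E3}
    (hx : x ∈ S.carrier p) : ‖x‖ ≤ r := by
  obtain ⟨a, b, c, -, hx⟩ := hx
  have hsub : ({p a, p b, p c} : Set E3) ⊆ Metric.closedBall 0 r := by
    rintro y (rfl | rfl | rfl) <;> simp [hv]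
  simpa using convexHull_min hsub (convex_closedBall 0 r) hx

theorem IsPolyhedral.exists_unbounded [Finite V] {p : V → E3} (hp : S.IsPolyhedral p) :
    ∃ C, IsComponent (space \ S.carrier p) C ∧ ¬ ∃ r < 1, C ⊆ Metric.closedBall 0 r := by
  obtain ⟨r, hr, h0, hv⟩ := hp.exists_radius (o := 0) (by simp [space])
  rw [norm_zero] at h0
  set e : E3 := EuclideanSpace.single 0 1
  have he : ∀ t ∈ Ioo r 1, ‖t • e‖ = t := by
    intro t ht
    rw [norm_smul, Real.norm_of_nonneg (h0.trans ht.1.le)]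
    simp [e]
  have hsub : (fun t : ℝ => t • e) '' Ioo r 1 ⊆ space \ S.carrier p := by
    rintro _ ⟨t, ht, rfl⟩
    refine ⟨?_, fun hc => ?_⟩
    · simp only [space, mem_ball_zero_iff]
      rw [he t ht]; exact ht.2
    · have := norm_le_of_mem_carrier hv hc
      rw [he t ht] at this
      exact absurd ht.1 (not_lt.2 this)
  obtain ⟨t, ht⟩ := exists_between hr
  have hmem : t • e ∈ (fun t : ℝ => t • e) '' Ioo r 1 := ⟨t, ht, rfl⟩
  refine ⟨_, ⟨t • e, hsub hmem, rfl⟩, ?_⟩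
  rintro ⟨r', hr', hC⟩
  obtain ⟨t', ht'⟩ := exists_between (max_lt hr hr')
  have ht'' : t' ∈ Ioo r 1 := ⟨(le_max_left _ _).trans_lt ht'.1, ht'.2⟩
  have hpre : IsPreconnected ((fun t : ℝ => t • e) '' Ioo r 1) :=
    isPreconnected_Ioo.image _ (by fun_prop)
  have := hC (hpre.subset_connectedComponentIn hmem hsub ⟨t', ht'', rfl⟩)
  rw [mem_closedBall_zero_iff, he t' ht''] at this
  exact absurd ((le_max_right _ _).trans_lt ht'.1) (not_lt.2 this)

variable [Fintype V]

/-! ### The winding number on the components of the complement -/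

/-- Two points near `y` are joined to a third one in general position by segments which avoid the
surface. -/
theorem winding_locally_const {p : V → E3} (hp : S.IsPolyhedral p) {o : E3}
    (ho : ∀ a b c, S.tri a b c → normal o (p a) (p b) ≠ 0) {y : E3} (hy : y ∈ space \ S.carrier p) :
    ∃ k, ∀ᶠ z in 𝓝 y, S.IsGeneric p o z → S.winding p o z = k := by
  obtain ⟨δ, hδ, hB⟩ := Metric.isOpen_iff.1 (S.isOpen_complement p) y hy
  have hne : (Metric.ball y δ).Nonempty := ⟨y, Metric.mem_ball_self hδ⟩
  obtain ⟨z₀, hz₀, g₀⟩ := exists_mem_of_ae (ae_isGeneric hp ho) Metric.isOpen_ball hne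
  refine ⟨S.winding p o z₀, ?_⟩
  filter_upwards [Metric.ball_mem_nhds y hδ] with z hz g
  obtain ⟨x, hx, ⟨gx, h1⟩, h2⟩ := exists_mem_of_ae
    (((ae_isGeneric hp ho).and (ae_isGenericPair g)).and (ae_isGenericPair g₀)) Metric.isOpen_ball hne
  have hdisj : ∀ {u v}, u ∈ Metric.ball y δ → v ∈ Metric.ball y δ →
      Disjoint (segment ℝ u v) (S.carrier p) := fun hu hv =>
    disjoint_left.2 fun w hw => (hB ((convex_ball y δ).segment_subset hu hv hw)).2
  rw [winding_eq_of_segment g gx h1 (hdisj hz hx), winding_eq_of_segment g₀ gx h2 (hdisj hz₀ hx)]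

theorem winding_eq_of_component {p : V → E3} (hp : S.IsPolyhedral p) {o : E3}
    (ho : ∀ a b c, S.tri a b c → normal o (p a) (p b) ≠ 0) {C : Set E3}
    (hC : IsComponent (space \ S.carrier p) C) {z z' : E3} (hz : z ∈ C) (hz' : z' ∈ C)
    (g : S.IsGeneric p o z) (g' : S.IsGeneric p o z') : S.winding p o z = S.winding p o z' := by
  have hpre : IsPreconnected C := by
    obtain ⟨y, -, rfl⟩ := hC
    exact isPreconnected_connectedComponentIn
  obtain ⟨k, hk⟩ := winding_locally_const hp ho (hC.subset hz)
  have hk' := value_eq_of_isPreconnected hpre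
    (fun y k => ∀ᶠ z in 𝓝 y, S.IsGeneric p o z → S.winding p o z = k) (fun y hy => ?_)
    (fun y _ k k' h h' => ?_) hz hz' hk
  · rw [hk.self_of_nhds g, hk'.self_of_nhds g']
  · obtain ⟨k, hk⟩ := winding_locally_const hp ho (hC.subset hy)
    exact ⟨k, (eventually_eventually_nhds.2 hk).filter_mono nhdsWithin_le_nhds⟩
  · obtain ⟨U, hU, hUo, hyU⟩ := eventually_nhds_iff.1 (h.and h')
    obtain ⟨x, hx, gx⟩ := exists_mem_of_ae (ae_isGeneric hp ho) hUo ⟨y, hyU⟩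
    exact ((hU x hx).1 gx).symm.trans ((hU x hx).2 gx)

/-- The winding numbers on the two sides of an embedded surface differ by `1`. -/
theorem IsEmbedded.exists_winding_sub {p : V → E3} (hp : S.IsPolyhedral p) (he : S.IsEmbedded p)
    {o : E3} (ho : ∀ a b c, S.tri a b c → normal o (p a) (p b) ≠ 0) {a b c : V} (h : S.tri a b c)
    {C C' : Set E3} (hC : S.TriSide p 1 a b c C) (hC' : S.TriSide p (-1) a b c C') :
    ∃ x ∈ C, ∃ x' ∈ C', S.IsGeneric p o x ∧ S.IsGeneric p o x' ∧
      S.winding p o x - S.winding p o x' = 1 := by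
  obtain ⟨q, hq⟩ := triInt_nonempty (p a) (p b) (p c)
  have hq0 := sdet_eq_zero_of_mem (triInt_subset _ _ _ hq)
  obtain ⟨δ, hδ, hB⟩ := Metric.eventually_nhds_iff_ball.1
    ((he.eventually_near hp h hq).and ((hC.2 q hq).and (hC'.2 q hq)))
  have hopen : ∀ σ : ℝ, IsOpen (Metric.ball q δ ∩ {z | 0 < σ * sdet z (p a) (p b) (p c)}) :=
    fun σ => Metric.isOpen_ball.inter
      (isOpen_lt continuous_const (continuous_const.mul (continuous_sdet _ _ _)))
  have hne : ∀ σ : ℝ, σ ≠ 0 →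
      (Metric.ball q δ ∩ {z | 0 < σ * sdet z (p a) (p b) (p c)}).Nonempty := by
    intro σ hσ
    obtain ⟨z, h1, h2⟩ := ((frequently_side (hp.2 a b c h) hq0 hσ).and_eventually
      (Metric.ball_mem_nhds q hδ)).exists
    exact ⟨z, h2, h1⟩
  obtain ⟨x, ⟨hx, hpos⟩, g⟩ := exists_mem_of_ae (ae_isGeneric hp ho) (hopen 1) (hne 1 one_ne_zero)
  obtain ⟨x', ⟨hx', hneg⟩, g', hpair⟩ := exists_mem_of_ae
    ((ae_isGeneric hp ho).and (ae_isGenericPair g)) (hopen (-1)) (hne (-1) (by norm_num))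
  have hpos' : 0 < sdet x (p a) (p b) (p c) := by simpa using hpos
  have hneg' : sdet x' (p a) (p b) (p c) < 0 := by simpa using hneg
  have hseg := (convex_ball q δ).segment_subset hx hx'
  refine ⟨x, (hB x hx).2.1 hpos, x', (hB x' hx').2.2 hneg, g, g',
    winding_sub_of_segment g g' hpair h hpos' hneg' (fun z hz => (hB z (hseg hz)).1.2.2) ?_⟩
  exact fun a' b' c' h' hrot => disjoint_left.2 fun z hz =>
    (hB z (hseg hz)).1.2.1 a' b' c' h' hrot

theorem winding_eq_zero {p : V → E3} {o x : E3} {r : ℝ} (ho : ‖o‖ ≤ r) (hv : ∀ v, ‖p v‖ ≤ r)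
    (hx : r < ‖x‖) : S.winding p o x = 0 := by
  have h : ∀ a b c, signedInd o (p a) (p b) (p c) x = 0 := by
    intro a b c
    rw [signedInd, indicator_of_notMem, mul_zero]
    intro hmem
    have hsub : ({o, p a, p b, p c} : Set E3) ⊆ Metric.closedBall 0 r := by
      rintro y (rfl | rfl | rfl | rfl) <;> simp [ho, hv]
    have := convexHull_min hsub (convex_closedBall 0 r) hmem
    rw [mem_closedBall_zero_iff] at this
    linarith
  simp [winding, h]

/-- The winding number vanishes on unbounded components: far away no tetrahedron contains `x`. -/
theorem winding_eq_zero_of_unbounded {p : V → E3} (hp : S.IsPolyhedral p) {o : E3} (hos : o ∈ space)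
    (ho : ∀ a b c, S.tri a b c → normal o (p a) (p b) ≠ 0) {C : Set E3}
    (hC : IsComponent (space \ S.carrier p) C) (hunb : ¬ ∃ r < 1, C ⊆ Metric.closedBall 0 r) {x : E3}
    (hx : x ∈ C) (g : S.IsGeneric p o x) : S.winding p o x = 0 := by
  obtain ⟨r, hr, hor, hv⟩ := hp.exists_radius hos
  have hopen : IsOpen C := by
    obtain ⟨y, -, rfl⟩ := hC
    exact (S.isOpen_complement p).connectedComponentIn
  have hne : (C ∩ (Metric.closedBall 0 r)ᶜ).Nonempty := by
    by_contra hcon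
    refine hunb ⟨r, hr, fun y hy => ?_⟩
    by_contra hy'
    exact hcon ⟨y, hy, hy'⟩
  obtain ⟨z, ⟨hz, hzr⟩, gz⟩ := exists_mem_of_ae (ae_isGeneric hp ho)
    (hopen.inter Metric.isClosed_closedBall.isOpen_compl) hne
  rw [winding_eq_of_component hp ho hC hx hz g gz]
  refine winding_eq_zero hor hv ?_
  simpa using hzr

/-- For a connected embedded surface, up to a global sign the winding number is the indicator
function of the enclosed domain, which is a bounded component of the complement. -/
theorem IsEmbedded.winding_eq {p : V → E3} (hp : S.IsPolyhedral p) (he : S.IsEmbedded p)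
    (hc : S.Connected) [Nonempty V] {o : E3} (hos : o ∈ space)
    (ho : ∀ a b c, S.tri a b c → normal o (p a) (p b) ≠ 0) :
    IsOpen (enclosed (S.carrier p)) ∧ (∃ r < 1, enclosed (S.carrier p) ⊆ Metric.closedBall 0 r) ∧
    ∃ ε : ℝ, |ε| = 1 ∧ ∀ x ∈ space, S.IsGeneric p o x →
      S.winding p o x = ε * (enclosed (S.carrier p)).indicator 1 x := by
  obtain ⟨a⟩ := ‹Nonempty V›
  obtain ⟨b, c, h⟩ := S.vertex_mem a
  have h11 : (-1 : ℝ) ≠ 0 := by norm_num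
  obtain ⟨C, hC⟩ := he.exists_triSide hp h (σ := 1) one_ne_zero
  obtain ⟨C', hC'⟩ := he.exists_triSide hp h (σ := -1) h11
  have hall : ∀ D, IsComponent (space \ S.carrier p) D → D = C ∨ D = C' := by
    intro D hD
    obtain ⟨σ, hσ, a', b', c', h', hD'⟩ := he.exists_triSide_of_component hp ⟨a, b, c, h⟩ hD
    rcases hσ with rfl | rfl
    · exact Or.inl ((he.triSide_of_connected hp hc h' h one_ne_zero hD').unique hp h one_ne_zero hC)
    · exact Or.inr ((he.triSide_of_connected hp hc h' h h11 hD').unique hp h h11 hC')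
  obtain ⟨y, hy, y', hy', g, g', hjump⟩ := he.exists_winding_sub hp ho h hC hC'
  -- `D` is the component on which the winding number does not vanish
  have key : ∀ D D' : Set E3, IsComponent (space \ S.carrier p) D →
      IsComponent (space \ S.carrier p) D' →
      (∀ E, IsComponent (space \ S.carrier p) E → E = D ∨ E = D') →
      (¬ ∃ r < 1, D' ⊆ Metric.closedBall 0 r) → ∀ y ∈ D, S.IsGeneric p o y →
      |S.winding p o y| = 1 →
      IsOpen (enclosed (S.carrier p)) ∧ (∃ r < 1, enclosed (S.carrier p) ⊆ Metric.closedBall 0 r) ∧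
      ∃ ε : ℝ, |ε| = 1 ∧ ∀ x ∈ space, S.IsGeneric p o x →
        S.winding p o x = ε * (enclosed (S.carrier p)).indicator 1 x := by
    intro D D' hD hD' hDD' hunb y hy g hw
    have hbdd : ∃ r < 1, D ⊆ Metric.closedBall 0 r := by
      by_contra hcon
      rw [winding_eq_zero_of_unbounded hp hos ho hD hcon hy g] at hw
      simp at hw
    have henc : enclosed (S.carrier p) = D := by
      ext x
      constructor
      · rintro ⟨hxU, hx⟩
        rcases hDD' _ ⟨x, hxU, rfl⟩ with e | e
        · rw [← e]; exact mem_connectedComponentIn hxU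
        · rw [e] at hx; exact absurd hx hunb
      · intro hx
        have hxU := hD.subset hx
        have e := hD.eq_of_mem ⟨x, hxU, rfl⟩ hx (mem_connectedComponentIn hxU)
        exact ⟨hxU, e ▸ hbdd⟩
    rw [henc]
    refine ⟨?_, hbdd, S.winding p o y, hw, fun x hx gx => ?_⟩
    · obtain ⟨z, -, rfl⟩ := hD
      exact (S.isOpen_complement p).connectedComponentIn
    · by_cases hxD : x ∈ D
      · rw [indicator_of_mem hxD, winding_eq_of_component hp ho hD hxD hy gx g]; simp
      · have hxU : x ∈ space \ S.carrier p := ⟨hx, gx.not_mem_carrier⟩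
        rw [indicator_of_notMem hxD, mul_zero]
        have hxm := mem_connectedComponentIn hxU
        rcases hDD' _ ⟨x, hxU, rfl⟩ with e | e
        · exact absurd (e ▸ hxm) hxD
        · exact winding_eq_zero_of_unbounded hp hos ho hD' hunb (e ▸ hxm) gx
  obtain ⟨E, hE, hunb⟩ := hp.exists_unbounded
  rcases hall E hE with rfl | rfl
  · refine key C' E hC'.1 hE (fun F hF => (hall F hF).symm) hunb y' hy' g' ?_
    rw [winding_eq_zero_of_unbounded hp hos ho hE hunb hy g] at hjump
    rw [show S.winding p o y' = -1 by linarith]; simp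
  · refine key C E hC.1 hE hall hunb y hy g ?_
    rw [winding_eq_zero_of_unbounded hp hos ho hE hunb hy' g'] at hjump
    rw [show S.winding p o y = 1 by linarith]; simp

/-! ### The enclosed volume -/

open Classical in
theorem integral_winding {p : V → E3} (hp : S.IsPolyhedral p) {o : E3} (ho : o ∈ space) :
    ∫ x, S.winding p o x ∂vol =
      (∑ a, ∑ b, ∑ c, if S.tri a b c then tetVolume o (p a) (p b) (p c) else 0) / 3 := by
  obtain ⟨r, hr, hor, hv⟩ := hp.exists_radius ho
  have hint : ∀ a b c, Integrable
      (fun x => if S.tri a b c then signedInd o (p a) (p b) (p c) x else 0) vol := by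
    intro a b c
    split_ifs
    · refine integrable_signedInd (vol_tetrahedron_lt_top hr ?_)
      rintro x (rfl | rfl | rfl | rfl) <;> simp [hor, hv]
    · exact integrable_zero _ _ _
  simp only [winding]
  rw [integral_div, integral_finsetSum _ fun a _ => integrable_finsetSum _ fun b _ =>
    integrable_finsetSum _ fun c _ => hint a b c]
  congr 1
  refine Finset.sum_congr rfl fun a _ => ?_
  rw [integral_finsetSum _ fun b _ => integrable_finsetSum _ fun c _ => hint a b c]
  refine Finset.sum_congr rfl fun b _ => ?_
  rw [integral_finsetSum _ fun c _ => hint a b c]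
  refine Finset.sum_congr rfl fun c _ => ?_
  split_ifs
  · exact integral_signedInd _ _ _ _
  · exact integral_zero _ _

/-- The oriented volume of a connected embedded surface is, up to sign, the volume of the enclosed
domain. -/
theorem IsEmbedded.enclosedVolume_eq {p : V → E3} (hp : S.IsPolyhedral p) (he : S.IsEmbedded p)
    (hc : S.Connected) [Nonempty V] :
    S.enclosedVolume p = ENNReal.ofReal |S.orientedVolume p| := by
  classical
  have hae : ∀ᵐ o : E3, ∀ a b c, S.tri a b c → normal o (p a) (p b) ≠ 0 := by
    simp only [ae_all_iff]
    intro a b c h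
    filter_upwards [ae_lor_ne_zero (normal_ne_zero_of_affineIndependent (hp.2 a b c h))] with o ho h0
    rw [← neg_ne_zero, ← sdet_eq_neg_lor, sdet_eq_lor, h0] at ho
    simp [lor] at ho
  set G : E3 → ℝ := fun o =>
    |(∑ a, ∑ b, ∑ c, if S.tri a b c then tetVolume o (p a) (p b) (p c) else 0) / 3| with hG
  have hG0 : G 0 = |S.orientedVolume p| := by
    simp only [hG, tetVolume_zero]; rfl
  have hgen : ∀ o ∈ space, (∀ a b c, S.tri a b c → normal o (p a) (p b) ≠ 0) →
      G o = (S.enclosedVolume p).toReal := by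
    intro o hos ho
    obtain ⟨hopen, -, ε, hε, hw⟩ := he.winding_eq hp hc hos ho
    simp only [hG]
    rw [← integral_winding hp hos]
    have : ∫ x, S.winding p o x ∂vol =
        ∫ x, ε * (enclosed (S.carrier p)).indicator 1 x ∂vol := by
      refine integral_congr_ae ?_
      filter_upwards [ae_vol (ae_isGeneric hp ho)] with x hx
      exact hw x hx.1 hx.2
    rw [this, integral_const_mul, integral_indicator_one hopen.measurableSet, abs_mul, hε, one_mul,
      abs_of_nonneg measureReal_nonneg]
    rfl
  have h0s : (0 : E3) ∈ space := by simp [space]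
  have hcont : ContinuousOn G space := by
    refine ContinuousOn.abs (ContinuousOn.div_const ?_ _)
    refine continuousOn_finsetSum _ fun a _ => continuousOn_finsetSum _ fun b _ =>
      continuousOn_finsetSum _ fun c _ => ?_
    split_ifs
    · exact continuousOn_tetVolume (hp.1 a) (hp.1 b) (hp.1 c)
    · exact continuousOn_const
  -- the apex `0` need not be in general position, but it is a limit of such points
  have hlim : G 0 = (S.enclosedVolume p).toReal := by
    by_contra hne
    have hev := (hcont.continuousAt (Metric.isOpen_ball.mem_nhds h0s)).eventually
      (isOpen_ne.mem_nhds hne)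
    obtain ⟨U, hU, hUo, h0U⟩ := eventually_nhds_iff.1
      (hev.and (Metric.isOpen_ball.mem_nhds h0s))
    obtain ⟨o, ho, ho'⟩ := exists_mem_of_ae hae hUo ⟨0, h0U⟩
    exact (hU o ho).1 (hgen o (hU o ho).2 ho')
  have hfin : S.enclosedVolume p ≠ ⊤ := by
    obtain ⟨o, hos, ho⟩ := exists_mem_of_ae hae Metric.isOpen_ball ⟨0, h0s⟩
    obtain ⟨-, ⟨r, hr, hsub⟩, -⟩ := he.winding_eq hp hc hos ho
    exact ((measure_mono hsub).trans_lt (vol_closedBall_lt_top hr)).ne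
  rw [← hG0, hlim, ENNReal.ofReal_toReal hfin]

end OrientedClosedSurface

end

theorem theorem2 {V : Type*} [Fintype V] (S : OrientedClosedSurface V)
    (I : Set ℝ) (hI : I.OrdConnected) (p : ℝ → V → Klein.E3)
    (hpoly : ∀ t ∈ I, S.IsPolyhedral (p t))
    (hsmooth : ∀ v, ContDiffOn ℝ ∞ (fun t => p t v) I)
    (hangle : ∀ a b c d, S.tri a b c → S.tri b a d → ∀ s ∈ I, ∀ t ∈ I,
      Klein.dihedralAngle (p s a) (p s b) (p s c) (p s d) =
        Klein.dihedralAngle (p t a) (p t b) (p t c) (p t d)) :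
    (∀ s ∈ I, ∀ t ∈ I, S.orientedVolume (p s) = S.orientedVolume (p t)) ∧
    (S.Connected → ∀ s ∈ I, ∀ t ∈ I, S.IsEmbedded (p s) → S.IsEmbedded (p t) →
      S.enclosedVolume (p s) = S.enclosedVolume (p t)) := by
  have hvol : ∀ s ∈ I, ∀ t ∈ I, S.orientedVolume (p s) = S.orientedVolume (p t) :=
    fun s hs t ht => S.orientedVolume_eq hI hpoly
      (fun v => (hsmooth v).of_le (by exact_mod_cast le_top)) hangle hs ht
  refine ⟨hvol, fun hc s hs t ht hes het => ?_⟩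
  rcases isEmpty_or_nonempty V with hV | hV
  · rw [Subsingleton.elim (p s) (p t)]
  · rw [hes.enclosedVolume_eq (hpoly s hs) hc, het.enclosedVolume_eq (hpoly t ht) hc, hvol s hs t ht]
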